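/- **Setting.** Let $p=p(\varrho,s)$ be a smooth equation of state with $\partial_\varrho p>0$ for $\varrho>0$, let $\bar\varrho>0$ be a constant, and regard $c=\sqrt{\partial_\varrho p}$ and $p_{;s}=\partial_s p$ as functions of $(\rho,s)$, $\rho=\ln(\varrho/\bar\varrho)$. Greek indices run over $0,\dots,3$ ($x^0=t$), Latin ones over $1,2,3$. Consider smooth solutions of the compressible Euler equations $B\rho=-\partial_av^a$, $Bv^i=-c^2\partial_i\rho-e^{-\rho}\frac{p_{;s}}{\bar\varrho}\partial_is$, $Bs=0$, with $B=\partial_t+v^a\partial_a$. Put $\Psi=(\rho,v^1,v^2,v^3,s)$, $\Omega^i=e^{-\rho}(\mathrm{curl}\,v)^i$, $S^i=\partial_is$, $\Omega^0=S^0=0$, and $$\mathcal C^i=e^{-\rho}(\mathrm{curl}\,\Omega)^i+e^{-3\rho}c^{-2}\tfrac{p_{;s}}{\bar\varrho}\bigl(S^a\partial_av^i-(\partial_av^a)S^i\bigr),\qquad \mathcal C^0=0.$$ The acoustical metric is $\mathbf g=-dt^2+c^{-2}\sum_a(dx^a-v^adt)^2$; its inverse is $\mathbf g^{-1}=-B\otimes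 B+c^2\sum_a\partial_a\otimes\partial_a$. Indices are lowered and raised with $\mathbf g$; $\epsilon_{\alpha\beta\gamma\delta}$ is the antisymmetric symbol with $\epsilon_{0123}=1$. Let $\tau$ be a smooth function on an open connected $\mathscr O\subset\mathbb R^{1+3}$ with $\mathbf g^{-1}(d\tau,d\tau)<0$ and $B\tau>0$, and let $\mathcal M\subset\mathscr O$ be a compact connected region with corners, foliated by $\widetilde\Sigma_\theta=\mathcal M\cap\{\tau=\theta\}$, $0\le\theta\le T$, $T>0$, each diffeomorphic to a closed ball, with $\partial\mathcal M=\widetilde\Sigma_0\cup\widetilde\Sigma_T\cup\underline{\mathcal H}$, where $\underline{\mathcal H}$ is the intersection of $\mathcal M$ with a smooth embedded hypersurface transversal to the level sets of $\tau$ and is either $\mathbf g$-spacelike everywhere or $\mathbf g$-null everywhere. Let $\mathcal S_\tau=\underline{\mathcal H}\cap\widetilde\Sigma_\tau$. Along $\underline{\mathcal H}$, let $N$ and $\underline N$ be the $\mathbf g$-normals of $\widetilde\Sigma_\tau$ and of $\underline{\mathcal H}$ with $Nt=\underline Nt=1$; $Z$ the outer $\mathbf g$-unit normal of $\mathcal S_\tau$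 in $\widetilde\Sigma_\tau$; $\underline H$ the vectorfield tangent to $\underline{\mathcal H}$, $\mathbf g$-orthogonal to $\mathcal S_\tau$, with $\underline Ht=1$ (assumed to exist). Assume $\underline z:=-\mathbf g(Z,\underline N)>0$ and $\underline h:=-\mathbf g(\underline H,N)>0$. Put $\ell=1/(\underline H\tau)$, $\underline\eta=\mathbf g(\underline H,\underline H)^{1/2}$, $\nu=(-\mathbf g(N,N))^{1/2}$, $\underline\nu=(-\mathbf g(\underline N,\underline N))^{1/2}$, $\hat N=N/\nu$, and $$\Theta=B-\underline h^{-1}\underline H-\underline z^{-1}Z,\quad \underline E=B-\underline z^{-1}Z,\quad P=\underline h^{-1}(\underline N-N),\quad \lambda_\alpha=\partial_\alpha+\underline N_\alpha B-P_\alpha\underline H,$$ $$k=\underline h^{-1}(S^a\underline N_a-S^aN_a),\quad U=S+(S^a\underline N_a)B-k\underline H,\quad Y=k\Theta-\underline h^{-1}U.$$ Let $\slashed g_{\alpha\beta}=\mathbf g_{\alpha\beta}+\hat N_\alpha\hat N_\beta-Z_\alpha Z_\beta$, with $\slashed g^{-1}$ and the projection $\slashed\Pi$ onto $\mathcal S_\tau$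 obtained by raising indices; $\slashed V=\slashed\Pi V$, $\slashed\partial_\alpha=\slashed\Pi^\beta_{\ \alpha}\partial_\beta$, and $\slashed{\mathrm{div}}$ the divergence on $\mathcal S_\tau$. In the spacelike case let $\underline\partial_\alpha=\underline\Pi^\beta_{\ \alpha}\partial_\beta$, $\underline\Pi^\alpha_{\ \beta}=\delta^\alpha_\beta+\underline\nu^{-2}\underline N^\alpha\underline N_\beta$, be the projection of $\partial_\alpha$ onto $\underline{\mathcal H}$. **Error integrands.** For $V\in\{\Omega,S\}$, $$\begin{aligned}\mathfrak H[V]={}&\tfrac12\tfrac{\underline z}{\underline h\ell}|\slashed V|^2_{\slashed g}(\slashed g^{-1})^{\alpha\beta}\mathcal L_{\ell\underline H}\slashed g_{\alpha\beta}+\Bigl\{\ell\underline H\bigl[\tfrac{\underline z}{\underline h\ell}(\slashed g^{-1})^{\alpha\beta}\bigr]\Bigr\}V_\alpha V_\beta+\bigl\{\Theta[\underline z(\slashed g^{-1})^{\alpha\beta}]\bigr\}V_\alpha V_\beta-2V_\alpha\slashed VB^\alpha\\&+\underline z|\slashed V|^2_{\slashed g}\slashed{\mathrm{div}}\,\Theta+Z_\alpha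 V^\alpha V^\beta\slashed{\mathrm{div}}\,\slashed\partial_\beta+V^\alpha Z^\beta\slashed V\mathbf g_{\alpha\beta}+V_\alpha\slashed VZ^\alpha,\end{aligned}$$ $$\mathfrak H_{(2)}[S]=4\underline zS_\alpha\underline E^\alpha\slashed S\ln c-4\underline z|\slashed S|^2_{\slashed g}\underline E\ln c,$$ and, with $\mathsf q=p_{;s}/\bar\varrho$, $\epsilon(X_1,X_2,X_3,X_4)=\epsilon_{\alpha\beta\gamma\delta}X_1^\alpha X_2^\beta X_3^\gamma X_4^\delta$, $\sigma=\mathrm{sgn}\,\epsilon(\underline E,\slashed\Omega,\underline N,S+(S^a\underline N_a)B)$ ($\mathrm{sgn}\,0=0$), $G$ the determinant of the Gram matrix of $(\slashed\Omega,Y)$ for $\slashed g$, and spatial vectors written $(w^i)_i$, $$\begin{aligned}\mathfrak H_{(1)}[\Omega]={}&2\sigma\underline zc^{-1}e^{-2\rho}\mathsf q\tfrac{\underline h+\underline\eta^2}{\sqrt{\underline h^2+\underline\eta^2\nu^2}}\sqrt G\,\bigl\{P_a\underline Hv^a+\underline N_aP^a\underline H\rho+\lambda_av^a+c^2\textstyle\sum_a\underline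 N_a\lambda_a\rho+e^{-\rho}\mathsf q\,\underline N_aS^a\bigr\}\\&+4\underline z\Omega_\alpha\underline E^\alpha\slashed\Omega\ln c-4\underline z|\slashed\Omega|^2_{\slashed g}\underline E\ln c+4\underline z\underline E^0\Omega_a\slashed\Omega v^a-4\underline z\slashed\Omega^0\Omega_a\underline Ev^a\\&+2\underline zc^{-4}e^{-2\rho}\mathsf q\bigl[\epsilon(\underline E,\slashed\Omega,P,S)-S^a\underline N_a\,\epsilon(\underline E,\slashed\Omega,B,P)\bigr]\underline H\rho\\&+2\underline zc^{-2}e^{-2\rho}\mathsf q\bigl[\epsilon(\underline E,\slashed\Omega,(\lambda_i\rho)_i,S)-S^a\underline N_a\,\epsilon(\underline E,\slashed\Omega,B,(\lambda_i\rho)_i)\bigr]\\&-2\underline zc^{-4}e^{-2\rho}\mathsf q\bigl[S^aP_a\,\epsilon(\underline E,\slashed\Omega,B,(\underline Hv^i)_i)+\epsilon(\underline E,\slashed\Omega,B,(S^a\lambda_av^i)_i)\bigr]\\&+2\underline zc^{-2}e^{\rho}\epsilon(\underline E,\slashed\Omega,B,\mathcal C)-2\underline zc^{-4}e^{-3\rho}\mathsf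 q^2S^a\underline N_a\,\epsilon(\underline E,\slashed\Omega,B,S).\end{aligned}$$ **Notation.** $\mathscr L(A)[b]$ denotes any linear combination of the elements of the array $b$ whose coefficients are functions of the array $A$ of Cartesian components, continuous on an open set containing all values of $A$ that occur. For a fixed equation of state and $\bar\varrho$, the coefficient functions and the open sets are the same for all solutions, time functions, regions and boundary points. **Theorem.** (1) If $\underline{\mathcal H}$ is $\mathbf g$-spacelike, then along $\underline{\mathcal H}$ $$\mathfrak H[\Omega],\ \mathfrak H[S]=\mathscr L(\Psi,\Omega,S,\underline H,Z,\partial\tau)[\underline\partial\Psi,\underline\partial\,\underline H,\underline\partial Z,\underline\partial\partial\tau]+\mathscr L(\Psi,\Omega,S,\underline H,Z,\partial\tau)[\Omega,S,\mathcal C],$$ $$\mathfrak H_{(1)}[\Omega],\ \mathfrak H_{(2)}[S]=\mathscr L(\Psi,\Omega,S,\underline H,Z,\partial\tau)[\underline\partial\Psi,\slashed\partial\,\underline H,\underline\partial Z,\underline\partial\partial\tau]+\mathscr L(\Psi,\Omega,S,\underline H,Z,\partial\tau)[\Omega,S,\mathcal C].$$ In particular only derivatives tangent to $\underline{\mathcal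 H}$ appear. (2) If $\underline{\mathcal H}$ is $\mathbf g$-null, then $\underline N=\underline H=:\underline L$, and along $\underline{\mathcal H}$ $$\begin{aligned}\mathfrak H[\Omega],\ \mathfrak H[S]={}&\mathscr L(\Psi,\Omega,S,\underline L,N)[\underline L\Psi,\slashed\partial\Psi,\slashed\partial\,\underline L,\underline LZ,\slashed\partial Z]+\mathscr L(\Psi,\Omega,S,\underline L,N,\partial\tau)[\underline L\partial\tau]\\&+\mathscr L(\Psi,\Omega,S,\underline L,N)[\Omega,S,\mathcal C],\end{aligned}$$ $$\mathfrak H_{(1)}[\Omega],\ \mathfrak H_{(2)}[S]=\mathscr L(\Psi,\Omega,S,\underline L,N)[\underline L\Psi,\slashed\partial\Psi,\slashed\partial\,\underline L,\underline LZ,\slashed\partial Z]+\mathscr L(\Psi,\Omega,S,\underline L,N)[\Omega,S,\mathcal C].$$ So only $\underline L$-derivatives and sphere-derivatives appear; the term in $\underline L\partial\tau$ is absent when $\tau=t$. -/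

import Mathlib

open scoped ContDiff Topology

noncomputable section

namespace EulerBoundary

/-- Spacetime `ℝ^{1+3}` with its Cartesian coordinates `x^0 = t, x^1, x^2, x^3`; vectors are given by
their Cartesian components. A spatial index `a : Fin 3` is the spacetime index `a.succ`. -/
abbrev Vec := Fin 4 → ℝ

/-- An equation of state `p = p(ϱ, s)`, with the background density `ϱ̄ > 0`, such that the speed of
sound is positive whenever the density is. -/
structure EquationOfState where
  p : ℝ → ℝ → ℝ
  rhoBar : ℝ
  rhoBar_pos : 0 < rhoBar
  smooth : ContDiffOn ℝ ∞ (Function.uncurry p) {q : ℝ × ℝ | 0 < q.1}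
  hyperbolic : ∀ r s : ℝ, 0 < r → 0 < deriv (fun r' => p r' s) r

namespace EquationOfState

/-- The speed of sound `c = (∂p/∂ϱ)^{1/2}` as a function of the logarithmic density `ρ = ln (ϱ/ϱ̄)`
and the entropy. -/
def c (e : EquationOfState) (rho s : ℝ) : ℝ :=
  Real.sqrt (deriv (fun r => e.p r s) (e.rhoBar * Real.exp rho))

/-- `p_{;s}`: the derivative of the pressure with respect to the entropy, as a function of `(ρ, s)`. -/
def pS (e : EquationOfState) (rho s : ℝ) : ℝ :=
  deriv (fun s' => e.p (e.rhoBar * Real.exp rho) s') s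

end EquationOfState

/-- The derivative of a scalar function in the direction `X` at `x`. -/
def dir (X : Vec) (f : Vec → ℝ) (x : Vec) : ℝ := fderiv ℝ f x X

/-- The Cartesian coordinate vector `∂_α`. -/
def coordVec (α : Fin 4) : Vec := Pi.single α 1

/-- The Cartesian partial derivative `∂_α f`. -/
def pd (α : Fin 4) (f : Vec → ℝ) (x : Vec) : ℝ := dir (coordVec α) f x

/-- The contraction `ε_{αβγδ} X^α Y^β Z^γ W^δ`, where `ε_{0123} = 1`. -/
def eps (X Y Z W : Vec) : ℝ := Matrix.det (Matrix.of ![X, Y, Z, W])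

/-- The raw data: fluid variables (logarithmic density, velocity, entropy), the open set on which
everything is defined, the time function, the height `T`, the spacetime region `M` and its lateral
boundary `H`. -/
structure Config where
  rho : Vec → ℝ
  v : Fin 3 → Vec → ℝ
  s : Vec → ℝ
  O : Set Vec
  tau : Vec → ℝ
  T : ℝ
  M : Set Vec
  H : Set Vec

section Quantities

variable (e : EquationOfState) (D : Config)

/-! ### Fluid variables -/

/-- The array `Ψ = (ρ, v^1, v^2, v^3, s)`. -/
def Psi : Fin 5 → Vec → ℝ := ![D.rho, D.v 0, D.v 1, D.v 2, D.s]

/-- The speed of sound along the solution. -/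
def snd (x : Vec) : ℝ := e.c (D.rho x) (D.s x)

/-- `p_{;s} / ϱ̄` along the solution. -/
def pSbar (x : Vec) : ℝ := e.pS (D.rho x) (D.s x) / e.rhoBar

/-- The material derivative vectorfield `B = ∂_t + v^a ∂_a`. -/
def B (x : Vec) : Vec := Fin.cons 1 fun i => D.v i x

/-- The Euclidean divergence of the velocity. -/
def divV (x : Vec) : ℝ := ∑ a : Fin 3, pd a.succ (D.v a) x

/-- The Euclidean curl of a spatial vectorfield. The index arithmetic is modulo three. -/
def curl (V : Fin 3 → Vec → ℝ) (i : Fin 3) (x : Vec) : ℝ :=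
  pd (i + 1).succ (V (i + 2)) x - pd (i + 2).succ (V (i + 1)) x

/-- The specific vorticity `Ω^i = (curl v)^i / exp ρ`. -/
def Om (i : Fin 3) (x : Vec) : ℝ := curl D.v i x / Real.exp (D.rho x)

/-- The entropy gradient `S^i = ∂_i s`. -/
def S (i : Fin 3) (x : Vec) : ℝ := pd i.succ D.s x

/-- The modified fluid variable `𝒞`. -/
def modC (i : Fin 3) (x : Vec) : ℝ :=
  Real.exp (-D.rho x) * curl (Om D) i x
    + Real.exp (-3 * D.rho x) * (snd e D x ^ 2)⁻¹ * pSbar e D x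
        * ∑ a : Fin 3, S D a x * pd a.succ (D.v i) x
    - Real.exp (-3 * D.rho x) * (snd e D x ^ 2)⁻¹ * pSbar e D x * divV D x * S D i x

/-- A `Σ_t`-tangent vector with the given spatial components. -/
def spatial (w : Fin 3 → ℝ) : Vec := Fin.cons 0 w

/-- `Ω` as a spacetime vector. -/
def OmVec (x : Vec) : Vec := spatial fun i => Om D i x

/-- `S` as a spacetime vector. -/
def SVec (x : Vec) : Vec := spatial fun i => S D i x

/-- `𝒞` as a spacetime vector. -/
def CVec (x : Vec) : Vec := spatial fun i => modC e D i x

/-- The compressible Euler equations hold at the point `x`. -/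
def EulerAt (x : Vec) : Prop :=
  dir (B D x) D.rho x = -divV D x ∧
  (∀ i : Fin 3, dir (B D x) (D.v i) x =
    -(snd e D x) ^ 2 * pd i.succ D.rho x
      - Real.exp (-D.rho x) * pSbar e D x * pd i.succ D.s x) ∧
  dir (B D x) D.s x = 0

/-! ### The acoustical metric -/

/-- The one-form `dx^a - v^a dt`. -/
def coframe (a : Fin 3) (x : Vec) (α : Fin 4) : ℝ :=
  (if α = a.succ then 1 else 0) - D.v a x * (if α = 0 then 1 else 0)

/-- The acoustical metric `g = - dt ⊗ dt + c^{-2} ∑_a (dx^a - v^a dt) ⊗ (dx^a - v^a dt)`. -/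
def gLow (x : Vec) (α β : Fin 4) : ℝ :=
  -((if α = 0 then 1 else 0) * (if β = 0 then 1 else 0))
    + (snd e D x ^ 2)⁻¹ * ∑ a : Fin 3, coframe D a x α * coframe D a x β

/-- The inverse acoustical metric `g^{-1} = - B ⊗ B + c^2 ∑_a ∂_a ⊗ ∂_a`. -/
def gUp (x : Vec) (α β : Fin 4) : ℝ :=
  -(B D x α * B D x β)
    + snd e D x ^ 2 * ∑ a : Fin 3, (if α = a.succ then 1 else 0) * (if β = a.succ then 1 else 0)

/-- Lowering an index: `X_α = g_{αβ} X^β`. -/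
def low (x : Vec) (X : Vec) (α : Fin 4) : ℝ := ∑ β, gLow e D x α β * X β

/-- `g(X, Y)`. -/
def ip (x : Vec) (X Y : Vec) : ℝ := ∑ α, ∑ β, gLow e D x α β * X α * Y β

/-- The Christoffel symbol `Γ_β^α_γ` of `g`. -/
def christoffel (x : Vec) (β α γ : Fin 4) : ℝ :=
  (1 / 2) * ∑ κ, gUp e D x α κ *
    (pd β (fun y => gLow e D y κ γ) x + pd γ (fun y => gLow e D y β κ) x
      - pd κ (fun y => gLow e D y β γ) x)

/-! ### The geometry of the lateral boundary -/

/-- The portion `Σ̃_θ = M ∩ {τ = θ}`. -/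
def SigmaTilde (θ : ℝ) : Set Vec := {x | x ∈ D.M ∧ D.tau x = θ}

/-- The tangent space of the lateral boundary `H` at `x`. -/
def TH (x : Vec) : Submodule ℝ Vec := Submodule.span ℝ (tangentConeAt ℝ D.H x)

/-- Tangency to the sphere `S_τ = H ∩ Σ̃_τ` through `x` (a transversal intersection). -/
def SphereTangent (x X : Vec) : Prop := X ∈ TH D x ∧ dir X D.tau x = 0

/-- The derivative at `x ∈ H`, in a direction `X` tangent to `H`, of a function given along `H`. -/
def along (X : Vec) (f : Vec → ℝ) (x : Vec) : ℝ := fderivWithin ℝ f D.H x X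

/-- `n` is a `g`-normal of `H` at `x`. -/
def IsNormal (x n : Vec) : Prop := ∀ X ∈ TH D x, ip e D x n X = 0

/-- `H` is `g`-spacelike: its nonzero `g`-normals are `g`-timelike. -/
def IsSpacelike : Prop :=
  ∀ x ∈ D.H, ∀ n : Vec, n ≠ 0 → IsNormal e D x n → ip e D x n n < 0

/-- `H` is `g`-null: its nonzero `g`-normals are `g`-null. -/
def IsNull : Prop :=
  ∀ x ∈ D.H, ∀ n : Vec, n ≠ 0 → IsNormal e D x n → ip e D x n n = 0

/-- `N`, the `g`-normal of `Σ̃_τ` with `N t = 1`: `N^α = - (g^{-1})^{αβ} ∂_β τ / B τ`. -/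
def N (x : Vec) : Vec :=
  fun α => -(∑ β, gUp e D x α β * pd β D.tau x) / dir (B D x) D.tau x

/-- `N̲`, the `g`-normal of `H` with `N̲ t = 1`. -/
def Nbar (x : Vec) : Vec := Classical.epsilon fun n : Vec => IsNormal e D x n ∧ n 0 = 1

/-- The defining property of `Z`: the outward `g`-unit normal to `S_τ` in `Σ̃_τ`. -/
def IsOuterNormal (x X : Vec) : Prop :=
  dir X D.tau x = 0 ∧ (∀ Y, SphereTangent D x Y → ip e D x X Y = 0) ∧ ip e D x X X = 1 ∧
    X ∉ posTangentConeAt (SigmaTilde D (D.tau x)) x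

/-- The vectorfield `Z`. -/
def Z (x : Vec) : Vec := Classical.epsilon fun X : Vec => IsOuterNormal e D x X

/-- The defining property of `H̲`: tangent to `H`, `g`-orthogonal to `S_τ`, and `H̲ t = 1`. -/
def IsGenerator (x X : Vec) : Prop :=
  X ∈ TH D x ∧ (∀ Y, SphereTangent D x Y → ip e D x X Y = 0) ∧ X 0 = 1

/-- The vectorfield `H̲`. -/
def Hbar (x : Vec) : Vec := Classical.epsilon fun X : Vec => IsGenerator e D x X

/-- `z̲ = - g(Z, N̲)`. -/
def zbar (x : Vec) : ℝ := -ip e D x (Z e D x) (Nbar e D x)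

/-- `h̲ = - g(H̲, N)`. -/
def hbar (x : Vec) : ℝ := -ip e D x (Hbar e D x) (N e D x)

/-- The lapse `1 / (H̲ τ)`. -/
def lapse (x : Vec) : ℝ := 1 / dir (Hbar e D x) D.tau x

/-- `η̲ = g(H̲, H̲)^{1/2}`. -/
def etabar (x : Vec) : ℝ := Real.sqrt (ip e D x (Hbar e D x) (Hbar e D x))

/-- `ν = (-g(N, N))^{1/2}`. -/
def nu (x : Vec) : ℝ := Real.sqrt (-ip e D x (N e D x) (N e D x))

/-- `ν̲ = (-g(N̲, N̲))^{1/2}`. -/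
def nubar (x : Vec) : ℝ := Real.sqrt (-ip e D x (Nbar e D x) (Nbar e D x))

/-- The unit normal `N̂ = N / ν` of `Σ̃_τ`. -/
def Nhat (x : Vec) : Vec := fun α => N e D x α / nu e D x

/-- The unit normal of `H`, `N̲ / ν̲` (used when `H` is `g`-spacelike). -/
def Nbarhat (x : Vec) : Vec := fun α => Nbar e D x α / nubar e D x

/-- The vectorfield `Θ = B - H̲ / h̲ - Z / z̲`. -/
def Theta (x : Vec) : Vec :=
  fun α => B D x α - (1 / hbar e D x) * Hbar e D x α - (1 / zbar e D x) * Z e D x α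

/-- The vectorfield `E̲ = B - Z / z̲`. -/
def Ebar (x : Vec) : Vec := fun α => B D x α - (1 / zbar e D x) * Z e D x α

/-- The first fundamental form of `S_τ`. -/
def sLow (x : Vec) (α β : Fin 4) : ℝ :=
  gLow e D x α β + low e D x (Nhat e D x) α * low e D x (Nhat e D x) β
    - low e D x (Z e D x) α * low e D x (Z e D x) β

/-- The inverse first fundamental form of `S_τ`. -/
def sUp (x : Vec) (α β : Fin 4) : ℝ :=
  gUp e D x α β + Nhat e D x α * Nhat e D x β - Z e D x α * Z e D x β

/-- The `g`-orthogonal projection onto `S_τ`, with upper index `α` and lower index `β`. -/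
def sProj (x : Vec) (α β : Fin 4) : ℝ :=
  (if α = β then 1 else 0) + Nhat e D x α * low e D x (Nhat e D x) β
    - Z e D x α * low e D x (Z e D x) β

/-- The `g`-orthogonal projection onto `H` (used when `H` is `g`-spacelike). -/
def hProj (x : Vec) (α β : Fin 4) : ℝ :=
  (if α = β then 1 else 0) + Nbarhat e D x α * low e D x (Nbarhat e D x) β

/-- The sphere-tangent vector `∂̸_α`, the projection of `∂_α` onto `S_τ`. -/
def angVec (α : Fin 4) (x : Vec) : Vec := fun β => sProj e D x β α

/-- The sphere-tangent vector with raised index, `(g̸^{-1})^{αβ} ∂_β`. -/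
def angUpVec (α : Fin 4) (x : Vec) : Vec := fun β => sUp e D x α β

/-- The `H`-tangent vector `∂̲_α`, the projection of `∂_α` onto `H`. -/
def sideVec (α : Fin 4) (x : Vec) : Vec := fun β => hProj e D x β α

/-- The projection `V̸` of a vector onto `S_τ`. -/
def slash (x V : Vec) : Vec := fun α => ∑ β, sProj e D x α β * V β

/-- `g̸(X, Y)`. -/
def sIp (x X Y : Vec) : ℝ := ∑ α, ∑ β, sLow e D x α β * X α * Y β

/-- The intrinsic divergence on `S_τ` of an `S_τ`-tangent vectorfield given along `H`:
the trace `∇̸_α Y^α` of `∇̸ Y = Π̸ (D Y)`, with `D` the Levi-Civita connection of `g`. -/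
def divS (Y : Vec → Vec) (x : Vec) : ℝ :=
  ∑ δ, along D (angVec e D δ x) (fun y => Y y δ) x
    + ∑ γ, ∑ δ, ∑ κ, sProj e D x γ δ * christoffel e D x γ δ κ * Y x κ

/-- The trace `(g̸^{-1})^{αβ} (ℒ_X g̸)_{αβ}` for an `H`-tangent vectorfield `X` given along `H`. In
`ℒ_X g̸_{αβ} = X g̸_{αβ} + g̸_{γβ} ∂_α X^γ + g̸_{αγ} ∂_β X^γ` the contraction with `g̸^{-1}` turns the
derivatives of `X` into sphere-tangent ones. -/
def trLie (X : Vec → Vec) (x : Vec) : ℝ :=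
  ∑ α, ∑ β, sUp e D x α β * along D (X x) (fun y => sLow e D y α β) x
    + 2 * ∑ β, ∑ γ, sLow e D x γ β * along D (angUpVec e D β x) (fun y => X y γ) x

/-- The `Σ_t`-tangent vectorfield `P = (N̲ - N) / h̲`. -/
def P (x : Vec) : Vec := fun α => (Nbar e D x α - N e D x α) / hbar e D x

/-- The sphere-tangent vectors `λ_α` in the decomposition `∂_α = - N̲_α B + P_α H̲ + λ_α`. -/
def lam (α : Fin 4) (x : Vec) : Vec := fun β =>
  coordVec α β + low e D x (Nbar e D x) α * B D x β - low e D x (P e D x) α * Hbar e D x β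

/-- `S^a N̲_a`. -/
def SNbar (x : Vec) : ℝ := ∑ a : Fin 3, S D a x * low e D x (Nbar e D x) a.succ

/-- `S^a N_a`. -/
def SN (x : Vec) : ℝ := ∑ a : Fin 3, S D a x * low e D x (N e D x) a.succ

/-- The sphere-tangent part `U` in
`S = - (S^a N̲_a) B + (S^a N̲_a / h̲ - S^a N_a / h̲) H̲ + U`. -/
def U (x : Vec) : Vec := fun α =>
  SVec D x α + SNbar e D x * B D x α
    - (SNbar e D x / hbar e D x - SN e D x / hbar e D x) * Hbar e D x α

/-- The sphere-tangent vectorfield `Y = (S^a N̲_a / h̲ - S^a N_a / h̲) Θ - U / h̲`. -/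
def Y (x : Vec) : Vec := fun α =>
  (SNbar e D x / hbar e D x - SN e D x / hbar e D x) * Theta e D x α
    - (1 / hbar e D x) * U e D x α

/-! ### The error integrands -/

/-- The error integrand `𝔥[V]` at `x`, for a `Σ_t`-tangent vectorfield whose value at `x` is `V`. -/
def errV (x V : Vec) : ℝ :=
  (1 / 2) * (zbar e D x / (hbar e D x * lapse e D x))
      * sIp e D x (slash e D x V) (slash e D x V)
      * trLie e D (fun y => lapse e D y • Hbar e D y) x
  + ∑ α, ∑ β, along D (lapse e D x • Hbar e D x)
        (fun y => zbar e D y / (hbar e D y * lapse e D y) * sUp e D y α β) x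
      * low e D x V α * low e D x V β
  + ∑ α, ∑ β, along D (Theta e D x) (fun y => zbar e D y * sUp e D y α β) x
      * low e D x V α * low e D x V β
  - 2 * ∑ α, low e D x V α * dir (slash e D x V) (fun y => B D y α) x
  + zbar e D x * sIp e D x (slash e D x V) (slash e D x V) * divS e D (Theta e D) x
  + ip e D x (Z e D x) V * ∑ β, V β * divS e D (angVec e D β) x
  + ∑ α, ∑ β, V α * Z e D x β * dir (slash e D x V) (fun y => gLow e D y α β) x
  + ∑ α, low e D x V α * along D (slash e D x V) (fun y => Z e D y α) x

/-- The sign `σ` of `ε_{αβγδ} E̲^α Ω̸^β N̲^γ (S^δ + S^a N̲_a B^δ)` (with `sgn 0 = 0`). -/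
def sigma (x : Vec) : ℝ :=
  Real.sign (eps (Ebar e D x) (slash e D x (OmVec D x)) (Nbar e D x)
    (SVec D x + SNbar e D x • B D x))

/-- The determinant of the `2 × 2` Gram matrix of `Ω̸` and `Y` with respect to `g̸`. -/
def gram (x : Vec) : ℝ :=
  Matrix.det !![sIp e D x (slash e D x (OmVec D x)) (slash e D x (OmVec D x)),
      sIp e D x (slash e D x (OmVec D x)) (Y e D x);
    sIp e D x (slash e D x (OmVec D x)) (Y e D x), sIp e D x (Y e D x) (Y e D x)]

/-- The factor in braces in the first product of `𝔥_(1)[Ω]`. -/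
def brace (x : Vec) : ℝ :=
  ∑ a : Fin 3, low e D x (P e D x) a.succ * dir (Hbar e D x) (D.v a) x
  + (∑ a : Fin 3, low e D x (Nbar e D x) a.succ * P e D x a.succ) * dir (Hbar e D x) D.rho x
  + ∑ a : Fin 3, dir (lam e D a.succ x) (D.v a) x
  + ∑ a : Fin 3, ∑ b : Fin 3, (gUp e D x a.succ b.succ + B D x a.succ * B D x b.succ)
      * low e D x (Nbar e D x) a.succ * dir (lam e D b.succ x) D.rho x
  + Real.exp (-D.rho x) * pSbar e D x * SNbar e D x

/-- The error integrand `𝔥_(1)[Ω]`. -/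
def errOne (x : Vec) : ℝ :=
  let c := snd e D x
  let ρ := D.rho x
  let q := pSbar e D x
  let z := zbar e D x
  let E := Ebar e D x
  let Om' := OmVec D x
  let W := slash e D x (OmVec D x)
  let Hx := Hbar e D x
  2 * sigma e D x * z * c⁻¹ * Real.exp (-2 * ρ) * q
      * ((hbar e D x + etabar e D x ^ 2)
          / Real.sqrt (hbar e D x ^ 2 + etabar e D x ^ 2 * nu e D x ^ 2))
      * Real.sqrt (gram e D x) * brace e D x
  + 4 * z * ip e D x Om' E * dir W (fun y => Real.log (snd e D y)) x
  - 4 * z * sIp e D x W W * dir E (fun y => Real.log (snd e D y)) x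
  + 4 * z * E 0 * ∑ a : Fin 3, low e D x Om' a.succ * dir W (D.v a) x
  - 4 * z * W 0 * ∑ a : Fin 3, low e D x Om' a.succ * dir E (D.v a) x
  + 2 * z * (c ^ 4)⁻¹ * Real.exp (-2 * ρ) * q
      * eps E W (P e D x) (SVec D x) * dir Hx D.rho x
  - 2 * z * (c ^ 4)⁻¹ * Real.exp (-2 * ρ) * q * SNbar e D x
      * eps E W (B D x) (P e D x) * dir Hx D.rho x
  + 2 * z * (c ^ 2)⁻¹ * Real.exp (-2 * ρ) * q
      * eps E W (spatial fun a => dir (lam e D a.succ x) D.rho x) (SVec D x)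
  - 2 * z * (c ^ 2)⁻¹ * Real.exp (-2 * ρ) * q * SNbar e D x
      * eps E W (B D x) (spatial fun d => dir (lam e D d.succ x) D.rho x)
  - 2 * z * (c ^ 4)⁻¹ * Real.exp (-2 * ρ) * q
      * (∑ a : Fin 3, S D a x * low e D x (P e D x) a.succ)
      * eps E W (B D x) (spatial fun i => dir Hx (D.v i) x)
  - 2 * z * (c ^ 4)⁻¹ * Real.exp (-2 * ρ) * q
      * eps E W (B D x)
          (spatial fun i => ∑ a : Fin 3, S D a x * dir (lam e D a.succ x) (D.v i) x)
  + 2 * z * (c ^ 2)⁻¹ * Real.exp ρ * eps E W (B D x) (CVec e D x)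
  - 2 * z * (c ^ 4)⁻¹ * Real.exp (-3 * ρ) * q ^ 2 * SNbar e D x
      * eps E W (B D x) (SVec D x)

/-- The error integrand `𝔥_(2)[S]`. -/
def errTwo (x : Vec) : ℝ :=
  let W := slash e D x (SVec D x)
  4 * zbar e D x * ip e D x (SVec D x) (Ebar e D x) * dir W (fun y => Real.log (snd e D y)) x
  - 4 * zbar e D x * sIp e D x W W * dir (Ebar e D x) (fun y => Real.log (snd e D y)) x

/-! ### The standing assumptions -/

/-- The standing assumptions on the solution, the time function and the spacetime region. -/
structure Admissible : Prop where
  isOpen_O : IsOpen D.O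
  isConnected_O : IsConnected D.O
  T_pos : 0 < D.T
  M_subset : D.M ⊆ D.O
  isCompact_M : IsCompact D.M
  isConnected_M : IsConnected D.M
  H_subset : D.H ⊆ D.M
  /-- Smoothness of the fluid and of the time function. -/
  smooth_rho : ContDiffOn ℝ ∞ D.rho D.O
  smooth_v : ∀ i, ContDiffOn ℝ ∞ (D.v i) D.O
  smooth_s : ContDiffOn ℝ ∞ D.s D.O
  smooth_tau : ContDiffOn ℝ ∞ D.tau D.O
  /-- The fluid solves the compressible Euler equations on `M`. -/
  euler : ∀ x ∈ D.M, EulerAt e D x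
  /-- `τ` is an acoustical time function: its gradient is `g`-timelike and past-directed. -/
  tau_timelike : ∀ x ∈ D.O, ∑ α, ∑ β, gUp e D x α β * pd α D.tau x * pd β D.tau x < 0
  tau_directed : ∀ x ∈ D.O, 0 < dir (B D x) D.tau x
  /-- `M` is foliated by the `Σ̃_θ`, `θ ∈ [0, T]`. -/
  tau_mem : ∀ x ∈ D.M, D.tau x ∈ Set.Icc 0 D.T
  /-- Away from `H`, the only boundary points of `M` are those with `τ = 0` or `τ = T`. -/
  local_away : ∀ x ∈ D.M, x ∉ D.H → ∀ᶠ y in 𝓝 x, y ∈ D.M ↔ D.tau y ∈ Set.Icc 0 D.T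
  /-- Near a point of `H`, the region is `{0 ≤ τ ≤ T, φ ≤ 0}` and `H` is `{0 ≤ τ ≤ T, φ = 0}` for a
  smooth `φ` whose zero set is a hypersurface transversal to the level sets of `τ`: so `M` is a
  manifold with corners, and `H` is its intersection with an embedded hypersurface. -/
  local_lateral : ∀ x ∈ D.H, ∃ (φ : Vec → ℝ) (V : Set Vec), IsOpen V ∧ x ∈ V ∧
    ContDiffOn ℝ ∞ φ V ∧ LinearIndependent ℝ ![fderiv ℝ φ x, fderiv ℝ D.tau x] ∧
    ∀ y ∈ V, (y ∈ D.M ↔ D.tau y ∈ Set.Icc 0 D.T ∧ φ y ≤ 0) ∧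
      (y ∈ D.H ↔ D.tau y ∈ Set.Icc 0 D.T ∧ φ y = 0)
  /-- Each `Σ̃_θ` is diffeomorphic to the closed unit ball of `ℝ^3`. -/
  slices : ∀ θ ∈ Set.Icc 0 D.T, ∃ Φ : EuclideanSpace ℝ (Fin 3) → Vec,
    ContDiffOn ℝ ∞ Φ (Metric.closedBall 0 1) ∧ Set.InjOn Φ (Metric.closedBall 0 1) ∧
    (∀ w ∈ Metric.closedBall (0 : EuclideanSpace ℝ (Fin 3)) 1,
      Function.Injective (fderivWithin ℝ Φ (Metric.closedBall 0 1) w)) ∧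
    Φ '' Metric.closedBall 0 1 = SigmaTilde D θ
  /-- The normalization `H̲ t = 1` is possible, so that `H̲` is well defined along `H`. -/
  generator_exists : ∀ x ∈ D.H, ∃ X, IsGenerator e D x X
  zbar_pos : ∀ x ∈ D.H, 0 < zbar e D x
  hbar_pos : ∀ x ∈ D.H, 0 < hbar e D x

end Quantities

/-- A solution with an admissible region, together with a point of the lateral boundary. -/
structure BoundaryPoint (e : EquationOfState) where
  D : Config
  admissible : Admissible e D
  x : Vec
  mem : x ∈ D.H

/-- All boundary points of all solutions and regions whose lateral boundary is `g`-spacelike. -/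
abbrev SpacelikePoint (e : EquationOfState) := {q : BoundaryPoint e // IsSpacelike e q.D}

/-- All boundary points of all solutions and regions whose lateral boundary is `g`-null. -/
abbrev NullPoint (e : EquationOfState) := {q : BoundaryPoint e // IsNull e q.D}

/-- The schematic class `𝓛(A)[b]`. The quantities `A`, `b` and the members of the class are functions
on a set `Pts` of pairs (configuration, boundary point). The members are the linear combinations of the
elements of the array `b` whose coefficients are functions of `A`, continuous on an open set that
contains all the values of `A`. The coefficients are universal: neither they nor the open set depend
on the configuration or on the point. -/
def Schematic {Pts Arg ι : Type} [TopologicalSpace Arg] [Fintype ι] (A : Pts → Arg) (b : Pts → ι → ℝ) :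
    Set (Pts → ℝ) :=
  {E | ∃ (W : Set Arg) (F : ι → Arg → ℝ), IsOpen W ∧ (∀ i, ContinuousOn (F i) W) ∧
    ∀ q, A q ∈ W ∧ E q = ∑ i, F i (A q) * b q i}

section Arrays

variable {e : EquationOfState}

/-- The error integrands as functions of the boundary point. -/
def errOm (q : BoundaryPoint e) : ℝ := errV e q.D q.x (OmVec q.D q.x)
def errS (q : BoundaryPoint e) : ℝ := errV e q.D q.x (SVec q.D q.x)
def errOneOm (q : BoundaryPoint e) : ℝ := errOne e q.D q.x
def errTwoS (q : BoundaryPoint e) : ℝ := errTwo e q.D q.x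

/-- The undifferentiated arrays `Ψ`, `Ω`, `S`, `𝒞` and `∂τ`. -/
def arrPsi (q : BoundaryPoint e) : Fin 5 → ℝ := fun J => Psi q.D J q.x
def arrOm (q : BoundaryPoint e) : Fin 3 → ℝ := fun i => Om q.D i q.x
def arrS (q : BoundaryPoint e) : Fin 3 → ℝ := fun i => S q.D i q.x
def arrC (q : BoundaryPoint e) : Fin 3 → ℝ := fun i => modC e q.D i q.x
def arrDtau (q : BoundaryPoint e) : Fin 4 → ℝ := fun α => pd α q.D.tau q.x

/-- The arguments `(Ψ, Ω, S, H̲, Z, ∂τ)`. -/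
def argSpacelike (q : BoundaryPoint e) :
    (Fin 5 → ℝ) × (Fin 3 → ℝ) × (Fin 3 → ℝ) × Vec × Vec × (Fin 4 → ℝ) :=
  (arrPsi q, arrOm q, arrS q, Hbar e q.D q.x, Z e q.D q.x, arrDtau q)

/-- The arguments `(Ψ, Ω, S, L̲, N)`, where `L̲ = N̲`. -/
def argNull (q : BoundaryPoint e) :
    (Fin 5 → ℝ) × (Fin 3 → ℝ) × (Fin 3 → ℝ) × Vec × Vec :=
  (arrPsi q, arrOm q, arrS q, Nbar e q.D q.x, N e q.D q.x)

/-- The arguments `(Ψ, Ω, S, L̲, N, ∂τ)`. -/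
def argNullTau (q : BoundaryPoint e) :
    (Fin 5 → ℝ) × (Fin 3 → ℝ) × (Fin 3 → ℝ) × Vec × Vec × (Fin 4 → ℝ) :=
  (arrPsi q, arrOm q, arrS q, Nbar e q.D q.x, N e q.D q.x, arrDtau q)

/-- The array `(Ω, S, 𝒞)`. -/
def arrLow (q : BoundaryPoint e) : Fin 3 ⊕ Fin 3 ⊕ Fin 3 → ℝ :=
  Sum.elim (arrOm q) (Sum.elim (arrS q) (arrC q))

/-- The arrays `∂̲Ψ`, `∂̲H̲`, `∂̲Z`, `∂̲∂τ` of `H`-tangent derivatives. -/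
def sidePsi (q : BoundaryPoint e) : Fin 4 × Fin 5 → ℝ :=
  fun i => dir (sideVec e q.D i.1 q.x) (Psi q.D i.2) q.x
def sideHbar (q : BoundaryPoint e) : Fin 4 × Fin 4 → ℝ :=
  fun i => along q.D (sideVec e q.D i.1 q.x) (fun y => Hbar e q.D y i.2) q.x
def sideZ (q : BoundaryPoint e) : Fin 4 × Fin 4 → ℝ :=
  fun i => along q.D (sideVec e q.D i.1 q.x) (fun y => Z e q.D y i.2) q.x
def sideDtau (q : BoundaryPoint e) : Fin 4 × Fin 4 → ℝ :=
  fun i => dir (sideVec e q.D i.1 q.x) (pd i.2 q.D.tau) q.x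

/-- The arrays `∂̸Ψ`, `∂̸H̲`, `∂̸N̲`, `∂̸Z` of sphere-tangent derivatives. -/
def angPsi (q : BoundaryPoint e) : Fin 4 × Fin 5 → ℝ :=
  fun i => dir (angVec e q.D i.1 q.x) (Psi q.D i.2) q.x
def angHbar (q : BoundaryPoint e) : Fin 4 × Fin 4 → ℝ :=
  fun i => along q.D (angVec e q.D i.1 q.x) (fun y => Hbar e q.D y i.2) q.x
def angNbar (q : BoundaryPoint e) : Fin 4 × Fin 4 → ℝ :=
  fun i => along q.D (angVec e q.D i.1 q.x) (fun y => Nbar e q.D y i.2) q.x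
def angZ (q : BoundaryPoint e) : Fin 4 × Fin 4 → ℝ :=
  fun i => along q.D (angVec e q.D i.1 q.x) (fun y => Z e q.D y i.2) q.x

/-- The arrays `L̲Ψ`, `L̲Z`, `L̲∂τ`, where `L̲ = N̲`. -/
def nullPsi (q : BoundaryPoint e) : Fin 5 → ℝ :=
  fun J => dir (Nbar e q.D q.x) (Psi q.D J) q.x
def nullZ (q : BoundaryPoint e) : Fin 4 → ℝ :=
  fun α => along q.D (Nbar e q.D q.x) (fun y => Z e q.D y α) q.x
def nullDtau (q : BoundaryPoint e) : Fin 4 → ℝ :=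
  fun α => dir (Nbar e q.D q.x) (pd α q.D.tau) q.x

/-- The array `(∂̲Ψ, ∂̲H̲, ∂̲Z, ∂̲∂τ)`. -/
def arrSide (q : BoundaryPoint e) :
    (Fin 4 × Fin 5) ⊕ (Fin 4 × Fin 4) ⊕ (Fin 4 × Fin 4) ⊕ (Fin 4 × Fin 4) → ℝ :=
  Sum.elim (sidePsi q) (Sum.elim (sideHbar q) (Sum.elim (sideZ q) (sideDtau q)))

/-- The array `(∂̲Ψ, ∂̸H̲, ∂̲Z, ∂̲∂τ)`. -/
def arrSideAng (q : BoundaryPoint e) :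
    (Fin 4 × Fin 5) ⊕ (Fin 4 × Fin 4) ⊕ (Fin 4 × Fin 4) ⊕ (Fin 4 × Fin 4) → ℝ :=
  Sum.elim (sidePsi q) (Sum.elim (angHbar q) (Sum.elim (sideZ q) (sideDtau q)))

/-- The array `(L̲Ψ, ∂̸Ψ, ∂̸L̲, L̲Z, ∂̸Z)`. -/
def arrNull (q : BoundaryPoint e) :
    Fin 5 ⊕ (Fin 4 × Fin 5) ⊕ (Fin 4 × Fin 4) ⊕ Fin 4 ⊕ (Fin 4 × Fin 4) → ℝ :=
  Sum.elim (nullPsi q) (Sum.elim (angPsi q)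
    (Sum.elim (angNbar q) (Sum.elim (nullZ q) (angZ q))))

end Arrays

end EulerBoundary

end

/-!
The theorem is a statement about bookkeeping, but one that has to be uniform: the coefficients may
depend neither on the solution nor on the region nor on the point. It is convenient to say that `f` is a
*function of* the array `A` (`FunctionOf`) if `f = F ∘ A` for one universal `C^n` function `F` on an open
set containing all the values of `A`. The classes `𝓛(A)[b]` and their sums are then modules over the
continuous functions of `A` (`IsCoefModule`).

The geometric input is that the vectorfields `N`, `N̲`, `Z`, `H̲` all lie in one timelike plane, the
orthogonal complement of the sphere (`Admissible.isFrame`). So `Ψ`, `N`, `Z`, `H̲` determine `N̲`, and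
`Ψ`, `N`, `N̲` determine `Z` and `H̲`, by universal smooth formulas (`FrameArray.of_N_Z_Hbar`,
`FrameArray.of_N_Nbar`); the scalars `z̲`, `h̲`, `ν` are then determined as well. So in the spacelike
case all the undifferentiated geometric quantities are functions of `(Ψ, H̲, Z, ∂τ)`, because `N` is
determined by `Ψ` and `∂τ`, and in the null case all of them but `ℓ`, whose value cancels, are functions
of `(Ψ, L̲, N)`.

All the derivatives in the error integrands are tangent to `H`, since `Θ`, `λ_α`, `V̸` are tangent to the
sphere and `E̲ = Θ + H̲ / h̲`. By the chain rule along `H` (`FunctionOf.exists_along_eq`) such a derivative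
of a function of an array is a universal combination of the derivatives of the array in the sphere
directions and in the direction of `H̲`; `IsDerivModule.errV_mem`, `IsDerivModule.errOne_mem`,
`IsDerivModule.errTwo_mem` do this for the three kinds of integrands. In `𝔥_(1)` and `𝔥_(2)` only fluid
variables are differentiated. In `𝔥` the Christoffel symbols in the intrinsic divergence reduce to
sphere derivatives of `g` (`sum_sProj_christoffel`), and `1 / ℓ = h̲ B τ` leaves of the lapse only the
logarithmic derivative `H̲(Bτ) / Bτ`.

Two points go beyond this. The first is the factor `σ √G` in `𝔥_(1)[Ω]`, in which neither factor is
smooth. On a spacelike boundary `√G` is proportional to the absolute value of the volume whose sign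
is `σ`, so that the product is smooth (`IsFrame.sigma_mul_sqrt_gram`); on a null boundary that volume
vanishes (`IsFrame.sigma_eq_zero`). The second is that on a null boundary the derivative of `L̲` along
itself is not in the array. It is removed by writing `L̲` as a function of `Ψ`, `dτ / Bτ` and `Z`
(`Hbar_nullTauArray`): its derivative along `L̲` is then controlled by `L̲Ψ`, `L̲Z` and `L̲∂τ`, where the
`dτ`-part comes with coefficients that depend on `Ψ`, `L̲`, `N` only, up to the factor `1 / Bτ`.
-/

noncomputable section

namespace EulerBoundary

/-! ### Functions of an array of arguments -/

section FunctionOf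

variable {Pts : Type} {E : Type} [NormedAddCommGroup E] [NormedSpace ℝ E] {n : WithTop ℕ∞}

/-- `f` is a `C^n` function of the array `A`: there are an open set containing all the values of `A`
and a `C^n` function `F` on it with `f = F ∘ A`. For `n = 0` these are the coefficients allowed in
`Schematic A`. -/
def FunctionOf (n : WithTop ℕ∞) (A : Pts → E) (f : Pts → ℝ) : Prop :=
  ∃ (W : Set E) (F : E → ℝ), IsOpen W ∧ ContDiffOn ℝ n F W ∧ ∀ q, A q ∈ W ∧ f q = F (A q)

variable {A : Pts → E} {f g : Pts → ℝ}

namespace FunctionOf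

theorem of_le {m : WithTop ℕ∞} (hf : FunctionOf n A f) (h : m ≤ n) : FunctionOf m A f := by
  obtain ⟨W, F, hW, hF, hq⟩ := hf
  exact ⟨W, F, hW, hF.of_le h, hq⟩

theorem congr (hf : FunctionOf n A f) (h : ∀ q, g q = f q) : FunctionOf n A g := by
  rwa [show g = f from funext h]

theorem of_contDiff {F : E → ℝ} (hF : ContDiff ℝ n F) : FunctionOf n A fun q => F (A q) :=
  ⟨Set.univ, F, isOpen_univ, hF.contDiffOn, fun _ => ⟨trivial, rfl⟩⟩

theorem const (r : ℝ) : FunctionOf n A fun _ => r :=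
  of_contDiff (F := fun _ => r) contDiff_const

theorem coord {κ : Type} [Fintype κ] {A : Pts → κ → ℝ} (j : κ) : FunctionOf n A fun q => A q j :=
  of_contDiff (F := fun u : κ → ℝ => u j) (contDiff_apply ℝ ℝ j)

/-- Substitution: a function of an array whose entries are functions of `A` is a function of `A`. -/
theorem comp {κ : Type} [Fintype κ] {A' : Pts → κ → ℝ} (hf : FunctionOf n A' f)
    (hA : ∀ j, FunctionOf n A fun q => A' q j) : FunctionOf n A f := by
  obtain ⟨W, F, hW, hF, hq⟩ := hf
  choose V G hV hG hGq using hA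
  set U : Set E := ⋂ j, V j
  have hU : IsOpen U := isOpen_iInter_of_finite hV
  have hGU : ContDiffOn ℝ n (fun a => fun j => G j a) U :=
    contDiffOn_pi.2 fun j => (hG j).mono (Set.iInter_subset _ j)
  refine ⟨U ∩ (fun a => fun j => G j a) ⁻¹' W, fun a => F fun j => G j a,
    hGU.continuousOn.isOpen_inter_preimage hU hW, ?_, fun q => ?_⟩
  · exact hF.comp (hGU.mono Set.inter_subset_left) fun a ha => ha.2
  · have h : (fun j => G j (A q)) = A' q := funext fun j => ((hGq j q).2).symm
    refine ⟨⟨Set.mem_iInter.2 fun j => (hGq j q).1, ?_⟩, ?_⟩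
    · simpa only [Set.mem_preimage, h] using (hq q).1
    · simpa only [h] using (hq q).2

theorem comp_contDiff {E' : Type} [NormedAddCommGroup E'] [NormedSpace ℝ E'] {Φ : E → E'}
    (hf : FunctionOf n (fun q => Φ (A q)) f) (hΦ : ContDiff ℝ n Φ) : FunctionOf n A f := by
  obtain ⟨W, F, hW, hF, hq⟩ := hf
  exact ⟨Φ ⁻¹' W, fun a => F (Φ a), hW.preimage hΦ.continuous,
    hF.comp hΦ.contDiffOn fun _ ha => ha, hq⟩

theorem comp_real {G : ℝ → ℝ} {V : Set ℝ} (hf : FunctionOf n A f) (hV : IsOpen V)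
    (hG : ContDiffOn ℝ n G V) (h : ∀ q, f q ∈ V) : FunctionOf n A fun q => G (f q) := by
  obtain ⟨W, F, hW, hF, hq⟩ := hf
  refine ⟨W ∩ F ⁻¹' V, fun a => G (F a), hF.continuousOn.isOpen_inter_preimage hW hV, ?_, ?_⟩
  · exact hG.comp (hF.mono Set.inter_subset_left) fun a ha => ha.2
  · intro q
    refine ⟨⟨(hq q).1, ?_⟩, by simp only [(hq q).2]⟩
    simpa only [Set.mem_preimage, ← (hq q).2] using h q

theorem add (hf : FunctionOf n A f) (hg : FunctionOf n A g) :
    FunctionOf n A fun q => f q + g q := by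
  obtain ⟨W, F, hW, hF, hq⟩ := hf
  obtain ⟨V, G, hV, hG, hr⟩ := hg
  exact ⟨W ∩ V, fun a => F a + G a, hW.inter hV,
    (hF.mono Set.inter_subset_left).add (hG.mono Set.inter_subset_right),
    fun q => ⟨⟨(hq q).1, (hr q).1⟩, by simp only [(hq q).2, (hr q).2]⟩⟩

theorem mul (hf : FunctionOf n A f) (hg : FunctionOf n A g) :
    FunctionOf n A fun q => f q * g q := by
  obtain ⟨W, F, hW, hF, hq⟩ := hf
  obtain ⟨V, G, hV, hG, hr⟩ := hg
  exact ⟨W ∩ V, fun a => F a * G a, hW.inter hV,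
    (hF.mono Set.inter_subset_left).mul (hG.mono Set.inter_subset_right),
    fun q => ⟨⟨(hq q).1, (hr q).1⟩, by simp only [(hq q).2, (hr q).2]⟩⟩

theorem neg (hf : FunctionOf n A f) : FunctionOf n A fun q => -f q :=
  ((const (-1)).mul hf).congr fun q => by ring

theorem sub (hf : FunctionOf n A f) (hg : FunctionOf n A g) :
    FunctionOf n A fun q => f q - g q :=
  (hf.add hg.neg).congr fun q => by ring

theorem pow (hf : FunctionOf n A f) (k : ℕ) : FunctionOf n A fun q => f q ^ k :=
  hf.comp_real (G := fun t => t ^ k) isOpen_univ (contDiff_id.pow k).contDiffOn fun _ => trivial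

theorem inv (hf : FunctionOf n A f) (h : ∀ q, f q ≠ 0) : FunctionOf n A fun q => (f q)⁻¹ :=
  hf.comp_real (G := fun t => t⁻¹) (V := {0}ᶜ) isOpen_compl_singleton
    (fun _ ht => (contDiffAt_inv ℝ ht).contDiffWithinAt) h

theorem div (hf : FunctionOf n A f) (hg : FunctionOf n A g) (h : ∀ q, g q ≠ 0) :
    FunctionOf n A fun q => f q / g q :=
  (hf.mul (hg.inv h)).congr fun _ => div_eq_mul_inv _ _

theorem sqrt (hf : FunctionOf n A f) (h : ∀ q, f q ≠ 0) :
    FunctionOf n A fun q => Real.sqrt (f q) :=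
  hf.comp_real (G := Real.sqrt) (V := {0}ᶜ) isOpen_compl_singleton
    (fun _ ht => (Real.contDiffAt_sqrt ht).contDiffWithinAt) h

theorem exp (hf : FunctionOf n A f) : FunctionOf n A fun q => Real.exp (f q) :=
  hf.comp_real (G := Real.exp) isOpen_univ Real.contDiff_exp.contDiffOn fun _ => trivial

theorem sum {ι : Type*} (s : Finset ι) {f : ι → Pts → ℝ} (h : ∀ i, FunctionOf n A (f i)) :
    FunctionOf n A fun q => ∑ i ∈ s, f i q := by
  classical
  induction s using Finset.induction_on with
  | empty => simpa using const (n := n) (A := A) 0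
  | insert i s hi ih => exact ((h i).add ih).congr fun q => Finset.sum_insert hi

theorem prod {ι : Type*} (s : Finset ι) {f : ι → Pts → ℝ} (h : ∀ i, FunctionOf n A (f i)) :
    FunctionOf n A fun q => ∏ i ∈ s, f i q := by
  classical
  induction s using Finset.induction_on with
  | empty => simpa using const (n := n) (A := A) 1
  | insert i s hi ih => exact ((h i).mul ih).congr fun q => Finset.prod_insert hi

theorem det {m : ℕ} {M : Pts → Matrix (Fin m) (Fin m) ℝ}
    (h : ∀ i j, FunctionOf n A fun q => M q i j) : FunctionOf n A fun q => (M q).det := by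
  have key : FunctionOf n A fun q =>
      ∑ σ : Equiv.Perm (Fin m), ((Equiv.Perm.sign σ : ℤ) : ℝ) * ∏ i, M q (σ i) i :=
    sum _ fun σ => (const _).mul (prod _ fun i => h _ _)
  exact key.congr fun q => Matrix.det_apply' _

theorem eps {X Y Z W : Pts → Vec} (hX : ∀ α, FunctionOf n A fun q => X q α)
    (hY : ∀ α, FunctionOf n A fun q => Y q α) (hZ : ∀ α, FunctionOf n A fun q => Z q α)
    (hW : ∀ α, FunctionOf n A fun q => W q α) :
    FunctionOf n A fun q => EulerBoundary.eps (X q) (Y q) (Z q) (W q) := by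
  refine det fun i j => ?_
  fin_cases i
  exacts [hX j, hY j, hZ j, hW j]

end FunctionOf

end FunctionOf

/-! ### Modules over the coefficient functions -/

/-- A set of functions of the boundary point that is closed under sums and under multiplication by the
continuous functions of the array `A`. -/
structure IsCoefModule {Pts : Type} {E : Type} [NormedAddCommGroup E] [NormedSpace ℝ E] (A : Pts → E)
    (T : Set (Pts → ℝ)) : Prop where
  zero : (fun _ => 0) ∈ T
  add : ∀ {f g : Pts → ℝ}, f ∈ T → g ∈ T → (fun q => f q + g q) ∈ T
  mul : ∀ {a f : Pts → ℝ}, FunctionOf 0 A a → f ∈ T → (fun q => a q * f q) ∈ T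

namespace IsCoefModule

variable {Pts : Type} {E : Type} [NormedAddCommGroup E] [NormedSpace ℝ E] {A : Pts → E}
  {T T' : Set (Pts → ℝ)} {f g a : Pts → ℝ}

theorem congr (hf : f ∈ T) (h : ∀ q, g q = f q) : g ∈ T := by
  rwa [show g = f from funext h]

theorem sum (hT : IsCoefModule A T) {ι : Type*} (s : Finset ι) {f : ι → Pts → ℝ}
    (h : ∀ i, f i ∈ T) : (fun q => ∑ i ∈ s, f i q) ∈ T := by
  classical
  induction s using Finset.induction_on with
  | empty => simpa using hT.zero
  | insert i s hi ih => exact congr (hT.add (h i) ih) fun q => Finset.sum_insert hi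

theorem mul_right (hT : IsCoefModule A T) (hf : f ∈ T) (ha : FunctionOf 0 A a) :
    (fun q => f q * a q) ∈ T :=
  congr (hT.mul ha hf) fun _ => mul_comm _ _

theorem neg (hT : IsCoefModule A T) (hf : f ∈ T) : (fun q => -f q) ∈ T :=
  congr (hT.mul (.const (-1)) hf) fun q => by ring

theorem sub (hT : IsCoefModule A T) (hf : f ∈ T) (hg : g ∈ T) : (fun q => f q - g q) ∈ T :=
  congr (hT.add hf (hT.neg hg)) fun q => by ring

open scoped Pointwise in
theorem set_add (hT : IsCoefModule A T) (hT' : IsCoefModule A T') : IsCoefModule A (T + T') where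
  zero := ⟨_, hT.zero, _, hT'.zero, by ext; simp⟩
  add := by
    rintro _ _ ⟨f, hf, g, hg, rfl⟩ ⟨f', hf', g', hg', rfl⟩
    exact ⟨_, hT.add hf hf', _, hT'.add hg hg', by ext; simp only [Pi.add_apply]; ring⟩
  mul := by
    rintro a _ ha ⟨f, hf, g, hg, rfl⟩
    exact ⟨_, hT.mul ha hf, _, hT'.mul ha hg, by ext; simp only [Pi.add_apply]; ring⟩

open scoped Pointwise in
theorem mem_add_left (hT' : IsCoefModule A T') (hf : f ∈ T) : f ∈ T + T' :=
  ⟨f, hf, _, hT'.zero, by ext; simp⟩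

open scoped Pointwise in
theorem mem_add_right (hT : IsCoefModule A T) (hf : f ∈ T') : f ∈ T + T' :=
  ⟨_, hT.zero, f, hf, by ext; simp⟩

end IsCoefModule

section SchematicModule

variable {Pts ι : Type} {E E' : Type} [NormedAddCommGroup E] [NormedSpace ℝ E]
  [NormedAddCommGroup E'] [NormedSpace ℝ E'] [Fintype ι] {A : Pts → E} {b : Pts → ι → ℝ}

theorem schematic_of_coef {c : ι → Pts → ℝ} (hc : ∀ i, FunctionOf 0 A (c i)) :
    (fun q => ∑ i, c i q * b q i) ∈ Schematic A b := by
  choose W F hW hF hq using hc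
  refine ⟨⋂ i, W i, F, isOpen_iInter_of_finite hW,
    fun i => (hF i).continuousOn.mono (Set.iInter_subset _ i), fun q =>
      ⟨Set.mem_iInter.2 fun i => (hq i q).1, ?_⟩⟩
  exact Finset.sum_congr rfl fun i _ => by rw [(hq i q).2]

theorem exists_coef_of_schematic {f : Pts → ℝ} (hf : f ∈ Schematic A b) :
    ∃ c : ι → Pts → ℝ, (∀ i, FunctionOf 0 A (c i)) ∧ f = fun q => ∑ i, c i q * b q i := by
  obtain ⟨W, F, hW, hF, hq⟩ := hf
  exact ⟨fun i q => F i (A q),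
    fun i => ⟨W, F i, hW, contDiffOn_zero.2 (hF i), fun q => ⟨(hq q).1, rfl⟩⟩,
    funext fun q => (hq q).2⟩

/-- `Schematic A b` is a module over the functions of `A`, hence over the functions of any array `A'`
that is itself a function of `A`. -/
theorem isCoefModule_schematic {A' : Pts → E'}
    (hA : ∀ {c : Pts → ℝ}, FunctionOf 0 A' c → FunctionOf 0 A c) :
    IsCoefModule A' (Schematic A b) where
  zero := by
    convert schematic_of_coef (A := A) (b := b) (c := fun _ _ => 0) fun _ => .const 0 using 2
    simp
  add := by
    intro f g hf hg
    obtain ⟨c, hc, rfl⟩ := exists_coef_of_schematic hf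
    obtain ⟨d, hd, rfl⟩ := exists_coef_of_schematic hg
    refine IsCoefModule.congr (schematic_of_coef fun i => (hc i).add (hd i)) fun q => ?_
    simp only [add_mul, Finset.sum_add_distrib]
  mul := by
    intro a f ha hf
    obtain ⟨c, hc, rfl⟩ := exists_coef_of_schematic hf
    refine IsCoefModule.congr (schematic_of_coef fun i => (hA ha).mul (hc i)) fun q => ?_
    simp only [mul_assoc, Finset.mul_sum]

theorem schematic_coord (i : ι) {f : Pts → ℝ} (h : ∀ q, f q = b q i) : f ∈ Schematic A b := by
  classical
  refine IsCoefModule.congr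
    (schematic_of_coef (A := A) (c := fun j _ => if j = i then 1 else 0) fun j => .const _)
    fun q => ?_
  simp [h]

end SchematicModule

/-! ### Tangent spaces of the lateral boundary -/

section TangentSpace

variable {e : EquationOfState} {D : Config} {x X : Vec} {f g : Vec → ℝ}

theorem HasFDerivWithinAt.eqOn_TH {f' g' : Vec →L[ℝ] ℝ} (hf : HasFDerivWithinAt f f' D.H x)
    (hg : HasFDerivWithinAt f g' D.H x) (hX : X ∈ TH D x) : f' X = g' X := by
  have h : TH D x ≤ LinearMap.ker ((f' - g' : Vec →L[ℝ] ℝ) : Vec →ₗ[ℝ] ℝ) := by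
    refine Submodule.span_le.2 fun Y hY => ?_
    simpa [sub_eq_zero] using hf.unique_on hg hY
  simpa [sub_eq_zero] using h hX

theorem along_eq {f' : Vec →L[ℝ] ℝ} (hf : HasFDerivWithinAt f f' D.H x) (hX : X ∈ TH D x) :
    along D X f x = f' X :=
  HasFDerivWithinAt.eqOn_TH hf.differentiableWithinAt.hasFDerivWithinAt hf hX

theorem along_eq_dir (hf : DifferentiableAt ℝ f x) (hX : X ∈ TH D x) :
    along D X f x = dir X f x :=
  along_eq hf.hasFDerivAt.hasFDerivWithinAt hX

theorem along_congr (hx : x ∈ D.H) (h : ∀ y ∈ D.H, f y = g y) : along D X f x = along D X g x := by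
  unfold along
  rw [fderivWithin_congr h (h x hx)]

theorem along_mul (hf : DifferentiableWithinAt ℝ f D.H x) (hg : DifferentiableWithinAt ℝ g D.H x)
    (hX : X ∈ TH D x) :
    along D X (fun y => f y * g y) x = f x * along D X g x + g x * along D X f x := by
  have h : HasFDerivWithinAt (fun y => f y * g y) _ D.H x :=
    hf.hasFDerivWithinAt.mul hg.hasFDerivWithinAt
  rw [along_eq h hX]
  simp [along]

theorem along_sum_smul {ι : Type*} (s : Finset ι) (a : ι → ℝ) (Y : ι → Vec) :
    along D (∑ i ∈ s, a i • Y i) f x = ∑ i ∈ s, a i * along D (Y i) f x := by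
  simp [along, map_sum]

theorem dir_sum_smul {ι : Type*} (s : Finset ι) (a : ι → ℝ) (Y : ι → Vec) :
    dir (∑ i ∈ s, a i • Y i) f x = ∑ i ∈ s, a i * dir (Y i) f x := by
  simp [dir, map_sum]

theorem dir_eq_sum (X : Vec) (f : Vec → ℝ) (x : Vec) : dir X f x = ∑ α, X α * pd α f x := by
  have h : X = ∑ α, X α • coordVec α := by
    ext β
    simp [coordVec, Pi.single_apply]
  conv_lhs => rw [h]
  rw [dir_sum_smul]
  rfl

/-- Whenever the zero set of `φ` and the slab `0 ≤ τ ≤ T` describe `H` near a point and cross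
transversally there, the tangent space of `H` is the kernel of `dφ`. At `τ = 0` and `τ = T` the tangent
cone is only part of the kernel, but it still spans it. -/
theorem TH_eq_ker {φ : Vec → ℝ} {V : Set Vec} (hT : 0 < D.T) (hV : IsOpen V) (hx : x ∈ V)
    (hxH : x ∈ D.H) (hφ : ContDiffOn ℝ ∞ φ V) (hτ : DifferentiableAt ℝ D.tau x)
    (hli : LinearIndependent ℝ ![fderiv ℝ φ x, fderiv ℝ D.tau x])
    (hH : ∀ y ∈ V, (y ∈ D.H ↔ D.tau y ∈ Set.Icc 0 D.T ∧ φ y = 0)) :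
    TH D x = LinearMap.ker (fderiv ℝ φ x : Vec →ₗ[ℝ] ℝ) := by
  have hφx : ContDiffAt ℝ ∞ φ x := hφ.contDiffAt (hV.mem_nhds hx)
  have hst : HasStrictFDerivAt φ (fderiv ℝ φ x) x := hφx.hasStrictFDerivAt (by simp)
  have hφ0 : φ x = 0 := ((hH x hx).1 hxH).2
  have hτx := ((hH x hx).1 hxH).1
  apply le_antisymm
  · intro X hX
    have h1 : HasFDerivWithinAt φ (0 : Vec →L[ℝ] ℝ) D.H x := by
      refine (hasFDerivWithinAt_const (0 : ℝ) x D.H).congr_of_eventuallyEq ?_ hφ0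
      filter_upwards [self_mem_nhdsWithin, nhdsWithin_le_nhds (hV.mem_nhds hx)] with y hy hyV
      exact ((hH y hyV).1 hy).2
    simpa using HasFDerivWithinAt.eqOn_TH hst.hasFDerivAt.hasFDerivWithinAt h1 hX
  · have hne : fderiv ℝ φ x ≠ 0 := by simpa using hli.ne_zero 0
    have hsurj : (fderiv ℝ φ x).range = ⊤ := by
      refine LinearMap.range_eq_top.2 (LinearMap.surjective (f := (fderiv ℝ φ x : Vec →ₗ[ℝ] ℝ)) ?_)
      intro h
      exact hne (by ext v; simpa using congrArg (fun l => l v) h)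
    -- Vectors of the kernel along which `τ` moves into `[0, T]` are velocities of curves in `H`.
    have hcone : ∀ r : ℝ, (r = 1 ∧ D.tau x < D.T ∨ r = -1 ∧ 0 < D.tau x) → ∀ X : Vec,
        fderiv ℝ φ x X = 0 → 0 < fderiv ℝ D.tau x X → X ∈ TH D x := by
      intro r hr X hX hpos
      have hr0 : r ≠ 0 := by rcases hr with h | h <;> rw [h.1] <;> norm_num
      set X' : (fderiv ℝ φ x).ker := ⟨X, hX⟩
      set γ : ℝ → Vec := fun t => hst.implicitFunction φ _ hsurj (φ x) (t • X') with hγ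
      have hγ0 : γ 0 = x := by simp [hγ]
      have hγd : HasDerivAt γ X 0 := by
        have h1 := hst.to_implicitFunction hsurj
        have h2 : HasDerivAt (fun t : ℝ => t • X') X' 0 := by
          simpa using (hasDerivAt_id (0 : ℝ)).smul_const X'
        have h3 : HasFDerivAt (hst.implicitFunction φ _ hsurj (φ x))
            (fderiv ℝ φ x).ker.subtypeL ((fun t : ℝ => t • X') 0) := by
          simpa using h1.hasFDerivAt
        exact h3.comp_hasDerivAt 0 h2
      have hφγ : ∀ᶠ t in 𝓝 (0 : ℝ), φ (γ t) = 0 := by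
        have h1 := hst.map_implicitFunction_eq hsurj
        have h2 : Filter.Tendsto (fun t : ℝ => (φ x, t • X')) (𝓝 0) (𝓝 (φ x, 0)) := by
          have : Continuous fun t : ℝ => (φ x, t • X') := by fun_prop
          simpa using this.tendsto 0
        filter_upwards [h2.eventually h1] with t ht
        exact ht.trans hφ0
      have hγc : Filter.Tendsto γ (𝓝 0) (𝓝 x) := by
        simpa [hγ0] using hγd.continuousAt.tendsto
      have hτd : HasDerivAt (fun t => D.tau (γ t)) (fderiv ℝ D.tau x X) 0 := by
        have h3 : HasFDerivAt D.tau (fderiv ℝ D.tau x) (γ 0) := by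
          rw [hγ0]; exact hτ.hasFDerivAt
        exact h3.comp_hasDerivAt 0 hγd
      have hτc : Filter.Tendsto (fun t => D.tau (γ t)) (𝓝 0) (𝓝 (D.tau x)) := by
        simpa [hγ0] using hτd.continuousAt.tendsto
      have hlim : Filter.Tendsto (fun t : ℝ => r * t) (𝓝[>] 0) (𝓝 0) := by
        have : Filter.Tendsto (fun t : ℝ => r * t) (𝓝 0) (𝓝 (r * 0)) :=
          (continuous_const.mul continuous_id).tendsto 0
        rw [mul_zero] at this
        exact this.mono_left nhdsWithin_le_nhds
      have hlim' : Filter.Tendsto (fun t : ℝ => r * t) (𝓝[>] 0) (𝓝[≠] 0) := by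
        refine tendsto_nhdsWithin_iff.2 ⟨hlim, ?_⟩
        filter_upwards [self_mem_nhdsWithin] with t ht
        exact mul_ne_zero hr0 (ne_of_gt ht)
      have hslope : ∀ᶠ t in 𝓝[>] (0 : ℝ), 0 < (D.tau (γ (r * t)) - D.tau x) * (r * t) := by
        have h1 := (hasDerivAt_iff_tendsto_slope.1 hτd).comp hlim'
        filter_upwards [h1.eventually (lt_mem_nhds hpos), self_mem_nhdsWithin] with t ht ht0
        have hne : r * t ≠ 0 := mul_ne_zero hr0 (ne_of_gt ht0)
        have h2 : 0 < (D.tau (γ (r * t)) - D.tau x) / (r * t) := by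
          simpa [slope_def_field, hγ0] using ht
        have h3 := mul_pos h2 (sq_pos_of_ne_zero hne)
        have h4 : (D.tau (γ (r * t)) - D.tau x) / (r * t) * (r * t) ^ 2 =
          (D.tau (γ (r * t)) - D.tau x) * (r * t) := by field_simp
        rwa [h4] at h3
      have hmem : ∀ᶠ t in 𝓝[>] (0 : ℝ), γ (r * t) ∈ D.H := by
        have hVe := (hγc.comp hlim).eventually (hV.mem_nhds hx)
        have hφe := hlim.eventually hφγ
        rcases hr with ⟨rfl, hlt⟩ | ⟨rfl, hlt⟩
        · filter_upwards [hVe, hφe, hslope, (hτc.comp hlim).eventually (gt_mem_nhds hlt),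
            self_mem_nhdsWithin] with t h1 h2 h3 h4 h5
          refine (hH _ h1).2 ⟨⟨?_, le_of_lt h4⟩, h2⟩
          have h5' : (0 : ℝ) < t := h5
          have := pos_of_mul_pos_left h3 (by linarith)
          change 0 ≤ D.tau (γ (1 * t))
          linarith [hτx.1]
        · filter_upwards [hVe, hφe, hslope, (hτc.comp hlim).eventually (lt_mem_nhds hlt),
            self_mem_nhdsWithin] with t h1 h2 h3 h4 h5
          refine (hH _ h1).2 ⟨⟨le_of_lt h4, ?_⟩, h2⟩
          have h5' : (0 : ℝ) < t := h5
          have : 0 < (D.tau x - D.tau (γ (-1 * t))) * t := by linarith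
          have := pos_of_mul_pos_left this h5'.le
          change D.tau (γ (-1 * t)) ≤ D.T
          linarith [hτx.2]
      refine Submodule.subset_span (mem_tangentConeAt_of_seq (𝓝[>] (0 : ℝ))
        (fun t => (r * t)⁻¹) (fun t => γ (r * t) - x) ?_ ?_ ?_)
      · have := (hγc.comp hlim).sub_const x
        simpa using this
      · simpa using hmem
      · have h1 := (hasDerivAt_iff_tendsto_slope.1 hγd).comp hlim'
        refine h1.congr fun t => ?_
        simp [slope, hγ0]
    obtain ⟨r, hr⟩ : ∃ r : ℝ, (r = 1 ∧ D.tau x < D.T ∨ r = -1 ∧ 0 < D.tau x) := by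
      by_cases h : D.tau x < D.T
      · exact ⟨1, Or.inl ⟨rfl, h⟩⟩
      · exact ⟨-1, Or.inr ⟨rfl, lt_of_lt_of_le hT (not_lt.1 h)⟩⟩
    obtain ⟨X₀, hX₀, hτX₀⟩ : ∃ X₀, fderiv ℝ φ x X₀ = 0 ∧ 0 < fderiv ℝ D.tau x X₀ := by
      by_contra! hcon
      have hker : LinearMap.ker (fderiv ℝ φ x : Vec →ₗ[ℝ] ℝ) ≤
          LinearMap.ker (fderiv ℝ D.tau x : Vec →ₗ[ℝ] ℝ) := by
        intro X hX
        have h1 := hcon X hX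
        have h2 := hcon (-X) (by simpa using hX)
        have h3 : fderiv ℝ D.tau x X = 0 := le_antisymm h1 (by simpa using h2)
        exact h3
      obtain ⟨v, hv⟩ := LinearMap.surjective (f := (fderiv ℝ φ x : Vec →ₗ[ℝ] ℝ))
        (fun h => hne (by ext v; simpa using congrArg (fun l => l v) h)) 1
      have hv' : fderiv ℝ φ x v = 1 := hv
      have := LinearIndependent.pair_iff.1 hli (-(fderiv ℝ D.tau x v)) 1 (by
        ext w
        have h1 : w - fderiv ℝ φ x w • v ∈ LinearMap.ker (fderiv ℝ φ x : Vec →ₗ[ℝ] ℝ) := by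
          simp [hv']
        have h2 : fderiv ℝ D.tau x (w - fderiv ℝ φ x w • v) = 0 := hker h1
        simp only [map_sub, map_smul, smul_eq_mul] at h2
        simp only [add_apply, smul_apply, smul_eq_mul,
          zero_apply]
        linarith)
      exact one_ne_zero this.2
    intro X hX
    have hX' : fderiv ℝ φ x X = 0 := hX
    set m : ℝ := (|fderiv ℝ D.tau x X| + 1) / fderiv ℝ D.tau x X₀
    have hm : m * fderiv ℝ D.tau x X₀ = |fderiv ℝ D.tau x X| + 1 := div_mul_cancel₀ _ hτX₀.ne'
    have h1 : X + m • X₀ ∈ TH D x := by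
      refine hcone r hr _ (by simp [hX', hX₀]) ?_
      have := neg_abs_le (fderiv ℝ D.tau x X)
      simp only [map_add, map_smul, smul_eq_mul, hm]
      linarith
    have h2 := Submodule.sub_mem _ h1 (Submodule.smul_mem _ m (hcone r hr X₀ hX₀ hτX₀))
    simpa using h2

end TangentSpace

/-! ### Algebra of the acoustical metric -/

theorem EquationOfState.c_pos (e : EquationOfState) (rho s : ℝ) : 0 < e.c rho s :=
  Real.sqrt_pos.2 (e.hyperbolic _ _ (mul_pos e.rhoBar_pos (Real.exp_pos _)))

section Metric

variable {e : EquationOfState} {D : Config} {x : Vec}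

theorem snd_pos (e : EquationOfState) (D : Config) (x : Vec) : 0 < snd e D x := e.c_pos _ _

theorem B_zero : B D x 0 = 1 := rfl

theorem B_succ (a : Fin 3) : B D x a.succ = D.v a x := rfl

theorem ip_eq (X Y : Vec) : ip e D x X Y = -(X 0 * Y 0) + (snd e D x ^ 2)⁻¹ *
    ∑ a : Fin 3, (X a.succ - D.v a x * X 0) * (Y a.succ - D.v a x * Y 0) := by
  simp only [ip, gLow, coframe, Fin.sum_univ_succ, Fin.succ_ne_zero, Fin.succ_inj, if_true, if_false,
    Finset.univ_unique, Fin.default_eq_zero]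
  simp
  ring

theorem ip_comm (X Y : Vec) : ip e D x X Y = ip e D x Y X := by
  simp only [ip_eq]
  congr 1
  · ring
  · simp only [mul_comm]

theorem gLow_comm (α β : Fin 4) : gLow e D x α β = gLow e D x β α := by
  simp only [gLow, mul_comm]

theorem gUp_comm (α β : Fin 4) : gUp e D x α β = gUp e D x β α := by
  simp only [gUp, mul_comm]

theorem ip_eq_sum_low (X Y : Vec) : ip e D x X Y = ∑ α, low e D x X α * Y α := by
  rw [ip_comm]
  simp only [ip, low, Finset.sum_mul]
  refine Finset.sum_congr rfl fun α _ => Finset.sum_congr rfl fun β _ => by ring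

theorem ip_eq_sum_low' (X Y : Vec) : ip e D x X Y = ∑ α, X α * low e D x Y α := by
  rw [ip_comm, ip_eq_sum_low]
  exact Finset.sum_congr rfl fun α _ => mul_comm _ _

theorem ip_add_left (X Y W : Vec) : ip e D x (X + Y) W = ip e D x X W + ip e D x Y W := by
  simp only [ip, Pi.add_apply, mul_add, add_mul, Finset.sum_add_distrib]

theorem ip_smul_left (r : ℝ) (X W : Vec) : ip e D x (r • X) W = r * ip e D x X W := by
  simp only [ip, Pi.smul_apply, smul_eq_mul, Finset.mul_sum]
  refine Finset.sum_congr rfl fun α _ => Finset.sum_congr rfl fun β _ => by ring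

theorem ip_sub_left (X Y W : Vec) : ip e D x (X - Y) W = ip e D x X W - ip e D x Y W := by
  simp only [ip, Pi.sub_apply, mul_sub, sub_mul, Finset.sum_sub_distrib]

theorem ip_add_right (X Y W : Vec) : ip e D x W (X + Y) = ip e D x W X + ip e D x W Y := by
  rw [ip_comm, ip_add_left, ip_comm X, ip_comm Y]

theorem ip_smul_right (r : ℝ) (X W : Vec) : ip e D x W (r • X) = r * ip e D x W X := by
  rw [ip_comm, ip_smul_left, ip_comm X]

theorem ip_sub_right (X Y W : Vec) : ip e D x W (X - Y) = ip e D x W X - ip e D x W Y := by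
  rw [ip_comm, ip_sub_left, ip_comm X, ip_comm Y]

theorem ip_B_left (X : Vec) : ip e D x (B D x) X = -X 0 := by
  simp [ip_eq, B_zero, B_succ]

theorem low_B (α : Fin 4) : low e D x (B D x) α = -if α = 0 then 1 else 0 := by
  have h := ip_eq_sum_low (e := e) (D := D) (x := x) (B D x) (coordVec α)
  rw [ip_B_left] at h
  simp only [coordVec, Pi.single_apply] at h
  simpa [eq_comm] using h.symm

theorem gUp_mul_gLow (α γ : Fin 4) :
    ∑ β, gUp e D x α β * gLow e D x β γ = if α = γ then 1 else 0 := by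
  have hc : snd e D x ≠ 0 := (snd_pos e D x).ne'
  have hB : ∑ β, B D x β * gLow e D x β γ = low e D x (B D x) γ :=
    Finset.sum_congr rfl fun β _ => by rw [gLow_comm, mul_comm]
  have h1 : ∑ β, gUp e D x α β * gLow e D x β γ = -(B D x α * low e D x (B D x) γ)
      + snd e D x ^ 2 * ∑ β, ∑ a : Fin 3, (if α = a.succ then 1 else 0) *
        (if β = a.succ then 1 else 0) * gLow e D x β γ := by
    rw [← hB]
    simp only [gUp, add_mul, Finset.sum_add_distrib, Finset.mul_sum, Finset.sum_mul, neg_mul,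
      Finset.sum_neg_distrib, mul_assoc]
  rw [h1, low_B, Finset.sum_comm]
  refine Fin.cases ?_ (fun i => ?_) α
  · simp [B_zero, Fin.succ_ne_zero, eq_comm]
  · refine Fin.cases ?_ (fun j => ?_) γ
    · simp [B_succ, gLow, coframe, Fin.succ_ne_zero, (Fin.succ_ne_zero _).symm]
      field_simp
      ring
    · simp [B_succ, gLow, coframe, Fin.succ_ne_zero]
      by_cases h : i = j
      · subst h
        simp [hc]
      · simp [h]

/-- Raising the index of a covector with `g^{-1}`. -/
def raise (e : EquationOfState) (D : Config) (x : Vec) (θ : Fin 4 → ℝ) : Vec :=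
  fun α => ∑ β, gUp e D x α β * θ β

theorem raise_low (X : Vec) : raise e D x (low e D x X) = X := by
  ext α
  simp only [raise, low, Finset.mul_sum]
  rw [Finset.sum_comm]
  simp only [← mul_assoc, ← Finset.sum_mul, gUp_mul_gLow]
  simp

theorem low_raise (θ : Fin 4 → ℝ) : low e D x (raise e D x θ) = θ := by
  ext α
  simp only [raise, low, Finset.mul_sum]
  rw [Finset.sum_comm]
  have h : ∀ γ, ∑ β, gLow e D x α β * (gUp e D x β γ * θ γ) = (if γ = α then 1 else 0) * θ γ := by
    intro γ
    rw [← gUp_mul_gLow (e := e) (D := D) (x := x), Finset.sum_mul]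
    refine Finset.sum_congr rfl fun β _ => ?_
    rw [gLow_comm, gUp_comm]
    ring
  simp [h]

theorem ip_raise_left (θ : Fin 4 → ℝ) (X : Vec) : ip e D x (raise e D x θ) X = ∑ α, θ α * X α := by
  rw [ip_eq_sum_low, low_raise]

theorem raise_zero_component (θ : Fin 4 → ℝ) : raise e D x θ 0 = -∑ α, B D x α * θ α := by
  have h := ip_B_left (e := e) (D := D) (x := x) (raise e D x θ)
  rw [ip_comm, ip_raise_left] at h
  rw [← neg_eq_iff_eq_neg, ← h]
  exact Finset.sum_congr rfl fun α _ => mul_comm _ _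

theorem ext_ip {X Y : Vec} (h : ∀ W, ip e D x X W = ip e D x Y W) : X = Y := by
  have h1 : low e D x X = low e D x Y := by
    ext α
    have := h (coordVec α)
    simpa [ip_eq_sum_low, coordVec, Pi.single_apply] using this
  rw [← raise_low (e := e) (D := D) (x := x) X, h1, raise_low]

theorem ip_self_of_zero {X : Vec} (h0 : X 0 = 0) :
    ip e D x X X = (snd e D x ^ 2)⁻¹ * ∑ a : Fin 3, X a.succ ^ 2 := by
  simp [ip_eq, h0, sq]

theorem eq_zero_of_ip_nonpos {X : Vec} (h0 : X 0 = 0) (h : ip e D x X X ≤ 0) : X = 0 := by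
  have hc : 0 < (snd e D x ^ 2)⁻¹ := inv_pos.2 (pow_pos (snd_pos e D x) 2)
  rw [ip_self_of_zero h0] at h
  have hs : ∑ a : Fin 3, X a.succ ^ 2 = 0 :=
    le_antisymm (nonpos_of_mul_nonpos_right h hc) (Finset.sum_nonneg fun a _ => sq_nonneg _)
  have ha := (Finset.sum_eq_zero_iff_of_nonneg fun a _ => sq_nonneg _).1 hs
  ext α
  refine Fin.cases h0 (fun a => ?_) α
  simpa using ha a (Finset.mem_univ _)

/-- The reverse Cauchy–Schwarz inequality: the orthogonal complement of a timelike vector is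
spacelike. -/
theorem ip_pos_of_orthogonal {n W : Vec} (hn : ip e D x n n < 0) (hnW : ip e D x n W = 0)
    (hW : W ≠ 0) : 0 < ip e D x W W := by
  set k := (snd e D x ^ 2)⁻¹ with hk
  have hk0 : 0 < k := inv_pos.2 (pow_pos (snd_pos e D x) 2)
  set w : Fin 3 → ℝ := fun a => W a.succ - D.v a x * W 0 with hw
  set m : Fin 3 → ℝ := fun a => n a.succ - D.v a x * n 0 with hm
  have e1 : ip e D x n n = -(n 0 * n 0) + k * ∑ a, m a * m a := ip_eq _ _
  have e2 : ip e D x n W = -(n 0 * W 0) + k * ∑ a, m a * w a := ip_eq _ _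
  have e3 : ip e D x W W = -(W 0 * W 0) + k * ∑ a, w a * w a := ip_eq _ _
  have cs : (∑ a, m a * w a) ^ 2 ≤ (∑ a, m a ^ 2) * ∑ a, w a ^ 2 :=
    Finset.sum_mul_sq_le_sq_mul_sq _ _ _
  simp only [← sq] at e1 e3
  have hmn : 0 ≤ ∑ a, m a ^ 2 := Finset.sum_nonneg fun a _ => sq_nonneg _
  have hwn : 0 ≤ ∑ a, w a ^ 2 := Finset.sum_nonneg fun a _ => sq_nonneg _
  have hn0 : 0 < n 0 ^ 2 := by nlinarith [mul_nonneg hk0.le hmn]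
  have hwpos : 0 < ∑ a, w a ^ 2 := by
    refine lt_of_le_of_ne hwn fun h => hW ?_
    have ha := (Finset.sum_eq_zero_iff_of_nonneg fun a _ => sq_nonneg (w a)).1 h.symm
    have hw0 : ∀ a, w a = 0 := fun a => by simpa using ha a (Finset.mem_univ _)
    have hW0 : W 0 = 0 := by
      rw [e2] at hnW
      simp only [hw0, mul_zero, Finset.sum_const_zero, add_zero, neg_eq_zero] at hnW
      rcases mul_eq_zero.1 hnW with h' | h'
      · simp [h'] at hn0
      · exact h'
    ext α
    refine Fin.cases hW0 (fun a => ?_) α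
    have := hw0 a
    simp only [hw, hW0, mul_zero, sub_zero] at this
    exact this
  have h4 : n 0 * W 0 = k * ∑ a, m a * w a := by linarith
  have h5 : n 0 ^ 2 * W 0 ^ 2 ≤ k ^ 2 * ((∑ a, m a ^ 2) * ∑ a, w a ^ 2) := by
    calc n 0 ^ 2 * W 0 ^ 2 = k ^ 2 * (∑ a, m a * w a) ^ 2 := by rw [← mul_pow, h4, mul_pow]
      _ ≤ _ := by gcongr
  have h6 : k * ∑ a, m a ^ 2 < n 0 ^ 2 := by linarith
  have h7 : n 0 ^ 2 * W 0 ^ 2 < n 0 ^ 2 * (k * ∑ a, w a ^ 2) := by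
    refine lt_of_le_of_lt h5 ?_
    have := mul_lt_mul_of_pos_right h6 (mul_pos hk0 hwpos)
    nlinarith
  have h8 := lt_of_mul_lt_mul_left h7 hn0.le
  linarith

end Metric

/-! ### The frame along the lateral boundary -/

section Frame

variable {e : EquationOfState} {D : Config} {x : Vec}

theorem sum_pd_mul (f : Vec → ℝ) (X : Vec) : ∑ α, pd α f x * X α = dir X f x := by
  rw [dir_eq_sum]
  exact Finset.sum_congr rfl fun α _ => mul_comm _ _

theorem N_eq : N e D x = (-(dir (B D x) D.tau x)⁻¹) • raise e D x fun β => pd β D.tau x := by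
  ext α
  simp only [N, raise, Pi.smul_apply, smul_eq_mul]
  ring

theorem ip_N_left (X : Vec) : ip e D x (N e D x) X = -(dir (B D x) D.tau x)⁻¹ * dir X D.tau x := by
  rw [N_eq, ip_smul_left, ip_raise_left, sum_pd_mul]

theorem N_zero (h : 0 < dir (B D x) D.tau x) : N e D x 0 = 1 := by
  rw [N_eq, Pi.smul_apply, raise_zero_component, smul_eq_mul, ← dir_eq_sum]
  field_simp

theorem ip_N_N (hB : 0 < dir (B D x) D.tau x)
    (hτ : ∑ α, ∑ β, gUp e D x α β * pd α D.tau x * pd β D.tau x < 0) :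
    ip e D x (N e D x) (N e D x) < 0 := by
  have h1 : ip e D x (N e D x) (N e D x) = ((dir (B D x) D.tau x)⁻¹) ^ 2 *
      ∑ α, ∑ β, gUp e D x α β * pd α D.tau x * pd β D.tau x := by
    conv_lhs => rw [N_eq]
    rw [ip_smul_left, ip_smul_right, ip_raise_left]
    have h2 : ∑ α, pd α D.tau x * raise e D x (fun β => pd β D.tau x) α =
        ∑ α, ∑ β, gUp e D x α β * pd α D.tau x * pd β D.tau x := by
      simp only [raise, Finset.mul_sum]
      refine Finset.sum_congr rfl fun α _ => Finset.sum_congr rfl fun β _ => by ring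
    rw [h2]
    ring
  rw [h1]
  exact mul_neg_of_pos_of_neg (pow_pos (inv_pos.2 hB) 2) hτ

/-- A nonzero normal of a spacelike or null hypersurface has a nonzero time component, because a
vector without time component is zero or spacelike. -/
theorem IsNormal.zero_component_ne (hc : IsSpacelike e D ∨ IsNull e D) (hx : x ∈ D.H) {n : Vec}
    (hn : n ≠ 0) (hN : IsNormal e D x n) : n 0 ≠ 0 := by
  intro h0
  refine hn (eq_zero_of_ip_nonpos (e := e) (D := D) (x := x) h0 ?_)
  rcases hc with h | h
  · exact (h x hx n hn hN).le
  · exact (h x hx n hn hN).le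

section Local

variable {φ : Vec → ℝ}

theorem raise_pd_ne_zero (hφ : fderiv ℝ φ x ≠ 0) : raise e D x (fun β => pd β φ x) ≠ 0 := by
  intro h
  refine hφ (ContinuousLinearMap.ext fun X => ?_)
  have h1 := ip_raise_left (e := e) (D := D) (x := x) (fun β => pd β φ x) X
  rw [h, sum_pd_mul] at h1
  simpa [ip, dir] using h1.symm

theorem isNormal_raise_pd (hTH : TH D x = LinearMap.ker (fderiv ℝ φ x : Vec →ₗ[ℝ] ℝ)) :
    IsNormal e D x (raise e D x fun β => pd β φ x) := by
  intro X hX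
  rw [ip_raise_left, sum_pd_mul]
  rw [hTH] at hX
  exact hX

theorem Nbar_eq (hc : IsSpacelike e D ∨ IsNull e D) (hx : x ∈ D.H) (hφ : fderiv ℝ φ x ≠ 0)
    (hTH : TH D x = LinearMap.ker (fderiv ℝ φ x : Vec →ₗ[ℝ] ℝ)) :
    Nbar e D x = (raise e D x (fun β => pd β φ x) 0)⁻¹ • raise e D x fun β => pd β φ x := by
  set n := raise e D x fun β => pd β φ x with hn
  have hnN : IsNormal e D x n := isNormal_raise_pd hTH
  have hn0 : n 0 ≠ 0 := hnN.zero_component_ne hc hx (raise_pd_ne_zero hφ)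
  have hex : ∃ m : Vec, IsNormal e D x m ∧ m 0 = 1 := by
    refine ⟨(n 0)⁻¹ • n, fun X hX => ?_, ?_⟩
    · rw [ip_smul_left, hnN X hX, mul_zero]
    · simp [hn0]
  obtain ⟨hm, hm0⟩ : IsNormal e D x (Nbar e D x) ∧ Nbar e D x 0 = 1 :=
    Classical.epsilon_spec hex
  set m := Nbar e D x
  obtain ⟨v, hv⟩ : ∃ v, fderiv ℝ φ x v ≠ 0 := by
    by_contra! h
    exact hφ (ContinuousLinearMap.ext fun X => by simpa using h X)
  have hdφ : ∀ X, ip e D x n X = fderiv ℝ φ x X := fun X => by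
    rw [hn, ip_raise_left, sum_pd_mul]; rfl
  set r := ip e D x m v / fderiv ℝ φ x v with hr
  have hmn : m = r • n := by
    refine ext_ip (e := e) (D := D) (x := x) fun W => ?_
    have hW : W - (fderiv ℝ φ x W / fderiv ℝ φ x v) • v ∈ TH D x := by
      rw [hTH]
      change fderiv ℝ φ x (W - (fderiv ℝ φ x W / fderiv ℝ φ x v) • v) = 0
      rw [map_sub, map_smul, smul_eq_mul]
      field_simp
      ring
    have h1 := hm _ hW
    rw [ip_sub_right, ip_smul_right] at h1
    rw [ip_smul_left, hdφ, hr]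
    field_simp at h1 ⊢
    linarith
  have hrn : r * n 0 = 1 := by
    rw [← hm0, hmn]; rfl
  rw [hmn, eq_inv_of_mul_eq_one_left hrn]

end Local

/-- The coefficient `g(N̲, N) / g(N, N)` of `N` in `N̲ = g(N̲, N) / g(N, N) N - z̲ Z`. -/
def tilt (e : EquationOfState) (D : Config) (x : Vec) : ℝ :=
  ip e D x (Nbar e D x) (N e D x) / ip e D x (N e D x) (N e D x)

/-- The algebraic relations between the vectorfields `N`, `N̲`, `Z`, `H̲` at a point of the lateral
boundary. They all lie in one timelike plane, orthogonal to the sphere. -/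
structure IsFrame (e : EquationOfState) (D : Config) (x : Vec) : Prop where
  tau_pos : 0 < dir (B D x) D.tau x
  N_zero : N e D x 0 = 1
  Nbar_zero : Nbar e D x 0 = 1
  Hbar_zero : Hbar e D x 0 = 1
  ip_NN : ip e D x (N e D x) (N e D x) < 0
  ip_ZZ : ip e D x (Z e D x) (Z e D x) = 1
  ip_NZ : ip e D x (N e D x) (Z e D x) = 0
  mem_TH : ∀ X, X ∈ TH D x ↔ ip e D x (Nbar e D x) X = 0
  Nbar_decomp : Nbar e D x = tilt e D x • N e D x - zbar e D x • Z e D x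
  Hbar_decomp : Hbar e D x = (hbar e D x / -ip e D x (N e D x) (N e D x)) • N e D x
    - (tilt e D x * hbar e D x / zbar e D x) • Z e D x
  z_pos : 0 < zbar e D x
  h_pos : 0 < hbar e D x
  Hbar_mem : Hbar e D x ∈ TH D x

/-- A vector orthogonal to everything orthogonal to both `n` (timelike) and `W` lies in their span. -/
theorem mem_span_of_orthogonal {n W X : Vec} (hn : ip e D x n n < 0) (hnW : ip e D x n W = 0)
    (hW : 0 < ip e D x W W)
    (hX : ∀ Y, ip e D x n Y = 0 → ip e D x W Y = 0 → ip e D x X Y = 0) :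
    X = (ip e D x X n / ip e D x n n) • n + (ip e D x X W / ip e D x W W) • W := by
  set Y := X - (ip e D x X n / ip e D x n n) • n - (ip e D x X W / ip e D x W W) • W with hY
  have hWn : ip e D x W n = 0 := by rw [ip_comm, hnW]
  have h1 : ip e D x n Y = 0 := by
    simp only [hY, ip_sub_right, ip_smul_right, hnW, ip_comm X n]
    field_simp [hn.ne]
    ring
  have h2 : ip e D x W Y = 0 := by
    simp only [hY, ip_sub_right, ip_smul_right, hWn, ip_comm X W]
    field_simp [hW.ne']
    ring
  have h3 : ip e D x Y Y = 0 := by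
    calc ip e D x Y Y = ip e D x (X - (ip e D x X n / ip e D x n n) • n -
          (ip e D x X W / ip e D x W W) • W) Y := rfl
      _ = 0 := by
        rw [ip_sub_left, ip_sub_left, ip_smul_left, ip_smul_left, h1, h2, hX Y h1 h2]
        ring
  have h4 : Y = 0 := by
    by_contra h
    exact (ip_pos_of_orthogonal hn h1 h).ne' h3
  have h5 : X = Y + (ip e D x X n / ip e D x n n) • n + (ip e D x X W / ip e D x W W) • W := by
    rw [hY]; abel
  rw [h4, zero_add] at h5
  exact h5

/-- Along a spacelike or null lateral boundary the vectorfields `N`, `N̲`, `Z`, `H̲` exist and satisfy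
the expected relations. The outer normal `Z` is the multiple of `N̲ - g(N̲, N) / g(N, N) N` on which
`dφ > 0`: there it cannot belong to the positive tangent cone of the slice, on which `φ` is maximal at
the boundary. -/
theorem Admissible.isFrame (h : Admissible e D) (hc : IsSpacelike e D ∨ IsNull e D) (hx : x ∈ D.H) :
    IsFrame e D x := by
  have hxM := h.H_subset hx
  have hxO := h.M_subset hxM
  have hτd : DifferentiableAt ℝ D.tau x :=
    (h.smooth_tau.contDiffAt (h.isOpen_O.mem_nhds hxO)).differentiableAt (by simp)
  obtain ⟨φ, V, hV, hxV, hφ, hli, hloc⟩ := h.local_lateral x hx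
  have hTH := TH_eq_ker h.T_pos hV hxV hx hφ hτd hli fun y hy => (hloc y hy).2
  have hφd : DifferentiableAt ℝ φ x := (hφ.contDiffAt (hV.mem_nhds hxV)).differentiableAt (by simp)
  have hφne : fderiv ℝ φ x ≠ 0 := by simpa using hli.ne_zero 0
  have hβ := h.tau_directed x hxO
  have hN0 : N e D x 0 = 1 := EulerBoundary.N_zero hβ
  have hNN := ip_N_N hβ (h.tau_timelike x hxO)
  have hNb := Nbar_eq hc hx hφne hTH
  set n := raise e D x fun β => pd β φ x with hn
  have hnN : IsNormal e D x n := isNormal_raise_pd hTH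
  have hn0 : n 0 ≠ 0 := hnN.zero_component_ne hc hx (raise_pd_ne_zero hφne)
  have hdφ : ∀ X, fderiv ℝ φ x X = n 0 * ip e D x (Nbar e D x) X := fun X => by
    rw [hNb, ip_smul_left, hn, ip_raise_left, sum_pd_mul, ← mul_assoc, mul_inv_cancel₀ hn0, one_mul]
    rfl
  have hdτ : ∀ X, dir X D.tau x = -dir (B D x) D.tau x * ip e D x (N e D x) X := fun X => by
    rw [ip_N_left]
    field_simp
  have hNb0 : Nbar e D x 0 = 1 := by
    rw [hNb]; simp [hn0]
  have hmem : ∀ X, X ∈ TH D x ↔ ip e D x (Nbar e D x) X = 0 := fun X => by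
    rw [hTH]
    change fderiv ℝ φ x X = 0 ↔ _
    rw [hdφ]
    simp [hn0]
  have hsph : ∀ X, SphereTangent D x X ↔
      ip e D x (Nbar e D x) X = 0 ∧ ip e D x (N e D x) X = 0 := fun X => by
    rw [SphereTangent, hmem, hdτ]
    simp [hβ.ne']
  have hNne : Nbar e D x ≠ N e D x := by
    intro heq
    have := LinearIndependent.pair_iff.1 hli (n 0)⁻¹ (dir (B D x) D.tau x)⁻¹ (by
      ext X
      have h1 : fderiv ℝ D.tau x X = dir X D.tau x := rfl
      simp only [add_apply, smul_apply, smul_eq_mul, zero_apply]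
      rw [h1, hdτ X, hdφ, heq]
      field_simp
      ring)
    exact inv_ne_zero hn0 this.1
  set p := tilt e D x with hp
  have hpN : ip e D x (Nbar e D x) (N e D x) = p * ip e D x (N e D x) (N e D x) := by
    rw [hp, tilt, div_mul_cancel₀ _ hNN.ne]
  set Z₀ := Nbar e D x - p • N e D x with hZ₀
  have hZ₀N : ip e D x (N e D x) Z₀ = 0 := by
    rw [hZ₀, ip_sub_right, ip_smul_right, ip_comm (N e D x) (Nbar e D x), hpN]
    ring
  have hZ₀ne : Z₀ ≠ 0 := by
    intro h0
    have h1 : Nbar e D x = p • N e D x := sub_eq_zero.1 h0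
    have h2 : p = 1 := by
      have := congrFun h1 0
      rw [hNb0, Pi.smul_apply, hN0] at this
      simpa using this.symm
    exact hNne (by rw [h1, h2, one_smul])
  have hZ₀p := ip_pos_of_orthogonal hNN hZ₀N hZ₀ne
  have hNbZ₀ : ip e D x (Nbar e D x) Z₀ = ip e D x Z₀ Z₀ := by
    have h1 : Nbar e D x = Z₀ + p • N e D x := by rw [hZ₀]; abel
    conv_lhs => rw [h1]
    rw [ip_add_left, ip_smul_left, hZ₀N, mul_zero, add_zero]
  have hZ : IsOuterNormal e D x (Z e D x) := by
    refine Classical.epsilon_spec (p := fun X => IsOuterNormal e D x X) ?_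
    obtain ⟨r, hr1, hr2⟩ : ∃ r : ℝ, r * r * ip e D x Z₀ Z₀ = 1 ∧ 0 < r * (n 0 * ip e D x Z₀ Z₀) := by
      have hs := Real.mul_self_sqrt hZ₀p.le
      have hs0 := Real.sqrt_pos.2 hZ₀p
      set s := Real.sqrt (ip e D x Z₀ Z₀)
      rcases lt_or_gt_of_ne hn0 with hneg | hpos
      · refine ⟨-s⁻¹, ?_, ?_⟩
        · rw [← hs]; field_simp
        · have := mul_pos (inv_pos.2 hs0) (mul_pos (neg_pos.2 hneg) hZ₀p)
          linarith
      · refine ⟨s⁻¹, ?_, mul_pos (inv_pos.2 hs0) (mul_pos hpos hZ₀p)⟩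
        rw [← hs]; field_simp
    refine ⟨r • Z₀, ?_, ?_, ?_, ?_⟩
    · rw [hdτ, ip_smul_right, hZ₀N]; ring
    · intro Y hY
      rw [hsph] at hY
      rw [ip_smul_left, hZ₀, ip_sub_left, ip_smul_left, hY.1, hY.2]; ring
    · rw [ip_smul_left, ip_smul_right, ← mul_assoc, hr1]
    · intro hcone
      have hmax : IsLocalMaxOn φ (SigmaTilde D (D.tau x)) x := by
        have hφ0 : φ x = 0 := ((hloc x hxV).2.1 hx).2
        filter_upwards [self_mem_nhdsWithin, nhdsWithin_le_nhds (hV.mem_nhds hxV)] with y hy hyV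
        rw [hφ0]
        exact ((hloc y hyV).1.1 hy.1).2
      have := hmax.hasFDerivWithinAt_nonpos hφd.hasFDerivAt.hasFDerivWithinAt hcone
      rw [hdφ, ip_smul_right, hNbZ₀] at this
      linarith
  obtain ⟨hZτ, hZS, hZZ, -⟩ := hZ
  have hNZ : ip e D x (N e D x) (Z e D x) = 0 := by
    rw [ip_N_left, hZτ, mul_zero]
  have horth : ∀ Y, ip e D x (N e D x) Y = 0 → ip e D x Z₀ Y = 0 → SphereTangent D x Y := by
    intro Y h1 h2
    rw [hsph]
    refine ⟨?_, h1⟩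
    rwa [hZ₀, ip_sub_left, ip_smul_left, h1, mul_zero, sub_zero] at h2
  have hz := h.zbar_pos x hx
  have hh := h.hbar_pos x hx
  have hzdef : ip e D x (Z e D x) (Nbar e D x) = -zbar e D x := by rw [zbar, neg_neg]
  have hhdef : ip e D x (Hbar e D x) (N e D x) = -hbar e D x := by rw [hbar, neg_neg]
  have hZZ₀ : ip e D x (Z e D x) Z₀ = -zbar e D x := by
    rw [hZ₀, ip_sub_right, ip_smul_right, ip_comm _ (N e D x), hNZ, hzdef]; ring
  have hZdec := mem_span_of_orthogonal hNN hZ₀N hZ₀p fun Y h1 h2 => hZS Y (horth Y h1 h2)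
  rw [ip_comm _ (N e D x), hNZ, zero_div, zero_smul, zero_add, hZZ₀] at hZdec
  have hzz : zbar e D x ^ 2 = ip e D x Z₀ Z₀ := by
    have h1 := hZZ₀
    rw [hZdec, ip_smul_left] at h1
    have h2 := hZZ
    rw [hZdec, ip_smul_left, ip_smul_right] at h2
    field_simp at h2
    linarith
  have hNbdec : Nbar e D x = p • N e D x - zbar e D x • Z e D x := by
    have h1 : zbar e D x • Z e D x = -Z₀ := by
      rw [hZdec, smul_smul, ← hzz]
      have : zbar e D x * (-zbar e D x / zbar e D x ^ 2) = -1 := by field_simp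
      rw [this, neg_one_smul]
    rw [h1, hZ₀]; abel
  obtain ⟨hHT, hHS, hH0⟩ : IsGenerator e D x (Hbar e D x) :=
    Classical.epsilon_spec (h.generator_exists x hx)
  have hHdec := mem_span_of_orthogonal hNN hNZ (by rw [hZZ]; exact one_pos)
    (X := Hbar e D x) fun Y h1 h2 => hHS Y (by
      rw [hsph, hNbdec, ip_sub_left, ip_smul_left, ip_smul_left, h1, h2]
      simp)
  rw [hZZ, div_one, hhdef] at hHdec
  have hHZ : ip e D x (Hbar e D x) (Z e D x) = -(p * hbar e D x / zbar e D x) := by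
    have h1 := (hmem _).1 hHT
    rw [hNbdec, ip_sub_left, ip_smul_left, ip_smul_left, ip_comm (N e D x), ip_comm (Z e D x),
      hhdef] at h1
    field_simp
    linarith
  refine ⟨hβ, hN0, hNb0, hH0, hNN, hZZ, hNZ, hmem, hNbdec, ?_, hz, hh, hHT⟩
  rw [hHZ] at hHdec
  rw [sub_eq_add_neg, ← neg_smul]
  rwa [div_neg, ← neg_div]

end Frame

/-! ### Smooth dependence of the geometric quantities on the frame -/

section EquationOfState

theorem EquationOfState.contDiffOn_fderiv (e : EquationOfState) (w : ℝ × ℝ) :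
    ContDiffOn ℝ 1 (fun q => fderiv ℝ (Function.uncurry e.p) q w) {q : ℝ × ℝ | 0 < q.1} :=
  (e.smooth.fderiv_of_isOpen (m := 1) (isOpen_lt continuous_const continuous_fst)
    (WithTop.coe_le_coe.2 le_top)).clm_apply contDiffOn_const

theorem EquationOfState.differentiableAt (e : EquationOfState) {r s : ℝ} (hr : 0 < r) :
    DifferentiableAt ℝ (Function.uncurry e.p) (r, s) :=
  (e.smooth.contDiffAt ((isOpen_lt continuous_const continuous_fst).mem_nhds hr)).differentiableAt
    (by simp)

theorem EquationOfState.contDiff_comp (e : EquationOfState) {F : ℝ × ℝ → ℝ}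
    (hF : ContDiffOn ℝ 1 F {q : ℝ × ℝ | 0 < q.1}) :
    ContDiff ℝ 1 fun u : Fin 5 → ℝ => F (e.rhoBar * Real.exp (u 0), u 4) := by
  rw [← contDiffOn_univ]
  refine hF.comp (t := {q : ℝ × ℝ | 0 < q.1}) (f := fun u : Fin 5 → ℝ =>
    (e.rhoBar * Real.exp (u 0), u 4)) ?_ fun u _ => mul_pos e.rhoBar_pos (Real.exp_pos _)
  exact ((contDiff_const.mul (Real.contDiff_exp.comp (contDiff_apply ℝ ℝ 0))).prodMk
    (contDiff_apply ℝ ℝ 4)).contDiffOn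

theorem EquationOfState.contDiff_c (e : EquationOfState) :
    ContDiff ℝ 1 fun u : Fin 5 → ℝ => e.c (u 0) (u 4) := by
  have h1 : ContDiffOn ℝ 1 (fun q : ℝ × ℝ => deriv (fun r => e.p r q.2) q.1)
      {q : ℝ × ℝ | 0 < q.1} := by
    refine (e.contDiffOn_fderiv (1, 0)).congr fun q hq => ?_
    have h2 : HasDerivAt (fun r : ℝ => (r, q.2)) ((1 : ℝ), (0 : ℝ)) q.1 :=
      (hasDerivAt_id q.1).prodMk (hasDerivAt_const _ _)
    exact ((e.differentiableAt (s := q.2) hq).hasFDerivAt.comp_hasDerivAt q.1 h2).deriv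
  refine (e.contDiff_comp h1).sqrt fun u => ?_
  exact (e.hyperbolic _ _ (mul_pos e.rhoBar_pos (Real.exp_pos _))).ne'

theorem EquationOfState.contDiff_pS (e : EquationOfState) :
    ContDiff ℝ 1 fun u : Fin 5 → ℝ => e.pS (u 0) (u 4) := by
  have h1 : ContDiffOn ℝ 1 (fun q : ℝ × ℝ => deriv (fun s => e.p q.1 s) q.2)
      {q : ℝ × ℝ | 0 < q.1} := by
    refine (e.contDiffOn_fderiv (0, 1)).congr fun q hq => ?_
    have h2 : HasDerivAt (fun s : ℝ => (q.1, s)) ((0 : ℝ), (1 : ℝ)) q.2 :=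
      (hasDerivAt_const _ _).prodMk (hasDerivAt_id q.2)
    exact ((e.differentiableAt (s := q.2) hq).hasFDerivAt.comp_hasDerivAt q.2 h2).deriv
  exact e.contDiff_comp h1

end EquationOfState

/-- The boundary points of the configurations with the property `K`. -/
abbrev Points (e : EquationOfState) (K : Config → Prop) := {q : BoundaryPoint e // K q.D}

section Fluid

variable {e : EquationOfState} {K : Config → Prop} {E : Type} [NormedAddCommGroup E]
  [NormedSpace ℝ E] {A : Points e K → E}

/-- The array `A` determines the fluid variables smoothly. -/
def FluidArray (A : Points e K → E) : Prop :=
  ∀ J, FunctionOf 1 A fun q => Psi q.1.D J q.1.x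

/-- The vector `X` at the boundary points is a `C^1` function of the array `A`. -/
def VecFunctionOf (A : Points e K → E) (X : Points e K → Vec) : Prop :=
  ∀ α, FunctionOf 1 A fun q => X q α

namespace VecFunctionOf

variable {X Y : Points e K → Vec} {a : Points e K → ℝ}

theorem add (hX : VecFunctionOf A X) (hY : VecFunctionOf A Y) : VecFunctionOf A fun q => X q + Y q :=
  fun α => (hX α).add (hY α)

theorem sub (hX : VecFunctionOf A X) (hY : VecFunctionOf A Y) : VecFunctionOf A fun q => X q - Y q :=
  fun α => (hX α).sub (hY α)

theorem smul (ha : FunctionOf 1 A a) (hX : VecFunctionOf A X) : VecFunctionOf A fun q => a q • X q :=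
  fun α => ha.mul (hX α)

theorem congr (hX : VecFunctionOf A X) (h : ∀ q, Y q = X q) : VecFunctionOf A Y := by
  rwa [show Y = X from funext h]

end VecFunctionOf

namespace FluidArray

theorem rho (hA : FluidArray A) : FunctionOf 1 A fun q => q.1.D.rho q.1.x := hA 0

theorem v (hA : FluidArray A) (i : Fin 3) : FunctionOf 1 A fun q => q.1.D.v i q.1.x := by
  fin_cases i
  exacts [hA 1, hA 2, hA 3]

theorem snd (hA : FluidArray A) : FunctionOf 1 A fun q => EulerBoundary.snd e q.1.D q.1.x :=
  (FunctionOf.of_contDiff (A := fun q : Points e K => fun J => Psi q.1.D J q.1.x) e.contDiff_c).comp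
    hA

theorem pSbar (hA : FluidArray A) : FunctionOf 1 A fun q => EulerBoundary.pSbar e q.1.D q.1.x :=
  ((FunctionOf.of_contDiff (A := fun q : Points e K => fun J => Psi q.1.D J q.1.x)
    e.contDiff_pS).comp hA).div (.const _) fun _ => e.rhoBar_pos.ne'

theorem snd_inv_pow (hA : FluidArray A) (k : ℕ) :
    FunctionOf 1 A fun q => (EulerBoundary.snd e q.1.D q.1.x ^ k)⁻¹ :=
  (hA.snd.pow k).inv fun _ => (pow_pos (snd_pos _ _ _) k).ne'

theorem log_snd (hA : FluidArray A) :
    FunctionOf 1 A fun q => Real.log (EulerBoundary.snd e q.1.D q.1.x) :=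
  hA.snd.comp_real (G := Real.log) (V := {0}ᶜ) isOpen_compl_singleton
    (fun _ ht => (Real.contDiffAt_log.2 ht).contDiffWithinAt) fun _ => (snd_pos _ _ _).ne'

theorem B (hA : FluidArray A) : VecFunctionOf A fun q => EulerBoundary.B q.1.D q.1.x := by
  intro α
  refine Fin.cases ?_ (fun i => ?_) α
  · exact .const 1
  · exact hA.v i

theorem coframe (hA : FluidArray A) (a : Fin 3) (α : Fin 4) :
    FunctionOf 1 A fun q => EulerBoundary.coframe q.1.D a q.1.x α :=
  (FunctionOf.const _).sub ((hA.v a).mul (.const _))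

theorem gLow (hA : FluidArray A) (α β : Fin 4) :
    FunctionOf 1 A fun q => EulerBoundary.gLow e q.1.D q.1.x α β :=
  (FunctionOf.const _).add
    ((hA.snd_inv_pow 2).mul (.sum _ fun a => (hA.coframe a α).mul (hA.coframe a β)))

theorem gUp (hA : FluidArray A) (α β : Fin 4) :
    FunctionOf 1 A fun q => EulerBoundary.gUp e q.1.D q.1.x α β :=
  ((hA.B α).mul (hA.B β)).neg.add ((hA.snd.pow 2).mul (.const _))

theorem low (hA : FluidArray A) {X : Points e K → Vec} (hX : VecFunctionOf A X) (α : Fin 4) :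
    FunctionOf 1 A fun q => EulerBoundary.low e q.1.D q.1.x (X q) α :=
  .sum _ fun β => (hA.gLow α β).mul (hX β)

theorem ip (hA : FluidArray A) {X Y : Points e K → Vec} (hX : VecFunctionOf A X)
    (hY : VecFunctionOf A Y) :
    FunctionOf 1 A fun q => EulerBoundary.ip e q.1.D q.1.x (X q) (Y q) :=
  .sum _ fun α => .sum _ fun β => ((hA.gLow α β).mul (hX α)).mul (hY β)

theorem raise (hA : FluidArray A) {w : Points e K → Fin 4 → ℝ}
    (hw : ∀ α, FunctionOf 1 A fun q => w q α) :
    VecFunctionOf A fun q => EulerBoundary.raise e q.1.D q.1.x (w q) :=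
  fun α => .sum _ fun β => (hA.gUp α β).mul (hw β)

end FluidArray

/-- The array `A` determines the fluid variables and the vectorfields `N`, `N̲`, `Z`, `H̲` smoothly. -/
structure FrameArray (A : Points e K → E) : Prop where
  psi : FluidArray A
  N : VecFunctionOf A fun q => EulerBoundary.N e q.1.D q.1.x
  Nbar : VecFunctionOf A fun q => EulerBoundary.Nbar e q.1.D q.1.x
  Z : VecFunctionOf A fun q => EulerBoundary.Z e q.1.D q.1.x
  Hbar : VecFunctionOf A fun q => EulerBoundary.Hbar e q.1.D q.1.x

theorem IsFrame.tilt_eq {D : Config} {x : Vec} (h : IsFrame e D x) :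
    tilt e D x = 1 + zbar e D x * EulerBoundary.Z e D x 0 := by
  have h1 := congrFun h.Nbar_decomp 0
  simp only [Pi.sub_apply, Pi.smul_apply, smul_eq_mul, h.N_zero, h.Nbar_zero] at h1
  linarith

theorem IsFrame.ip_HbarZ {D : Config} {x : Vec} (h : IsFrame e D x) :
    ip e D x (EulerBoundary.Hbar e D x) (EulerBoundary.Z e D x) =
      -(tilt e D x * hbar e D x / zbar e D x) := by
  conv_lhs => rw [h.Hbar_decomp]
  rw [ip_sub_left, ip_smul_left, ip_smul_left, h.ip_NZ, h.ip_ZZ]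
  ring

/-- `N̲` is a function of `N`, `Z` and `H̲`. -/
theorem FrameArray.of_N_Z_Hbar (hK : ∀ q : Points e K, IsFrame e q.1.D q.1.x) (hΨ : FluidArray A)
    (hN : VecFunctionOf A fun q => EulerBoundary.N e q.1.D q.1.x)
    (hZ : VecFunctionOf A fun q => EulerBoundary.Z e q.1.D q.1.x)
    (hH : VecFunctionOf A fun q => EulerBoundary.Hbar e q.1.D q.1.x) : FrameArray A := by
  have hh : FunctionOf 1 A fun q => hbar e q.1.D q.1.x := (hΨ.ip hH hN).neg
  have hb := hΨ.ip hH hZ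
  -- From `g(H̲, Z) = -p h̲ / z̲` and `p = 1 + z̲ Z⁰`.
  have hzq : ∀ q : Points e K, zbar e q.1.D q.1.x *
      (-(ip e q.1.D q.1.x (EulerBoundary.Hbar e q.1.D q.1.x) (EulerBoundary.Z e q.1.D q.1.x)
        / hbar e q.1.D q.1.x) - EulerBoundary.Z e q.1.D q.1.x 0) = 1 := fun q => by
    have h1 := (hK q).tilt_eq
    have h2 := (hK q).z_pos.ne'
    have h3 := (hK q).h_pos.ne'
    rw [(hK q).ip_HbarZ]
    field_simp
    linarith
  have hz : FunctionOf 1 A fun q => zbar e q.1.D q.1.x :=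
    (((hb.div hh fun q => (hK q).h_pos.ne').neg.sub (hZ 0)).inv
      fun q => right_ne_zero_of_mul_eq_one (hzq q)).congr fun q => eq_inv_of_mul_eq_one_left (hzq q)
  have hp : FunctionOf 1 A fun q => tilt e q.1.D q.1.x :=
    ((FunctionOf.const 1).add (hz.mul (hZ 0))).congr fun q => (hK q).tilt_eq
  exact ⟨hΨ, hN, ((VecFunctionOf.smul hp hN).sub (.smul hz hZ)).congr fun q => (hK q).Nbar_decomp,
    hZ, hH⟩

/-- `Z` and `H̲` are functions of `N` and `N̲`. -/
theorem FrameArray.of_N_Nbar (hK : ∀ q : Points e K, IsFrame e q.1.D q.1.x) (hΨ : FluidArray A)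
    (hN : VecFunctionOf A fun q => EulerBoundary.N e q.1.D q.1.x)
    (hNb : VecFunctionOf A fun q => EulerBoundary.Nbar e q.1.D q.1.x) : FrameArray A := by
  have hp : FunctionOf 1 A fun q => tilt e q.1.D q.1.x :=
    (hΨ.ip hNb hN).div (hΨ.ip hN hN) fun q => (hK q).ip_NN.ne
  have hW := (VecFunctionOf.smul hp hN).sub hNb
  have hWq : ∀ q : Points e K, tilt e q.1.D q.1.x • EulerBoundary.N e q.1.D q.1.x -
      EulerBoundary.Nbar e q.1.D q.1.x = zbar e q.1.D q.1.x • EulerBoundary.Z e q.1.D q.1.x :=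
    fun q => by
      conv_lhs => rw [(hK q).Nbar_decomp]
      abel
  have hz2 : FunctionOf 1 A fun q => zbar e q.1.D q.1.x ^ 2 :=
    (hΨ.ip hW hW).congr fun q => by
      rw [hWq, ip_smul_left, ip_smul_right, (hK q).ip_ZZ]; ring
  have hz : FunctionOf 1 A fun q => zbar e q.1.D q.1.x :=
    (hz2.sqrt fun q => (pow_pos (hK q).z_pos 2).ne').congr fun q =>
      (Real.sqrt_sq (hK q).z_pos.le).symm
  have hZ : VecFunctionOf A fun q => EulerBoundary.Z e q.1.D q.1.x :=
    (VecFunctionOf.smul (hz.inv fun q => (hK q).z_pos.ne') hW).congr fun q => by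
      rw [hWq, smul_smul, inv_mul_cancel₀ (hK q).z_pos.ne', one_smul]
  have hν : FunctionOf 1 A fun q =>
      -ip e q.1.D q.1.x (EulerBoundary.N e q.1.D q.1.x) (EulerBoundary.N e q.1.D q.1.x) :=
    (hΨ.ip hN hN).neg
  have hνq : ∀ q : Points e K, -ip e q.1.D q.1.x (EulerBoundary.N e q.1.D q.1.x)
      (EulerBoundary.N e q.1.D q.1.x) ≠ 0 := fun q => (neg_pos.2 (hK q).ip_NN).ne'
  -- The time component of the decomposition of `H̲`, which is one, determines `h̲`.
  have hhq : ∀ q : Points e K, hbar e q.1.D q.1.x * ((-ip e q.1.D q.1.x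
      (EulerBoundary.N e q.1.D q.1.x) (EulerBoundary.N e q.1.D q.1.x))⁻¹ -
        tilt e q.1.D q.1.x * (zbar e q.1.D q.1.x)⁻¹ * EulerBoundary.Z e q.1.D q.1.x 0) = 1 :=
    fun q => by
      have h1 := congrFun (hK q).Hbar_decomp 0
      simp only [Pi.sub_apply, Pi.smul_apply, smul_eq_mul, (hK q).Hbar_zero, (hK q).N_zero] at h1
      rw [h1]
      ring
  have hh : FunctionOf 1 A fun q => hbar e q.1.D q.1.x :=
    (((hν.inv hνq).sub ((hp.mul (hz.inv fun q => (hK q).z_pos.ne')).mul (hZ 0))).inv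
      fun q => right_ne_zero_of_mul_eq_one (hhq q)).congr fun q => eq_inv_of_mul_eq_one_left (hhq q)
  exact ⟨hΨ, hN, hNb, hZ, ((VecFunctionOf.smul (hh.div hν hνq) hN).sub
    (.smul ((hp.mul hh).div hz fun q => (hK q).z_pos.ne') hZ)).congr fun q => (hK q).Hbar_decomp⟩

namespace FrameArray

theorem zbar (hA : FrameArray A) : FunctionOf 1 A fun q => EulerBoundary.zbar e q.1.D q.1.x :=
  (hA.psi.ip hA.Z hA.Nbar).neg

theorem hbar (hA : FrameArray A) : FunctionOf 1 A fun q => EulerBoundary.hbar e q.1.D q.1.x :=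
  (hA.psi.ip hA.Hbar hA.N).neg

theorem zbar_inv (hK : ∀ q : Points e K, IsFrame e q.1.D q.1.x) (hA : FrameArray A) :
    FunctionOf 1 A fun q => 1 / EulerBoundary.zbar e q.1.D q.1.x :=
  (FunctionOf.const 1).div hA.zbar fun q => (hK q).z_pos.ne'

theorem hbar_inv (hK : ∀ q : Points e K, IsFrame e q.1.D q.1.x) (hA : FrameArray A) :
    FunctionOf 1 A fun q => 1 / EulerBoundary.hbar e q.1.D q.1.x :=
  (FunctionOf.const 1).div hA.hbar fun q => (hK q).h_pos.ne'

theorem nu (hK : ∀ q : Points e K, IsFrame e q.1.D q.1.x) (hA : FrameArray A) :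
    FunctionOf 1 A fun q => EulerBoundary.nu e q.1.D q.1.x :=
  (hA.psi.ip hA.N hA.N).neg.sqrt fun q => (neg_pos.2 (hK q).ip_NN).ne'

theorem Nhat (hK : ∀ q : Points e K, IsFrame e q.1.D q.1.x) (hA : FrameArray A) :
    VecFunctionOf A fun q => EulerBoundary.Nhat e q.1.D q.1.x :=
  fun α => (hA.N α).div (hA.nu hK) fun q => (Real.sqrt_pos.2 (neg_pos.2 (hK q).ip_NN)).ne'

theorem sLow (hK : ∀ q : Points e K, IsFrame e q.1.D q.1.x) (hA : FrameArray A) (α β : Fin 4) :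
    FunctionOf 1 A fun q => EulerBoundary.sLow e q.1.D q.1.x α β :=
  ((hA.psi.gLow α β).add ((hA.psi.low (hA.Nhat hK) α).mul (hA.psi.low (hA.Nhat hK) β))).sub
    ((hA.psi.low hA.Z α).mul (hA.psi.low hA.Z β))

theorem sUp (hK : ∀ q : Points e K, IsFrame e q.1.D q.1.x) (hA : FrameArray A) (α β : Fin 4) :
    FunctionOf 1 A fun q => EulerBoundary.sUp e q.1.D q.1.x α β :=
  ((hA.psi.gUp α β).add ((hA.Nhat hK α).mul (hA.Nhat hK β))).sub ((hA.Z α).mul (hA.Z β))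

theorem sProj (hK : ∀ q : Points e K, IsFrame e q.1.D q.1.x) (hA : FrameArray A) (α β : Fin 4) :
    FunctionOf 1 A fun q => EulerBoundary.sProj e q.1.D q.1.x α β :=
  ((FunctionOf.const _).add ((hA.Nhat hK α).mul (hA.psi.low (hA.Nhat hK) β))).sub
    ((hA.Z α).mul (hA.psi.low hA.Z β))

theorem Theta (hK : ∀ q : Points e K, IsFrame e q.1.D q.1.x) (hA : FrameArray A) :
    VecFunctionOf A fun q => EulerBoundary.Theta e q.1.D q.1.x :=
  fun α => ((hA.psi.B α).sub ((hA.hbar_inv hK).mul (hA.Hbar α))).sub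
    ((hA.zbar_inv hK).mul (hA.Z α))

theorem Ebar (hK : ∀ q : Points e K, IsFrame e q.1.D q.1.x) (hA : FrameArray A) :
    VecFunctionOf A fun q => EulerBoundary.Ebar e q.1.D q.1.x :=
  fun α => (hA.psi.B α).sub ((hA.zbar_inv hK).mul (hA.Z α))

theorem P (hK : ∀ q : Points e K, IsFrame e q.1.D q.1.x) (hA : FrameArray A) :
    VecFunctionOf A fun q => EulerBoundary.P e q.1.D q.1.x :=
  fun α => ((hA.Nbar α).sub (hA.N α)).div hA.hbar fun q => (hK q).h_pos.ne'

theorem lam (hK : ∀ q : Points e K, IsFrame e q.1.D q.1.x) (hA : FrameArray A) (α : Fin 4) :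
    VecFunctionOf A fun q => EulerBoundary.lam e q.1.D α q.1.x :=
  fun β => ((FunctionOf.const _).add ((hA.psi.low hA.Nbar α).mul (hA.psi.B β))).sub
    ((hA.psi.low (hA.P hK) α).mul (hA.Hbar β))

theorem slash (hK : ∀ q : Points e K, IsFrame e q.1.D q.1.x) (hA : FrameArray A)
    {V : Points e K → Vec} (hV : VecFunctionOf A V) :
    VecFunctionOf A fun q => EulerBoundary.slash e q.1.D q.1.x (V q) :=
  fun α => .sum _ fun β => (hA.sProj hK α β).mul (hV β)

theorem sIp (hK : ∀ q : Points e K, IsFrame e q.1.D q.1.x) (hA : FrameArray A)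
    {X Y : Points e K → Vec} (hX : VecFunctionOf A X) (hY : VecFunctionOf A Y) :
    FunctionOf 1 A fun q => EulerBoundary.sIp e q.1.D q.1.x (X q) (Y q) :=
  .sum _ fun α => .sum _ fun β => ((hA.sLow hK α β).mul (hX α)).mul (hY β)

end FrameArray

end Fluid

/-! ### Differentiation along the lateral boundary -/

section ChainRule

variable {e : EquationOfState} {K : Config → Prop} {κ : Type} [Fintype κ]

/-- The chain rule along `H`. If `f` is a universal `C^1` function of the array `A` at all boundary
points, then its `H`-tangent derivatives are universal linear combinations of those of `A`. -/
theorem FunctionOf.exists_along_eq {A : Config → Vec → κ → ℝ} {f : Config → Vec → ℝ}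
    (hf : FunctionOf 1 (fun q : Points e K => A q.1.D q.1.x) fun q => f q.1.D q.1.x)
    (hA : ∀ (q : Points e K) j, DifferentiableWithinAt ℝ (fun y => A q.1.D y j) q.1.D.H q.1.x) :
    (∀ q : Points e K, DifferentiableWithinAt ℝ (f q.1.D) q.1.D.H q.1.x) ∧
    ∃ c : κ → Points e K → ℝ,
      (∀ j, FunctionOf 0 (fun q : Points e K => A q.1.D q.1.x) (c j)) ∧
      ∀ (q : Points e K) (X : Vec), X ∈ TH q.1.D q.1.x →
        along q.1.D X (f q.1.D) q.1.x =
          ∑ j, c j q * along q.1.D X (fun y => A q.1.D y j) q.1.x := by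
  classical
  obtain ⟨W, F, hW, hF, hq⟩ := hf
  have hder : ∀ q : Points e K, HasFDerivWithinAt (f q.1.D)
      ((fderiv ℝ F (A q.1.D q.1.x)).comp
        (ContinuousLinearMap.pi fun j => fderivWithin ℝ (fun y => A q.1.D y j) q.1.D.H q.1.x))
      q.1.D.H q.1.x := by
    intro q
    have h1 : HasFDerivAt F (fderiv ℝ F (A q.1.D q.1.x)) (A q.1.D q.1.x) :=
      ((hF.contDiffAt (hW.mem_nhds (hq q).1)).differentiableAt (by simp)).hasFDerivAt
    have h2 : HasFDerivWithinAt (fun y => A q.1.D y) (ContinuousLinearMap.pi fun j =>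
        fderivWithin ℝ (fun y => A q.1.D y j) q.1.D.H q.1.x) q.1.D.H q.1.x :=
      hasFDerivWithinAt_pi.2 fun j => (hA q j).hasFDerivWithinAt
    refine (h1.comp_hasFDerivWithinAt q.1.x h2).congr (fun y hy => ?_) (hq q).2
    exact (hq ⟨⟨q.1.D, q.1.admissible, y, hy⟩, q.2⟩).2
  refine ⟨fun q => (hder q).differentiableWithinAt,
    fun j q => fderiv ℝ F (A q.1.D q.1.x) (Pi.single j 1), fun j => ?_, fun q X hX => ?_⟩
  · exact ⟨W, fun a => fderiv ℝ F a (Pi.single j 1), hW,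
      contDiffOn_zero.2 ((hF.continuousOn_fderiv_of_isOpen hW le_rfl).clm_apply
        continuousOn_const), fun q => ⟨(hq q).1, rfl⟩⟩
  · rw [along_eq (hder q) hX]
    simp only [ContinuousLinearMap.comp_apply]
    set u : κ → ℝ := fun j => along q.1.D X (fun y => A q.1.D y j) q.1.x with hu
    have h1 : (ContinuousLinearMap.pi fun j =>
        fderivWithin ℝ (fun y => A q.1.D y j) q.1.D.H q.1.x) X = ∑ j, u j • Pi.single j 1 := by
      ext i
      simp [hu, along, Finset.sum_apply, Pi.single_apply]
    rw [h1, map_sum]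
    exact Finset.sum_congr rfl fun j _ => by rw [map_smul, smul_eq_mul, mul_comm]

end ChainRule

section Differentiability

variable {e : EquationOfState} {D : Config} {x : Vec}

theorem Admissible.mem_O (h : Admissible e D) (hx : x ∈ D.H) : x ∈ D.O :=
  h.M_subset (h.H_subset hx)

theorem Admissible.contDiffAt_Psi (h : Admissible e D) (hx : x ∈ D.O) (J : Fin 5) :
    ContDiffAt ℝ ∞ (Psi D J) x := by
  have hO := h.isOpen_O.mem_nhds hx
  fin_cases J
  exacts [h.smooth_rho.contDiffAt hO, (h.smooth_v 0).contDiffAt hO, (h.smooth_v 1).contDiffAt hO,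
    (h.smooth_v 2).contDiffAt hO, h.smooth_s.contDiffAt hO]

theorem Admissible.differentiableAt_Psi (h : Admissible e D) (hx : x ∈ D.O) (J : Fin 5) :
    DifferentiableAt ℝ (Psi D J) x := (h.contDiffAt_Psi hx J).differentiableAt (by simp)

theorem Admissible.differentiableAt_v (h : Admissible e D) (hx : x ∈ D.O) (i : Fin 3) :
    DifferentiableAt ℝ (D.v i) x :=
  ((h.smooth_v i).contDiffAt (h.isOpen_O.mem_nhds hx)).differentiableAt (by simp)

theorem differentiableAt_pd {f : Vec → ℝ} (hf : ContDiffAt ℝ ∞ f x) (α : Fin 4) :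
    DifferentiableAt ℝ (pd α f) x :=
  ((hf.fderiv_right (m := ∞) (by simp)).differentiableAt (by simp)).clm_apply
    (differentiableAt_const _)

theorem Admissible.differentiableAt_pd_tau (h : Admissible e D) (hx : x ∈ D.O) (α : Fin 4) :
    DifferentiableAt ℝ (pd α D.tau) x :=
  differentiableAt_pd (h.smooth_tau.contDiffAt (h.isOpen_O.mem_nhds hx)) α

theorem Admissible.differentiableAt_snd (h : Admissible e D) (hx : x ∈ D.O) :
    DifferentiableAt ℝ (snd e D) x := by
  have h1 : DifferentiableAt ℝ (fun y => fun J => Psi D J y) x :=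
    differentiableAt_pi.2 (h.differentiableAt_Psi hx)
  exact (e.contDiff_c.differentiable (by simp) _).comp x h1

theorem Admissible.differentiableAt_log_snd (h : Admissible e D) (hx : x ∈ D.O) :
    DifferentiableAt ℝ (fun y => Real.log (snd e D y)) x :=
  (h.differentiableAt_snd hx).log (snd_pos e D x).ne'

theorem Admissible.differentiableAt_B (h : Admissible e D) (hx : x ∈ D.O) (α : Fin 4) :
    DifferentiableAt ℝ (fun y => B D y α) x := by
  refine Fin.cases ?_ (fun i => ?_) α
  · exact differentiableAt_const _
  · exact h.differentiableAt_v hx i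

theorem Admissible.differentiableAt_gLow (h : Admissible e D) (hx : x ∈ D.O) (α β : Fin 4) :
    DifferentiableAt ℝ (fun y => gLow e D y α β) x := by
  have hv := h.differentiableAt_v hx
  have hc : ∀ a γ, DifferentiableAt ℝ (fun y => coframe D a y γ) x := fun a γ =>
    (differentiableAt_const _).sub ((hv a).mul (differentiableAt_const _))
  exact (differentiableAt_const _).add
    ((((h.differentiableAt_snd hx).pow 2).inv (pow_pos (snd_pos e D x) 2).ne').mul
      (DifferentiableAt.fun_sum fun a _ => (hc a α).mul (hc a β)))

theorem Admissible.differentiableAt_gUp (h : Admissible e D) (hx : x ∈ D.O) (α β : Fin 4) :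
    DifferentiableAt ℝ (fun y => gUp e D y α β) x :=
  (((h.differentiableAt_B hx α).mul (h.differentiableAt_B hx β)).neg).add
    (((h.differentiableAt_snd hx).pow 2).mul (differentiableAt_const _))

/-- `N̲` is differentiable along `H`, because it is the normalized `g`-gradient of a defining
function. -/
theorem Admissible.differentiableWithinAt_Nbar (h : Admissible e D)
    (hc : IsSpacelike e D ∨ IsNull e D) (hx : x ∈ D.H) (α : Fin 4) :
    DifferentiableWithinAt ℝ (fun y => Nbar e D y α) D.H x := by
  have hxO := h.mem_O hx
  obtain ⟨φ, V, hV, hxV, hφ, hli, hloc⟩ := h.local_lateral x hx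
  have hφx : ContDiffAt ℝ ∞ φ x := hφ.contDiffAt (hV.mem_nhds hxV)
  have hτx : ContDiffAt ℝ ∞ D.tau x := h.smooth_tau.contDiffAt (h.isOpen_O.mem_nhds hxO)
  have hcont : ContinuousAt (fun y => ![fderiv ℝ φ y, fderiv ℝ D.tau y]) x := by
    refine continuousAt_pi.2 fun i => ?_
    fin_cases i
    · exact (hφx.fderiv_right (m := ∞) (by simp)).continuousAt
    · exact (hτx.fderiv_right (m := ∞) (by simp)).continuousAt
  have hev : ∀ᶠ y in 𝓝 x, LinearIndependent ℝ ![fderiv ℝ φ y, fderiv ℝ D.tau y] :=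
    hcont.eventually (hli.eventually)
  set n : Vec → Vec := fun y => raise e D y fun β => pd β φ y
  have hnd : ∀ β, DifferentiableAt ℝ (fun y => n y β) x := fun β =>
    DifferentiableAt.fun_sum fun γ _ => (h.differentiableAt_gUp hxO β γ).mul
      (differentiableAt_pd hφx γ)
  have key : ∀ y ∈ D.H, y ∈ V → LinearIndependent ℝ ![fderiv ℝ φ y, fderiv ℝ D.tau y] →
      Nbar e D y = (n y 0)⁻¹ • n y ∧ n y 0 ≠ 0 := by
    intro y hyH hyV hy
    have hφne : fderiv ℝ φ y ≠ 0 := by simpa using hy.ne_zero 0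
    have hTH := TH_eq_ker h.T_pos hV hyV hyH hφ ((h.smooth_tau.contDiffAt
      (h.isOpen_O.mem_nhds (h.mem_O hyH))).differentiableAt (by simp)) hy
      fun z hz => (hloc z hz).2
    exact ⟨Nbar_eq hc hyH hφne hTH,
      (isNormal_raise_pd hTH).zero_component_ne hc hyH (raise_pd_ne_zero hφne)⟩
  have hd : DifferentiableAt ℝ (fun y => (n y 0)⁻¹ * n y α) x :=
    ((hnd 0).inv (key x hx hxV hli).2).mul (hnd α)
  refine hd.differentiableWithinAt.congr_of_eventuallyEq ?_ ?_
  · filter_upwards [self_mem_nhdsWithin, nhdsWithin_le_nhds hev,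
      nhdsWithin_le_nhds (hV.mem_nhds hxV)] with y hyH hy hyV
    rw [(key y hyH hyV hy).1]
    rfl
  · rw [(key x hx hxV hli).1]
    rfl

end Differentiability

/-! ### Sphere-tangent vectors -/

section Sphere

variable {e : EquationOfState} {D : Config} {x : Vec}

/-- `X` is `g`-orthogonal to `N` and `Z`; at a point of the lateral boundary this means tangency to
the sphere. -/
def IsSphere (e : EquationOfState) (D : Config) (x X : Vec) : Prop :=
  ip e D x (N e D x) X = 0 ∧ ip e D x (Z e D x) X = 0

theorem Nhat_eq : Nhat e D x = (nu e D x)⁻¹ • N e D x := by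
  ext α
  simp only [Nhat, Pi.smul_apply, smul_eq_mul]
  ring

theorem slash_eq (V : Vec) : slash e D x V =
    V + ip e D x (Nhat e D x) V • Nhat e D x - ip e D x (Z e D x) V • Z e D x := by
  ext α
  simp only [slash, sProj, sub_mul, add_mul, Finset.sum_sub_distrib, Finset.sum_add_distrib,
    Pi.sub_apply, Pi.add_apply, Pi.smul_apply, smul_eq_mul, ip_eq_sum_low, Finset.sum_mul]
  congr 1
  · congr 1
    · simp
    · exact Finset.sum_congr rfl fun β _ => by ring
  · exact Finset.sum_congr rfl fun β _ => by ring

theorem slash_eq_sum (V : Vec) : slash e D x V = ∑ β, V β • angVec e D β x := by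
  ext α
  simp only [slash, angVec, Finset.sum_apply, Pi.smul_apply, smul_eq_mul]
  exact Finset.sum_congr rfl fun β _ => mul_comm _ _

theorem angVec_eq (α : Fin 4) : angVec e D α x = slash e D x (coordVec α) := by
  rw [slash_eq_sum]
  simp [coordVec, Pi.single_apply]

theorem sum_low_mul_gUp (X : Vec) (α : Fin 4) : ∑ β, low e D x X β * gUp e D x β α = X α := by
  conv_rhs => rw [← raise_low (e := e) (D := D) (x := x) X]
  exact Finset.sum_congr rfl fun β _ => by rw [gUp_comm, mul_comm]

theorem sum_sProj_mul_gUp (γ κ : Fin 4) : ∑ δ, sProj e D x γ δ * gUp e D x δ κ = sUp e D x γ κ := by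
  simp only [sProj, sUp, sub_mul, add_mul, Finset.sum_sub_distrib, Finset.sum_add_distrib, mul_assoc,
    ← Finset.mul_sum, sum_low_mul_gUp]
  simp

theorem sUp_comm (α β : Fin 4) : sUp e D x α β = sUp e D x β α := by
  simp only [sUp, gUp_comm α β]
  ring

theorem angUpVec_eq (α : Fin 4) : angUpVec e D α x = slash e D x fun β => gUp e D x β α := by
  ext γ
  rw [angUpVec, sUp_comm, ← sum_sProj_mul_gUp]
  rfl

theorem sIp_eq (X Y : Vec) : sIp e D x X Y = ip e D x X Y
    + ip e D x (Nhat e D x) X * ip e D x (Nhat e D x) Y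
    - ip e D x (Z e D x) X * ip e D x (Z e D x) Y := by
  rw [ip_eq_sum_low (Nhat e D x) X, ip_eq_sum_low (Nhat e D x) Y, ip_eq_sum_low (Z e D x) X,
    ip_eq_sum_low (Z e D x) Y]
  simp only [sIp, sLow, ip, Finset.sum_mul_sum, add_mul, sub_mul, Finset.sum_add_distrib,
    Finset.sum_sub_distrib]
  congr 1
  · congr 1
    refine Finset.sum_congr rfl fun α _ => Finset.sum_congr rfl fun β _ => by ring
  · refine Finset.sum_congr rfl fun α _ => Finset.sum_congr rfl fun β _ => by ring

theorem ip_NHbar : ip e D x (N e D x) (Hbar e D x) = -hbar e D x := by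
  rw [hbar, neg_neg, ip_comm]

theorem ip_NbarZ : ip e D x (Nbar e D x) (Z e D x) = -zbar e D x := by
  rw [zbar, neg_neg, ip_comm]

theorem Theta_eq : Theta e D x = B D x - (1 / hbar e D x) • Hbar e D x -
    (1 / zbar e D x) • Z e D x := rfl

theorem slash_of_isSphere {X : Vec} (hX : IsSphere e D x X) :
    slash e D x X = X := by
  rw [slash_eq, Nhat_eq, ip_smul_left, hX.1, hX.2]
  simp

namespace IsFrame

theorem nu_pos (h : IsFrame e D x) : 0 < nu e D x := Real.sqrt_pos.2 (neg_pos.2 h.ip_NN)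

theorem nu_sq (h : IsFrame e D x) : nu e D x ^ 2 = -ip e D x (N e D x) (N e D x) :=
  Real.sq_sqrt (neg_pos.2 h.ip_NN).le

theorem ip_NbarHbar (h : IsFrame e D x) : ip e D x (Nbar e D x) (Hbar e D x) = 0 :=
  (h.mem_TH _).1 h.Hbar_mem

theorem dir_tau (h : IsFrame e D x) (X : Vec) :
    dir X D.tau x = -dir (B D x) D.tau x * ip e D x (N e D x) X := by
  have := h.tau_pos.ne'
  rw [ip_N_left]
  field_simp

theorem isSphere_of_ip (h : IsFrame e D x) {X : Vec} (h1 : ip e D x (N e D x) X = 0)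
    (h2 : ip e D x (Nbar e D x) X = 0) : IsSphere e D x X := by
  refine ⟨h1, ?_⟩
  rw [h.Nbar_decomp, ip_sub_left, ip_smul_left, ip_smul_left, h1] at h2
  have := h.z_pos.ne'
  simpa [this] using h2

theorem ip_Nbar_of_isSphere (h : IsFrame e D x) {X : Vec} (hX : IsSphere e D x X) :
    ip e D x (Nbar e D x) X = 0 := by
  rw [h.Nbar_decomp, ip_sub_left, ip_smul_left, ip_smul_left, hX.1, hX.2]
  ring

theorem ip_Hbar_of_isSphere (h : IsFrame e D x) {X : Vec} (hX : IsSphere e D x X) :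
    ip e D x (Hbar e D x) X = 0 := by
  rw [h.Hbar_decomp, ip_sub_left, ip_smul_left, ip_smul_left, hX.1, hX.2]
  ring

theorem mem_TH_of_isSphere (h : IsFrame e D x) {X : Vec} (hX : IsSphere e D x X) : X ∈ TH D x :=
  (h.mem_TH X).2 (h.ip_Nbar_of_isSphere hX)

theorem isSphere_slash (h : IsFrame e D x) (V : Vec) : IsSphere e D x (slash e D x V) := by
  have hν := h.nu_pos.ne'
  have hν2 := h.nu_sq
  have hNN : ip e D x (N e D x) (N e D x) = -nu e D x ^ 2 := by rw [hν2, neg_neg]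
  constructor
  · rw [slash_eq, Nhat_eq]
    simp only [ip_add_right, ip_sub_right, ip_smul_right, ip_smul_left, h.ip_NZ, hNN]
    field_simp
    ring
  · rw [slash_eq, Nhat_eq]
    simp only [ip_add_right, ip_sub_right, ip_smul_right, ip_smul_left, h.ip_ZZ,
      ip_comm (Z e D x) (N e D x), h.ip_NZ]
    ring

theorem isSphere_angVec (h : IsFrame e D x) (α : Fin 4) : IsSphere e D x (angVec e D α x) := by
  rw [angVec_eq]
  exact h.isSphere_slash _

theorem isSphere_angUpVec (h : IsFrame e D x) (α : Fin 4) : IsSphere e D x (angUpVec e D α x) := by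
  rw [angUpVec_eq]
  exact h.isSphere_slash _

theorem isSphere_Theta (h : IsFrame e D x) : IsSphere e D x (Theta e D x) := by
  have hz := h.z_pos.ne'
  have hh := h.h_pos.ne'
  apply h.isSphere_of_ip
  · rw [Theta_eq, ip_sub_right, ip_sub_right, ip_smul_right, ip_smul_right, ip_comm _ (B D x),
      ip_B_left, h.N_zero, ip_NHbar, h.ip_NZ]
    field_simp
    ring
  · rw [Theta_eq, ip_sub_right, ip_sub_right, ip_smul_right, ip_smul_right, ip_comm _ (B D x),
      ip_B_left, h.Nbar_zero, h.ip_NbarHbar, ip_NbarZ]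
    field_simp
    ring

/-- `g̸` annihilates `H̲`, which lies in the span of `N` and `Z`. -/
theorem sum_sLow_mul_Hbar (h : IsFrame e D x) (β : Fin 4) :
    ∑ γ, sLow e D x γ β * Hbar e D x γ = 0 := by
  have h1 : ∑ γ, sLow e D x γ β * Hbar e D x γ = sIp e D x (Hbar e D x) (coordVec β) := by
    simp [sIp, coordVec, Pi.single_apply]
  have h2 : sIp e D x (Hbar e D x) (coordVec β) =
      ip e D x (Hbar e D x) (slash e D x (coordVec β)) := by
    rw [sIp_eq, slash_eq, ip_sub_right, ip_add_right, ip_smul_right, ip_smul_right,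
      ip_comm (Hbar e D x) (Nhat e D x), ip_comm (Hbar e D x) (Z e D x)]
    ring
  rw [h1, h2]
  exact h.ip_Hbar_of_isSphere (h.isSphere_slash _)

theorem lapse_eq (h : IsFrame e D x) :
    lapse e D x = (dir (B D x) D.tau x * hbar e D x)⁻¹ := by
  rw [lapse, h.dir_tau, ip_NHbar, one_div]
  congr 1
  ring

end IsFrame

end Sphere

/-! ### Derivatives occurring in the error integrands -/

section DerivModule

variable {e : EquationOfState} {K : Config → Prop} {κ : Type} [Fintype κ] {E : Type}
  [NormedAddCommGroup E] [NormedSpace ℝ E] {A : Config → Vec → κ → ℝ} {arg : Points e K → E}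
  {T : Set (Points e K → ℝ)} {f : Config → Vec → ℝ} {X : Points e K → Vec}

/-- `T` is a module over the continuous functions of `arg` that contains the derivatives of the array
`A` in the sphere directions and in the direction `H̲`, hence in all directions tangent to `H`. It is
also recorded that `arg` determines the frame, and that `A` is a function of `arg` at each point and
differentiable along `H`. -/
structure IsDerivModule (arg : Points e K → E) (A : Config → Vec → κ → ℝ)
    (T : Set (Points e K → ℝ)) : Prop where
  frame : ∀ q : Points e K, IsFrame e q.1.D q.1.x
  isCoefModule : IsCoefModule arg T
  frameArray : FrameArray arg
  coef : ∀ j, FunctionOf 0 arg fun q => A q.1.D q.1.x j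
  diff : ∀ (q : Points e K) j, DifferentiableWithinAt ℝ (fun y => A q.1.D y j) q.1.D.H q.1.x
  ang : ∀ δ j, (fun q : Points e K =>
    along q.1.D (angVec e q.1.D δ q.1.x) (fun y => A q.1.D y j) q.1.x) ∈ T
  gen : ∀ j, (fun q : Points e K =>
    along q.1.D (Hbar e q.1.D q.1.x) (fun y => A q.1.D y j) q.1.x) ∈ T

namespace IsDerivModule

theorem along_smul {D : Config} {x : Vec} (r : ℝ) (X : Vec) (f : Vec → ℝ) :
    along D (r • X) f x = r * along D X f x := by
  simp [along]

theorem along_gen_mem (h : IsDerivModule arg A T)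
    (hf : FunctionOf 1 (fun q : Points e K => A q.1.D q.1.x) fun q => f q.1.D q.1.x) :
    (fun q : Points e K => along q.1.D (Hbar e q.1.D q.1.x) (f q.1.D) q.1.x) ∈ T := by
  obtain ⟨-, c, hc, hq⟩ := hf.exists_along_eq h.diff
  refine IsCoefModule.congr (h.isCoefModule.sum Finset.univ fun j =>
    h.isCoefModule.mul ((hc j).comp h.coef) (h.gen j)) fun q => hq q _ (h.frame q).Hbar_mem

theorem along_angVec_mem (h : IsDerivModule arg A T)
    (hf : FunctionOf 1 (fun q : Points e K => A q.1.D q.1.x) fun q => f q.1.D q.1.x) (δ : Fin 4) :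
    (fun q : Points e K => along q.1.D (angVec e q.1.D δ q.1.x) (f q.1.D) q.1.x) ∈ T := by
  obtain ⟨-, c, hc, hq⟩ := hf.exists_along_eq h.diff
  refine IsCoefModule.congr (h.isCoefModule.sum Finset.univ fun j =>
    h.isCoefModule.mul ((hc j).comp h.coef) (h.ang δ j)) fun q =>
      hq q _ ((h.frame q).mem_TH_of_isSphere ((h.frame q).isSphere_angVec δ))

theorem along_sphere_mem (h : IsDerivModule arg A T)
    (hf : FunctionOf 1 (fun q : Points e K => A q.1.D q.1.x) fun q => f q.1.D q.1.x)
    (hX : VecFunctionOf arg X) (hS : ∀ q, IsSphere e q.1.D q.1.x (X q)) :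
    (fun q : Points e K => along q.1.D (X q) (f q.1.D) q.1.x) ∈ T := by
  refine IsCoefModule.congr (h.isCoefModule.sum Finset.univ fun δ =>
    h.isCoefModule.mul ((hX δ).of_le zero_le_one) (h.along_angVec_mem hf δ)) fun q => ?_
  conv_lhs => rw [← slash_of_isSphere (hS q), slash_eq_sum]
  rw [along_sum_smul]

theorem dir_sphere_mem (h : IsDerivModule arg A T)
    (hf : FunctionOf 1 (fun q : Points e K => A q.1.D q.1.x) fun q => f q.1.D q.1.x)
    (hd : ∀ q : Points e K, DifferentiableAt ℝ (f q.1.D) q.1.x)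
    (hX : VecFunctionOf arg X) (hS : ∀ q, IsSphere e q.1.D q.1.x (X q)) :
    (fun q : Points e K => dir (X q) (f q.1.D) q.1.x) ∈ T :=
  IsCoefModule.congr (h.along_sphere_mem hf hX hS) fun q =>
    (along_eq_dir (hd q) ((h.frame q).mem_TH_of_isSphere (hS q))).symm

theorem dir_gen_mem (h : IsDerivModule arg A T)
    (hf : FunctionOf 1 (fun q : Points e K => A q.1.D q.1.x) fun q => f q.1.D q.1.x)
    (hd : ∀ q : Points e K, DifferentiableAt ℝ (f q.1.D) q.1.x) :
    (fun q : Points e K => dir (Hbar e q.1.D q.1.x) (f q.1.D) q.1.x) ∈ T :=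
  IsCoefModule.congr (h.along_gen_mem hf) fun q =>
    (along_eq_dir (hd q) (h.frame q).Hbar_mem).symm

end IsDerivModule

end DerivModule

/-! ### The error integrands `𝔥[Ω]` and `𝔥[S]` -/

section Divergence

variable {e : EquationOfState} {D : Config} {x : Vec}

/-- In the trace of the Christoffel symbols over the sphere only derivatives of `g` in the direction of
the vectorfield itself survive. -/
theorem sum_sProj_christoffel (Y : Vec) :
    ∑ γ, ∑ δ, ∑ κ, sProj e D x γ δ * christoffel e D x γ δ κ * Y κ =
      (1 / 2) * ∑ γ, ∑ κ, sUp e D x γ κ * dir Y (fun y => gLow e D y γ κ) x := by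
  set G : Fin 4 → Fin 4 → Fin 4 → ℝ := fun α β γ => pd α (fun y => gLow e D y β γ) x with hG
  have hsymm : ∀ α β γ, G α β γ = G α γ β := fun α β γ => by
    simp only [hG, gLow_comm β γ]
  have h1 : ∀ γ κ, ∑ δ, sProj e D x γ δ * christoffel e D x γ δ κ =
      (1 / 2) * ∑ μ, sUp e D x γ μ * (G γ μ κ + G κ γ μ - G μ γ κ) := by
    intro γ κ
    have h2 : ∀ δ, sProj e D x γ δ * christoffel e D x γ δ κ = ∑ μ,
        (1 / 2) * ((sProj e D x γ δ * gUp e D x δ μ) * (G γ μ κ + G κ γ μ - G μ γ κ)) := fun δ => by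
      rw [christoffel, Finset.mul_sum, Finset.mul_sum]
      exact Finset.sum_congr rfl fun μ _ => by simp only [hG]; ring
    simp only [h2]
    rw [Finset.sum_comm]
    simp only [← Finset.mul_sum, ← Finset.sum_mul, sum_sProj_mul_gUp]
  have h3 : ∑ γ, ∑ δ, ∑ κ, sProj e D x γ δ * christoffel e D x γ δ κ * Y κ =
      ∑ κ, Y κ * ∑ γ, ∑ δ, sProj e D x γ δ * christoffel e D x γ δ κ := by
    symm
    simp only [Finset.mul_sum]
    rw [Finset.sum_comm]
    refine Finset.sum_congr rfl fun γ _ => ?_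
    rw [Finset.sum_comm]
    exact Finset.sum_congr rfl fun κ _ => Finset.sum_congr rfl fun δ _ => mul_comm _ _
  have h4 : ∀ κ, ∑ γ, ∑ μ, sUp e D x γ μ * (G γ μ κ + G κ γ μ - G μ γ κ) =
      ∑ γ, ∑ μ, sUp e D x γ μ * G κ γ μ := by
    intro κ
    have h5 : ∑ γ, ∑ μ, sUp e D x γ μ * G μ γ κ = ∑ γ, ∑ μ, sUp e D x γ μ * G γ μ κ := by
      rw [Finset.sum_comm]
      exact Finset.sum_congr rfl fun γ _ => Finset.sum_congr rfl fun μ _ => by rw [sUp_comm]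
    simp only [mul_add, mul_sub, Finset.sum_add_distrib, Finset.sum_sub_distrib, h5]
    ring
  rw [h3]
  simp only [h1, ← Finset.mul_sum, h4, dir_eq_sum]
  simp only [Finset.mul_sum]
  rw [Finset.sum_comm]
  refine Finset.sum_congr rfl fun γ _ => ?_
  rw [Finset.sum_comm]
  exact Finset.sum_congr rfl fun κ _ => Finset.sum_congr rfl fun μ _ => by simp only [hG]; ring

end Divergence

section ErrorIntegrand

/-- `B τ`. -/
def tauRate (D : Config) (x : Vec) : ℝ := dir (B D x) D.tau x

section Pointwise

variable {e : EquationOfState} {D : Config} {x : Vec}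

theorem Admissible.differentiableAt_tauRate (h : Admissible e D) (hx : x ∈ D.O) :
    DifferentiableAt ℝ (tauRate D) x := by
  have h1 : tauRate D = fun y => ∑ α, B D y α * pd α D.tau y := funext fun y => dir_eq_sum _ _ _
  rw [h1]
  exact DifferentiableAt.fun_sum fun α _ =>
    (h.differentiableAt_B hx α).mul (h.differentiableAt_pd_tau hx α)

/-- The lapse drops out of the trace of the Lie derivative, up to a factor: its own derivatives are
multiplied by `g̸(H̲, ·) = 0`. -/
theorem trLie_lapse_smul (h : Admissible e D) (hF : ∀ y ∈ D.H, IsFrame e D y) (hx : x ∈ D.H)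
    (hh : DifferentiableWithinAt ℝ (hbar e D) D.H x)
    (hH : ∀ α, DifferentiableWithinAt ℝ (fun y => Hbar e D y α) D.H x) :
    trLie e D (fun y => lapse e D y • Hbar e D y) x = lapse e D x *
      (∑ α, ∑ β, sUp e D x α β * along D (Hbar e D x) (fun y => sLow e D y α β) x
        + 2 * ∑ β, ∑ γ, sLow e D x γ β * along D (angUpVec e D β x) (fun y => Hbar e D y γ) x) := by
  have hfx := hF x hx
  have hl : DifferentiableWithinAt ℝ (lapse e D) D.H x := by
    have h1 : DifferentiableWithinAt ℝ (fun y => (tauRate D y * hbar e D y)⁻¹) D.H x :=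
      ((h.differentiableAt_tauRate (h.mem_O hx)).differentiableWithinAt.mul hh).inv
        (mul_pos hfx.tau_pos hfx.h_pos).ne'
    exact h1.congr (fun y hy => (hF y hy).lapse_eq) hfx.lapse_eq
  have h1 : ∀ β, ∑ γ, sLow e D x γ β *
      along D (angUpVec e D β x) (fun y => (lapse e D y • Hbar e D y) γ) x =
      lapse e D x * ∑ γ, sLow e D x γ β *
        along D (angUpVec e D β x) (fun y => Hbar e D y γ) x := by
    intro β
    have h2 : ∀ γ, along D (angUpVec e D β x) (fun y => (lapse e D y • Hbar e D y) γ) x =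
        lapse e D x * along D (angUpVec e D β x) (fun y => Hbar e D y γ) x +
          Hbar e D x γ * along D (angUpVec e D β x) (lapse e D) x := fun γ =>
      along_mul hl (hH γ) (hfx.mem_TH_of_isSphere (hfx.isSphere_angUpVec β))
    have h3 : ∀ γ, sLow e D x γ β * (lapse e D x * along D (angUpVec e D β x)
        (fun y => Hbar e D y γ) x + Hbar e D x γ * along D (angUpVec e D β x) (lapse e D) x) =
        lapse e D x * (sLow e D x γ β * along D (angUpVec e D β x) (fun y => Hbar e D y γ) x) +
        sLow e D x γ β * Hbar e D x γ * along D (angUpVec e D β x) (lapse e D) x :=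
      fun γ => by ring
    simp only [h2, h3, Finset.sum_add_distrib, ← Finset.mul_sum, ← Finset.sum_mul,
      hfx.sum_sLow_mul_Hbar, zero_mul, add_zero]
  rw [trLie]
  simp only [h1, IsDerivModule.along_smul]
  simp only [mul_left_comm _ (lapse e D x), ← Finset.mul_sum]
  ring

/-- Since `1 / ℓ = h̲ B τ` along `H`, the lapse enters the second term of `𝔥` only through the
logarithmic derivative of `B τ`. -/
theorem along_lapse_smul (h : Admissible e D) (hF : ∀ y ∈ D.H, IsFrame e D y) (hx : x ∈ D.H)
    {f : Vec → ℝ} (hf : DifferentiableWithinAt ℝ (fun y => zbar e D y * f y) D.H x) :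
    along D (lapse e D x • Hbar e D x)
        (fun y => zbar e D y / (hbar e D y * lapse e D y) * f y) x =
      1 / hbar e D x * (along D (Hbar e D x) (fun y => zbar e D y * f y) x +
        zbar e D x * f x * (along D (Hbar e D x) (tauRate D) x / tauRate D x)) := by
  have h1 : ∀ y ∈ D.H, zbar e D y / (hbar e D y * lapse e D y) * f y =
      tauRate D y * (zbar e D y * f y) := by
    intro y hy
    have h2 := (hF y hy).h_pos.ne'
    have h3 : dir (B D y) D.tau y ≠ 0 := (hF y hy).tau_pos.ne'
    rw [(hF y hy).lapse_eq, tauRate]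
    field_simp
  have h2 := (hF x hx).h_pos.ne'
  have h3 : tauRate D x ≠ 0 := (hF x hx).tau_pos.ne'
  rw [IsDerivModule.along_smul, along_congr hx h1,
    along_mul (h.differentiableAt_tauRate (h.mem_O hx)).differentiableWithinAt hf
      (hF x hx).Hbar_mem, (hF x hx).lapse_eq, ← tauRate]
  field_simp

end Pointwise

variable {e : EquationOfState} {K : Config → Prop} {κ : Type} [Fintype κ] {E : Type}
  [NormedAddCommGroup E] [NormedSpace ℝ E] {A : Config → Vec → κ → ℝ} {arg : Points e K → E}
  {T : Set (Points e K → ℝ)}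

namespace IsDerivModule

theorem divS_mem (h : IsDerivModule arg A T)
    (hA : FluidArray fun q : Points e K => A q.1.D q.1.x) {Y : Config → Vec → Vec}
    (hY : VecFunctionOf (fun q : Points e K => A q.1.D q.1.x) fun q => Y q.1.D q.1.x)
    (hY' : VecFunctionOf arg fun q => Y q.1.D q.1.x)
    (hS : ∀ q : Points e K, IsSphere e q.1.D q.1.x (Y q.1.D q.1.x)) :
    (fun q : Points e K => divS e q.1.D (Y q.1.D) q.1.x) ∈ T := by
  have hT := h.isCoefModule
  refine hT.add (hT.sum _ fun δ => h.along_angVec_mem (f := fun D y => Y D y δ) (hY δ) δ) ?_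
  refine IsCoefModule.congr (hT.mul (.const (1 / 2)) (hT.sum Finset.univ fun γ => hT.sum Finset.univ
    fun κ => hT.mul ((h.frameArray.sUp h.frame γ κ).of_le zero_le_one)
      (h.dir_sphere_mem (f := fun D y => gLow e D y γ κ) (hA.gLow γ κ)
        (fun q => q.1.admissible.differentiableAt_gLow (q.1.admissible.mem_O q.1.mem) γ κ)
        hY' hS))) fun q => sum_sProj_christoffel _

/-- `𝔥[V]` is a combination of the derivatives of the array `A` along `H`, provided that the logarithmic
derivative of `B τ` is. -/
theorem errV_mem (h : IsDerivModule arg A T)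
    (hA : FrameArray fun q : Points e K => A q.1.D q.1.x)
    (hτ : (fun q : Points e K => along q.1.D (Hbar e q.1.D q.1.x) (tauRate q.1.D) q.1.x
      / tauRate q.1.D q.1.x) ∈ T)
    {V : Points e K → Vec} (hV : VecFunctionOf arg V) :
    (fun q : Points e K => errV e q.1.D q.1.x (V q)) ∈ T := by
  have hT := h.isCoefModule
  have hK := h.frame
  have hR := h.frameArray
  have hc : ∀ {a : Points e K → ℝ}, FunctionOf 1 arg a → FunctionOf 0 arg a :=
    fun ha => ha.of_le zero_le_one
  have hF : ∀ q : Points e K, ∀ y ∈ q.1.D.H, IsFrame e q.1.D y := fun q y hy =>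
    hK ⟨⟨q.1.D, q.1.admissible, y, hy⟩, q.2⟩
  have hlV := fun α => hc (hR.psi.low hV α)
  have hW := hR.slash hK hV
  have hWS : ∀ q : Points e K, IsSphere e q.1.D q.1.x (slash e q.1.D q.1.x (V q)) := fun q =>
    (hK q).isSphere_slash _
  have hzsUp : ∀ α β, FunctionOf 1 (fun q : Points e K => A q.1.D q.1.x)
      fun q => zbar e q.1.D q.1.x * sUp e q.1.D q.1.x α β := fun α β =>
    hA.zbar.mul (hA.sUp hK α β)
  refine hT.add (hT.add (hT.add (hT.add (hT.sub (hT.add (hT.add ?_ ?_) ?_) ?_) ?_) ?_) ?_) ?_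
  · refine IsCoefModule.congr (hT.mul (hc (((FunctionOf.const (1 / 2)).mul
      (hR.zbar.mul (hR.hbar_inv hK))).mul (hR.sIp hK hW hW)))
      (hT.add
        (hT.sum Finset.univ fun α => hT.sum Finset.univ fun β => hT.mul (hc (hR.sUp hK α β))
          (h.along_gen_mem (f := fun D y => sLow e D y α β) (hA.sLow hK α β)))
        (hT.mul (.const 2) (hT.sum Finset.univ fun β => hT.sum Finset.univ fun γ =>
          hT.mul (hc (hR.sLow hK γ β)) (h.along_sphere_mem (f := fun D y => Hbar e D y γ)
            (hA.Hbar γ) (fun δ => hR.sUp hK β δ) fun q => (hK q).isSphere_angUpVec β))))) fun q => ?_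
    rw [trLie_lapse_smul q.1.admissible (hF q) q.1.mem
      ((FunctionOf.exists_along_eq (f := fun D y => hbar e D y) hA.hbar h.diff).1 q)
      fun α => (FunctionOf.exists_along_eq (f := fun D y => Hbar e D y α) (hA.Hbar α) h.diff).1 q]
    have h1 := (hK q).h_pos.ne'
    have h2 : lapse e q.1.D q.1.x ≠ 0 := by
      rw [(hK q).lapse_eq]
      exact inv_ne_zero (mul_pos (hK q).tau_pos (hK q).h_pos).ne'
    field_simp
    rfl
  · refine hT.sum _ fun α => hT.sum _ fun β => hT.mul_right (hT.mul_right ?_ (hlV α)) (hlV β)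
    refine IsCoefModule.congr (hT.mul (hc (hR.hbar_inv hK)) (hT.add
      (h.along_gen_mem (f := fun D y => zbar e D y * sUp e D y α β) (hzsUp α β))
      (hT.mul (hc (hR.zbar.mul (hR.sUp hK α β))) hτ))) fun q => ?_
    exact along_lapse_smul q.1.admissible (hF q) q.1.mem
      ((FunctionOf.exists_along_eq (f := fun D y => zbar e D y * sUp e D y α β)
        (hzsUp α β) h.diff).1 q)
  · exact hT.sum _ fun α => hT.sum _ fun β => hT.mul_right (hT.mul_right
      (h.along_sphere_mem (f := fun D y => zbar e D y * sUp e D y α β) (hzsUp α β)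
        (hR.Theta hK) fun q => (hK q).isSphere_Theta) (hlV α)) (hlV β)
  · exact hT.mul (.const 2) (hT.sum _ fun α => hT.mul (hlV α)
      (h.dir_sphere_mem (f := fun D y => B D y α) (hA.psi.B α)
        (fun q => q.1.admissible.differentiableAt_B (q.1.admissible.mem_O q.1.mem) α) hW hWS))
  · exact hT.mul (hc (hR.zbar.mul (hR.sIp hK hW hW)))
      (h.divS_mem hA.psi (Y := Theta e) (hA.Theta hK) (hR.Theta hK) fun q => (hK q).isSphere_Theta)
  · exact hT.mul (hc (hR.psi.ip hR.Z hV)) (hT.sum _ fun β => hT.mul (hc (hV β))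
      (h.divS_mem hA.psi (Y := fun D => angVec e D β) (fun α => hA.sProj hK α β)
        (fun α => hR.sProj hK α β) fun q => (hK q).isSphere_angVec β))
  · exact hT.sum _ fun α => hT.sum _ fun β => hT.mul (hc ((hV α).mul (hR.Z β)))
      (h.dir_sphere_mem (f := fun D y => gLow e D y α β) (hA.psi.gLow α β)
        (fun q => q.1.admissible.differentiableAt_gLow (q.1.admissible.mem_O q.1.mem) α β) hW hWS)
  · exact hT.sum _ fun α => hT.mul (hlV α)
      (h.along_sphere_mem (f := fun D y => Z e D y α) (hA.Z α) hW hWS)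

end IsDerivModule

end ErrorIntegrand

/-! ### The sign and the Gram determinant -/

section Gram

theorem det_fin_four (M : Matrix (Fin 4) (Fin 4) ℝ) : M.det =
    M 0 0 * (M 1 1 * (M 2 2 * M 3 3 - M 2 3 * M 3 2) - M 1 2 * (M 2 1 * M 3 3 - M 2 3 * M 3 1)
      + M 1 3 * (M 2 1 * M 3 2 - M 2 2 * M 3 1))
    - M 0 1 * (M 1 0 * (M 2 2 * M 3 3 - M 2 3 * M 3 2) - M 1 2 * (M 2 0 * M 3 3 - M 2 3 * M 3 0)
      + M 1 3 * (M 2 0 * M 3 2 - M 2 2 * M 3 0))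
    + M 0 2 * (M 1 0 * (M 2 1 * M 3 3 - M 2 3 * M 3 1) - M 1 1 * (M 2 0 * M 3 3 - M 2 3 * M 3 0)
      + M 1 3 * (M 2 0 * M 3 1 - M 2 1 * M 3 0))
    - M 0 3 * (M 1 0 * (M 2 1 * M 3 2 - M 2 2 * M 3 1) - M 1 1 * (M 2 0 * M 3 2 - M 2 2 * M 3 0)
      + M 1 2 * (M 2 0 * M 3 1 - M 2 1 * M 3 0)) := by
  have h : ∀ j, (M.submatrix Fin.succ (Fin.succAbove j)).det = _ := fun j => Matrix.det_fin_three _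
  rw [Matrix.det_succ_row_zero, Fin.sum_univ_four, h, h, h, h]
  simp only [Matrix.submatrix_apply, show Fin.succ (0 : Fin 3) = (1 : Fin 4) from rfl,
    show Fin.succ (1 : Fin 3) = (2 : Fin 4) from rfl, show Fin.succ (2 : Fin 3) = (3 : Fin 4) from rfl,
    show Fin.succAbove (0 : Fin 4) 0 = 1 from rfl, show Fin.succAbove (0 : Fin 4) 1 = 2 from rfl,
    show Fin.succAbove (0 : Fin 4) 2 = 3 from rfl, show Fin.succAbove (1 : Fin 4) 0 = 0 from rfl,
    show Fin.succAbove (1 : Fin 4) 1 = 2 from rfl, show Fin.succAbove (1 : Fin 4) 2 = 3 from rfl,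
    show Fin.succAbove (2 : Fin 4) 0 = 0 from rfl, show Fin.succAbove (2 : Fin 4) 1 = 1 from rfl,
    show Fin.succAbove (2 : Fin 4) 2 = 3 from rfl, show Fin.succAbove (3 : Fin 4) 0 = 0 from rfl,
    show Fin.succAbove (3 : Fin 4) 1 = 1 from rfl, show Fin.succAbove (3 : Fin 4) 2 = 2 from rfl]
  norm_num
  ring

variable {e : EquationOfState} {D : Config} {x : Vec}

theorem det_gLow : (Matrix.of (gLow e D x)).det = -((snd e D x ^ 2)⁻¹) ^ 3 := by
  have h0 : ∀ a α, coframe D a x α = if α = 0 then -D.v a x else if α = a.succ then 1 else 0 := by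
    intro a α
    refine Fin.cases ?_ (fun i => ?_) α <;> simp [coframe, (Fin.succ_ne_zero _).symm]
  rw [det_fin_four]
  simp only [Matrix.of_apply, gLow, Fin.sum_univ_three, h0]
  simp [Fin.ext_iff]
  ring

theorem det_gram (R : Fin 4 → Vec) : (Matrix.of fun i j => ip e D x (R i) (R j)).det =
    -((snd e D x ^ 2)⁻¹) ^ 3 * (Matrix.of R).det ^ 2 := by
  have h1 : (Matrix.of fun i j => ip e D x (R i) (R j)) =
      Matrix.of R * Matrix.of (gLow e D x) * (Matrix.of R).transpose := by
    ext i j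
    simp only [Matrix.of_apply, Matrix.mul_apply, Matrix.transpose_apply, Finset.sum_mul, ip]
    rw [Finset.sum_comm]
    exact Finset.sum_congr rfl fun α _ => Finset.sum_congr rfl fun β _ => by ring
  rw [h1, Matrix.det_mul, Matrix.det_mul, Matrix.det_transpose, det_gLow]
  ring

/-- The square of the volume spanned by `n` and three vectors orthogonal to it, as a Gram
determinant. -/
theorem eps_sq {X Y n W : Vec} (hX : ip e D x n X = 0) (hY : ip e D x n Y = 0)
    (hW : ip e D x n W = 0) : ((snd e D x ^ 2)⁻¹) ^ 3 * eps X Y n W ^ 2 = -ip e D x n n *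
      (ip e D x X X * ip e D x Y Y * ip e D x W W
        + 2 * ip e D x X Y * ip e D x Y W * ip e D x X W - ip e D x X X * ip e D x Y W ^ 2
        - ip e D x Y Y * ip e D x X W ^ 2 - ip e D x W W * ip e D x X Y ^ 2) := by
  have h1 := det_gram (e := e) (D := D) (x := x) ![X, Y, n, W]
  have h2 : eps X Y n W = (Matrix.of ![X, Y, n, W]).det := rfl
  rw [← h2] at h1
  have hX' : ip e D x X n = 0 := by rw [ip_comm, hX]
  have hY' : ip e D x Y n = 0 := by rw [ip_comm, hY]
  have hW' : ip e D x W n = 0 := by rw [ip_comm, hW]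
  have h3 : (Matrix.of fun i j => ip e D x (![X, Y, n, W] i) (![X, Y, n, W] j)).det =
      ip e D x n n * (ip e D x X X * ip e D x Y Y * ip e D x W W
        + 2 * ip e D x X Y * ip e D x Y W * ip e D x X W - ip e D x X X * ip e D x Y W ^ 2
        - ip e D x Y Y * ip e D x X W ^ 2 - ip e D x W W * ip e D x X Y ^ 2) := by
    rw [det_fin_four]
    simp [hX, hY, hW, hX', hY', hW', ip_comm Y X, ip_comm W X, ip_comm W Y]
    ring
  linarith

theorem eps_eq_zero_of_orthogonal {X Y Z W n : Vec} (hn : n ≠ 0) (hX : ip e D x n X = 0)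
    (hY : ip e D x n Y = 0) (hZ : ip e D x n Z = 0) (hW : ip e D x n W = 0) : eps X Y Z W = 0 := by
  refine Matrix.exists_mulVec_eq_zero_iff.1 ⟨low e D x n, fun h => hn ?_, ?_⟩
  · rw [← raise_low (e := e) (D := D) (x := x) n, h]
    ext α
    simp [raise]
  · have key : ∀ R : Vec, ip e D x n R = 0 → ∑ α, R α * low e D x n α = 0 := fun R hR => by
      rw [← ip_eq_sum_low', ip_comm, hR]
    ext i
    fin_cases i
    exacts [key X hX, key Y hY, key Z hZ, key W hW]

theorem low_eq_ip (X : Vec) (α : Fin 4) : low e D x X α = ip e D x X (coordVec α) := by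
  simp [ip_eq_sum_low, coordVec, Pi.single_apply]

theorem ip_spatial (X : Vec) (w : Fin 3 → ℝ) :
    ip e D x X (spatial w) = ∑ a : Fin 3, w a * low e D x X a.succ := by
  rw [ip_eq_sum_low, Fin.sum_univ_succ]
  simp [spatial, mul_comm]

theorem P_eq : P e D x = (1 / hbar e D x) • (Nbar e D x - N e D x) := by
  ext α
  simp only [P, Pi.smul_apply, Pi.sub_apply, smul_eq_mul]
  ring

theorem lam_eq (α : Fin 4) : lam e D α x = coordVec α + ip e D x (Nbar e D x) (coordVec α) • B D x
    - ip e D x (P e D x) (coordVec α) • Hbar e D x := by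
  rw [← low_eq_ip, ← low_eq_ip]
  rfl

/-- The coefficient `k` of `H̲` in `S = -(S^a N̲_a) B + k H̲ + U`. -/
def sCoef (e : EquationOfState) (D : Config) (x : Vec) : ℝ :=
  SNbar e D x / hbar e D x - SN e D x / hbar e D x

theorem U_eq : U e D x = SVec D x + SNbar e D x • B D x - sCoef e D x • Hbar e D x := rfl

theorem Y_eq : Y e D x = sCoef e D x • Theta e D x - (1 / hbar e D x) • U e D x := rfl

theorem sIp_of_isSphere {X Y : Vec} (hX : IsSphere e D x X) :
    sIp e D x X Y = ip e D x X Y := by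
  rw [sIp_eq, Nhat_eq, ip_smul_left, hX.1, hX.2]
  ring

theorem Ebar_eq :
    Ebar e D x = Theta e D x + (1 / hbar e D x) • Hbar e D x := by
  ext α
  simp only [Ebar, Theta, Pi.add_apply, Pi.smul_apply, smul_eq_mul]
  ring

namespace IsFrame

theorem isSphere_lam (h : IsFrame e D x) (α : Fin 4) : IsSphere e D x (lam e D α x) := by
  have hh := h.h_pos.ne'
  apply h.isSphere_of_ip
  · rw [lam_eq, P_eq]
    simp only [ip_sub_right, ip_add_right, ip_smul_right, ip_smul_left, ip_sub_left, ip_NHbar,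
      ip_comm _ (B D x), ip_B_left, h.N_zero]
    field_simp
    ring
  · rw [lam_eq]
    simp only [ip_sub_right, ip_add_right, ip_smul_right, h.ip_NbarHbar,
      ip_comm _ (B D x), ip_B_left, h.Nbar_zero]
    ring

theorem ip_Nbar_S (h : IsFrame e D x) :
    ip e D x (Nbar e D x) (SVec D x + SNbar e D x • B D x) = 0 := by
  rw [ip_add_right, ip_smul_right, SVec, ip_spatial, ip_comm _ (B D x), ip_B_left, h.Nbar_zero]
  simp [SNbar]

theorem isSphere_U (h : IsFrame e D x) : IsSphere e D x (U e D x) := by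
  have hh := h.h_pos.ne'
  apply h.isSphere_of_ip
  · have h1 : ip e D x (N e D x) (SVec D x) = SN e D x := ip_spatial _ _
    rw [U_eq, ip_sub_right, ip_add_right, ip_smul_right, ip_smul_right, h1, ip_NHbar,
      ip_comm _ (B D x), ip_B_left, h.N_zero, sCoef]
    field_simp
    ring
  · rw [U_eq, ip_sub_right, h.ip_Nbar_S, ip_smul_right, h.ip_NbarHbar]
    ring

theorem isSphere_Y (h : IsFrame e D x) : IsSphere e D x (Y e D x) := by
  constructor
  · rw [Y_eq, ip_sub_right, ip_smul_right, ip_smul_right, h.isSphere_Theta.1, h.isSphere_U.1]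
    ring
  · rw [Y_eq, ip_sub_right, ip_smul_right, ip_smul_right, h.isSphere_Theta.2, h.isSphere_U.2]
    ring

theorem ip_Nbar_Ebar (h : IsFrame e D x) : ip e D x (Nbar e D x) (Ebar e D x) = 0 := by
  rw [Ebar_eq, ip_add_right, ip_smul_right, h.ip_NbarHbar, h.ip_Nbar_of_isSphere h.isSphere_Theta]
  ring

/-- A nonzero vector orthogonal to `N̲` and to the sphere. -/
theorem ip_N_Nbar_ne (h : IsFrame e D x) (hne : ip e D x (Nbar e D x) (Nbar e D x) ≠ 0) :
    ip e D x (Nbar e D x) (Nbar e D x) • N e D x -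
      ip e D x (N e D x) (Nbar e D x) • Nbar e D x ≠ 0 := by
  intro h0
  have h1 := congrFun h0 0
  simp only [Pi.sub_apply, Pi.smul_apply, smul_eq_mul, h.N_zero, h.Nbar_zero, Pi.zero_apply] at h1
  have h2 := ip_smul_left (e := e) (D := D) (x := x) 0 0 (Z e D x)
  rw [zero_smul, ← h0, zero_mul, ip_sub_left, ip_smul_left, ip_smul_left, h.ip_NZ, ip_NbarZ] at h2
  have h3 : ip e D x (N e D x) (Nbar e D x) * zbar e D x = 0 := by linarith
  rcases mul_eq_zero.1 h3 with h4 | h4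
  · exact hne (by linarith)
  · exact h.z_pos.ne' h4

/-- Three sphere-tangent vectors and `N̲` are orthogonal to one nonzero vector, hence linearly
dependent. -/
theorem eps_sphere (h : IsFrame e D x) (hne : ip e D x (Nbar e D x) (Nbar e D x) ≠ 0) {X Y W : Vec}
    (hX : IsSphere e D x X) (hY : IsSphere e D x Y) (hW : IsSphere e D x W) :
    eps X Y (Nbar e D x) W = 0 := by
  have key : ∀ R : Vec, IsSphere e D x R →
      ip e D x (ip e D x (Nbar e D x) (Nbar e D x) • N e D x -
        ip e D x (N e D x) (Nbar e D x) • Nbar e D x) R = 0 := fun R hR => by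
    rw [ip_sub_left, ip_smul_left, ip_smul_left, hR.1, h.ip_Nbar_of_isSphere hR]
    ring
  refine eps_eq_zero_of_orthogonal (h.ip_N_Nbar_ne hne) (key X hX) (key Y hY) ?_ (key W hW)
  rw [ip_sub_left, ip_smul_left, ip_smul_left]
  ring

/-- The volume spanned by `E̲`, `Ω̸`, `N̲` and `S + (S^a N̲_a) B` factors into the area of
`(Ω̸, Y)` on the sphere and the lengths of `N̲` and `H̲`. Writing `E̲ = Θ + H̲ / h̲` and
`S + (S^a N̲_a) B = U + k H̲` reduces the Gram determinant to that of `(Ω̸, kΘ - U / h̲)`. -/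
theorem eps_sq_eq_gram (h : IsFrame e D x) (hne : ip e D x (Nbar e D x) (Nbar e D x) ≠ 0) :
    ((snd e D x ^ 2)⁻¹) ^ 3 * eps (Ebar e D x) (slash e D x (OmVec D x)) (Nbar e D x)
        (SVec D x + SNbar e D x • B D x) ^ 2 =
      -ip e D x (Nbar e D x) (Nbar e D x) * ip e D x (Hbar e D x) (Hbar e D x) * gram e D x := by
  have hW := h.isSphere_slash (OmVec D x)
  have hΘ := h.isSphere_Theta
  have hU := h.isSphere_U
  have hY := h.isSphere_Y
  rw [gram, sIp_of_isSphere hW, sIp_of_isSphere hW, sIp_of_isSphere hY, Matrix.det_fin_two]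
  set W := slash e D x (OmVec D x)
  rw [eps_sq h.ip_Nbar_Ebar (h.ip_Nbar_of_isSphere hW) h.ip_Nbar_S]
  have h0 := eps_sq (h.ip_Nbar_of_isSphere hΘ) (h.ip_Nbar_of_isSphere hW) (h.ip_Nbar_of_isSphere hU)
  rw [h.eps_sphere hne hΘ hW hU, zero_pow two_ne_zero, mul_zero] at h0
  have h1 := (mul_eq_zero.1 h0.symm).resolve_left (neg_ne_zero.2 hne)
  have hS : SVec D x + SNbar e D x • B D x = U e D x + sCoef e D x • Hbar e D x := by
    rw [U_eq]; abel
  have hHW := h.ip_Hbar_of_isSphere hW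
  have hHΘ := h.ip_Hbar_of_isSphere hΘ
  have hHU := h.ip_Hbar_of_isSphere hU
  rw [hS, Ebar_eq, Y_eq]
  simp only [ip_add_left, ip_add_right, ip_sub_left, ip_sub_right, ip_smul_left, ip_smul_right, hHW,
    hHΘ, hHU, ip_comm _ (Hbar e D x), Matrix.of_apply, Matrix.cons_val', Matrix.cons_val_zero,
    Matrix.cons_val_one, Matrix.cons_val_fin_one, ip_comm (U e D x) (Theta e D x),
    ip_comm W (Theta e D x)]
  linear_combination (-ip e D x (Nbar e D x) (Nbar e D x)) * h1

theorem ip_Hbar_Hbar (h : IsFrame e D x) : ip e D x (Hbar e D x) (Hbar e D x) =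
    (hbar e D x ^ 2 / (-ip e D x (N e D x) (N e D x) * zbar e D x ^ 2)) *
      -ip e D x (Nbar e D x) (Nbar e D x) := by
  have h1 := h.z_pos.ne'
  have h2 := h.ip_NN.ne
  rw [h.Hbar_decomp, h.Nbar_decomp]
  simp only [ip_sub_left, ip_sub_right, ip_smul_left, ip_smul_right, h.ip_NZ, h.ip_ZZ,
    ip_comm (Z e D x) (N e D x)]
  field_simp
  ring

theorem ip_Hbar_Hbar_coef_pos (h : IsFrame e D x) :
    0 < hbar e D x ^ 2 / (-ip e D x (N e D x) (N e D x) * zbar e D x ^ 2) :=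
  div_pos (pow_pos h.h_pos 2) (mul_pos (neg_pos.2 h.ip_NN) (pow_pos h.z_pos 2))

/-- On a spacelike boundary `σ` is the sign of a quantity whose absolute value is proportional to the
square root of the Gram determinant, so the product of the two is smooth. -/
theorem sigma_mul_sqrt_gram (h : IsFrame e D x) (hneg : ip e D x (Nbar e D x) (Nbar e D x) < 0) :
    sigma e D x * Real.sqrt (gram e D x) =
      eps (Ebar e D x) (slash e D x (OmVec D x)) (Nbar e D x) (SVec D x + SNbar e D x • B D x) *
        Real.sqrt (((snd e D x ^ 2)⁻¹) ^ 3 *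
          (-ip e D x (Nbar e D x) (Nbar e D x) * ip e D x (Hbar e D x) (Hbar e D x))⁻¹) := by
  have hH : 0 < ip e D x (Hbar e D x) (Hbar e D x) := by
    rw [h.ip_Hbar_Hbar]
    exact mul_pos h.ip_Hbar_Hbar_coef_pos (neg_pos.2 hneg)
  have h1 := h.eps_sq_eq_gram hneg.ne
  rw [sigma]
  set ε₀ := eps (Ebar e D x) (slash e D x (OmVec D x)) (Nbar e D x)
    (SVec D x + SNbar e D x • B D x)
  have h2 : gram e D x = ε₀ ^ 2 * (((snd e D x ^ 2)⁻¹) ^ 3 *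
      (-ip e D x (Nbar e D x) (Nbar e D x) * ip e D x (Hbar e D x) (Hbar e D x))⁻¹) := by
    have h3 := hneg.ne
    have h4 := hH.ne'
    rw [eq_comm, ← mul_assoc, mul_comm (ε₀ ^ 2), h1]
    field_simp
  rw [h2, Real.sqrt_mul (sq_nonneg _), Real.sqrt_sq_eq_abs, ← mul_assoc]
  congr 1
  rcases lt_trichotomy ε₀ 0 with hlt | heq | hgt
  · rw [Real.sign_of_neg hlt, abs_of_neg hlt]; ring
  · rw [heq]; simp
  · rw [Real.sign_of_pos hgt, abs_of_pos hgt]; ring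

/-- On a null boundary the four vectors in the definition of `σ` are all orthogonal to `N̲`, which is
orthogonal to itself, so they are linearly dependent. -/
theorem sigma_eq_zero (h : IsFrame e D x) (h0 : ip e D x (Nbar e D x) (Nbar e D x) = 0) :
    sigma e D x = 0 := by
  have hne : Nbar e D x ≠ 0 := fun hN => by
    have := h.Nbar_zero
    rw [hN] at this
    exact zero_ne_one this
  rw [sigma, eps_eq_zero_of_orthogonal hne h.ip_Nbar_Ebar
    (h.ip_Nbar_of_isSphere (h.isSphere_slash _)) h0 h.ip_Nbar_S, Real.sign_zero]

end IsFrame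

end Gram

/-! ### The error integrands `𝔥_(1)[Ω]` and `𝔥_(2)[S]` -/

section Multilinear

theorem eps_third (X Y Z W : Vec) :
    eps X Y Z W = ∑ α, Z α * eps X Y (coordVec α) W := by
  have h : ∀ V : Vec, eps X Y V W = (Matrix.detRowAlternating (R := ℝ)
      (n := Fin 4)).toMultilinearMap.toLinearMap ![X, Y, 0, W] 2 V := by
    intro V
    rw [MultilinearMap.toLinearMap_apply]
    have h1 : Function.update ![X, Y, 0, W] 2 V = ![X, Y, V, W] := by
      ext i j
      fin_cases i <;> rfl
    rw [h1]
    rfl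
  have h2 : Z = ∑ α, Z α • coordVec α := by
    ext β
    simp [coordVec, Pi.single_apply]
  simp only [h]
  conv_lhs => rw [h2, map_sum]
  exact Finset.sum_congr rfl fun α _ => by rw [map_smul, smul_eq_mul]

theorem eps_swap (X Y Z W : Vec) : eps X Y Z W = -eps X Y W Z := by
  have h := Matrix.det_permute (Equiv.swap (2 : Fin 4) 3) (Matrix.of ![X, Y, W, Z])
  have h1 : (Matrix.of ![X, Y, W, Z]).submatrix (Equiv.swap (2 : Fin 4) 3) id =
      Matrix.of ![X, Y, Z, W] := by
    ext i j
    fin_cases i <;> rfl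
  rw [h1, Equiv.Perm.sign_swap (by decide)] at h
  simpa [eps] using h

end Multilinear

section Integrands

variable {e : EquationOfState} {K : Config → Prop} {κ : Type} [Fintype κ] {E : Type}
  [NormedAddCommGroup E] [NormedSpace ℝ E] {A : Config → Vec → κ → ℝ} {arg : Points e K → E}
  {T : Set (Points e K → ℝ)}

theorem IsCoefModule.eps_third_mem (hT : IsCoefModule arg T) {X Y Z W : Points e K → Vec}
    (hX : VecFunctionOf arg X) (hY : VecFunctionOf arg Y) (hZ : ∀ α, (fun q => Z q α) ∈ T)
    (hW : VecFunctionOf arg W) : (fun q => eps (X q) (Y q) (Z q) (W q)) ∈ T := by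
  refine IsCoefModule.congr (hT.sum Finset.univ fun α => hT.mul_right (hZ α)
    ((FunctionOf.eps (n := 1) hX hY (Z := fun _ => coordVec α) (fun β => .const _) hW).of_le
      zero_le_one)) fun q => eps_third _ _ _ _

theorem IsCoefModule.eps_fourth_mem (hT : IsCoefModule arg T) {X Y Z W : Points e K → Vec}
    (hX : VecFunctionOf arg X) (hY : VecFunctionOf arg Y) (hZ : VecFunctionOf arg Z)
    (hW : ∀ α, (fun q => W q α) ∈ T) : (fun q => eps (X q) (Y q) (Z q) (W q)) ∈ T :=
  IsCoefModule.congr (hT.neg (hT.eps_third_mem hX hY hW hZ)) fun _ => eps_swap _ _ _ _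

theorem IsCoefModule.spatial_mem (hT : IsCoefModule arg T) {w : Points e K → Fin 3 → ℝ}
    (hw : ∀ a, (fun q => w q a) ∈ T) (α : Fin 4) : (fun q => spatial (w q) α) ∈ T := by
  refine Fin.cases ?_ (fun a => ?_) α
  · exact hT.zero
  · exact hw a

theorem VecFunctionOf.spatial {w : Points e K → Fin 3 → ℝ}
    (hw : ∀ a, FunctionOf 1 arg fun q => w q a) :
    VecFunctionOf arg fun q => EulerBoundary.spatial (w q) := by
  intro α
  refine Fin.cases ?_ (fun a => ?_) α
  · exact .const 0
  · exact hw a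

theorem IsCoefModule.SNbar_mem (hT : IsCoefModule arg T) (hR : FrameArray arg)
    (hS : ∀ a, (fun q : Points e K => S q.1.D a q.1.x) ∈ T) :
    (fun q : Points e K => SNbar e q.1.D q.1.x) ∈ T :=
  hT.sum _ fun a => hT.mul_right (hS a) ((hR.psi.low hR.Nbar a.succ).of_le zero_le_one)

namespace IsDerivModule

theorem dir_Ebar_mem {f : Config → Vec → ℝ} (h : IsDerivModule arg A T)
    (hf : FunctionOf 1 (fun q : Points e K => A q.1.D q.1.x) fun q => f q.1.D q.1.x)
    (hd : ∀ q : Points e K, DifferentiableAt ℝ (f q.1.D) q.1.x) :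
    (fun q : Points e K => dir (Ebar e q.1.D q.1.x) (f q.1.D) q.1.x) ∈ T := by
  refine IsCoefModule.congr (h.isCoefModule.add
    (h.dir_sphere_mem hf hd (h.frameArray.Theta h.frame) fun q => (h.frame q).isSphere_Theta)
    (h.isCoefModule.mul ((h.frameArray.hbar_inv h.frame).of_le zero_le_one)
      (h.dir_gen_mem hf hd))) fun q => ?_
  rw [Ebar_eq]
  simp [dir]

theorem errTwo_mem (h : IsDerivModule arg A T)
    (hA : FluidArray fun q : Points e K => A q.1.D q.1.x)
    (hS : VecFunctionOf arg fun q : Points e K => SVec q.1.D q.1.x) :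
    (fun q : Points e K => errTwo e q.1.D q.1.x) ∈ T := by
  have hT := h.isCoefModule
  have hK := h.frame
  have hR := h.frameArray
  have hc : ∀ {a : Points e K → ℝ}, FunctionOf 1 arg a → FunctionOf 0 arg a :=
    fun ha => ha.of_le zero_le_one
  have hW := hR.slash hK hS
  have hd := fun q : Points e K =>
    q.1.admissible.differentiableAt_log_snd (q.1.admissible.mem_O q.1.mem)
  refine hT.sub (hT.mul (hc (((FunctionOf.const 4).mul hR.zbar).mul (hR.psi.ip hS (hR.Ebar hK))))
    (h.dir_sphere_mem (f := fun D y => Real.log (snd e D y)) hA.log_snd hd hW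
      fun q => (hK q).isSphere_slash _))
    (hT.mul (hc (((FunctionOf.const 4).mul hR.zbar).mul (hR.sIp hK hW hW)))
      (h.dir_Ebar_mem (f := fun D y => Real.log (snd e D y)) hA.log_snd hd))

theorem brace_mem (h : IsDerivModule arg A T)
    (hA : FluidArray fun q : Points e K => A q.1.D q.1.x)
    (hS : ∀ a, (fun q : Points e K => S q.1.D a q.1.x) ∈ T) :
    (fun q : Points e K => brace e q.1.D q.1.x) ∈ T := by
  have hT := h.isCoefModule
  have hK := h.frame
  have hR := h.frameArray
  have hc : ∀ {a : Points e K → ℝ}, FunctionOf 1 arg a → FunctionOf 0 arg a :=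
    fun ha => ha.of_le zero_le_one
  have hO := fun q : Points e K => q.1.admissible.mem_O q.1.mem
  have hdv := fun a (q : Points e K) => q.1.admissible.differentiableAt_v (hO q) a
  have hdρ := fun q : Points e K => q.1.admissible.differentiableAt_Psi (hO q) 0
  refine hT.add (hT.add (hT.add (hT.add ?_ ?_) ?_) ?_) ?_
  · exact hT.sum _ fun a => hT.mul (hc (hR.psi.low (hR.P hK) a.succ))
      (h.dir_gen_mem (f := fun D => D.v a) (hA.v a) (hdv a))
  · exact hT.mul (hc (.sum _ fun a => (hR.psi.low hR.Nbar a.succ).mul (hR.P hK a.succ)))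
      (h.dir_gen_mem (f := fun D => D.rho) hA.rho hdρ)
  · exact hT.sum _ fun a => h.dir_sphere_mem (f := fun D => D.v a) (hA.v a) (hdv a)
      (hR.lam hK a.succ) fun q => (hK q).isSphere_lam _
  · exact hT.sum _ fun a => hT.sum _ fun b => hT.mul (hc (((hR.psi.gUp a.succ b.succ).add
      ((hR.psi.B a.succ).mul (hR.psi.B b.succ))).mul (hR.psi.low hR.Nbar a.succ)))
      (h.dir_sphere_mem (f := fun D => D.rho) hA.rho hdρ
        (hR.lam hK b.succ) fun q => (hK q).isSphere_lam _)
  · exact hT.mul (hc (hR.psi.rho.neg.exp.mul hR.psi.pSbar)) (hT.SNbar_mem hR hS)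

/-- `𝔥_(1)[Ω]` is a combination of `H`-tangent derivatives of the fluid variables and of the entries
of `S` and `𝒞`, provided that `σ` times the square root of the Gram determinant is an admissible
coefficient. -/
theorem errOne_mem (h : IsDerivModule arg A T)
    (hA : FluidArray fun q : Points e K => A q.1.D q.1.x)
    (hcausal : ∀ q : Points e K, ip e q.1.D q.1.x (Nbar e q.1.D q.1.x) (Nbar e q.1.D q.1.x) ≤ 0)
    (hOm : ∀ a, FunctionOf 1 arg fun q : Points e K => Om q.1.D a q.1.x)
    (hS : ∀ a, FunctionOf 1 arg fun q : Points e K => S q.1.D a q.1.x)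
    (hσ : FunctionOf 0 arg fun q : Points e K =>
      sigma e q.1.D q.1.x * Real.sqrt (gram e q.1.D q.1.x))
    (hST : ∀ a, (fun q : Points e K => S q.1.D a q.1.x) ∈ T)
    (hCT : ∀ a, (fun q : Points e K => modC e q.1.D a q.1.x) ∈ T) :
    (fun q : Points e K => errOne e q.1.D q.1.x) ∈ T := by
  have hT := h.isCoefModule
  have hK := h.frame
  have hR := h.frameArray
  have hc : ∀ {a : Points e K → ℝ}, FunctionOf 1 arg a → FunctionOf 0 arg a :=
    fun ha => ha.of_le zero_le_one
  have hO := fun q : Points e K => q.1.admissible.mem_O q.1.mem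
  have hdv := fun a (q : Points e K) => q.1.admissible.differentiableAt_v (hO q) a
  have hdρ := fun q : Points e K => q.1.admissible.differentiableAt_Psi (hO q) 0
  have hdc := fun q : Points e K => q.1.admissible.differentiableAt_log_snd (hO q)
  have hOV : VecFunctionOf arg fun q : Points e K => OmVec q.1.D q.1.x := .spatial hOm
  have hSV : VecFunctionOf arg fun q : Points e K => SVec q.1.D q.1.x := .spatial hS
  have hW := hR.slash hK hOV
  have hWS : ∀ q : Points e K, IsSphere e q.1.D q.1.x (slash e q.1.D q.1.x (OmVec q.1.D q.1.x)) :=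
    fun q => (hK q).isSphere_slash _
  have hE := hR.Ebar hK
  have hP := hR.P hK
  have hSN : FunctionOf 1 arg fun q : Points e K => SNbar e q.1.D q.1.x :=
    .sum _ fun a => (hS a).mul (hR.psi.low hR.Nbar a.succ)
  have hz2 := (FunctionOf.const 2).mul hR.zbar
  have hz4 := (FunctionOf.const 4).mul hR.zbar
  have he : ∀ r : ℝ, FunctionOf 1 arg fun q : Points e K => Real.exp (r * q.1.D.rho q.1.x) :=
    fun r => ((FunctionOf.const r).mul hR.psi.rho).exp
  have hbase : ∀ k : ℕ, FunctionOf 1 arg fun q : Points e K => 2 * zbar e q.1.D q.1.x *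
      (snd e q.1.D q.1.x ^ k)⁻¹ * Real.exp (-2 * q.1.D.rho q.1.x) * pSbar e q.1.D q.1.x := fun k =>
    ((hz2.mul (hR.psi.snd_inv_pow k)).mul (he (-2))).mul hR.psi.pSbar
  have hlamρ : ∀ a : Fin 3, (fun q : Points e K =>
      dir (lam e q.1.D a.succ q.1.x) q.1.D.rho q.1.x) ∈ T := fun a =>
    h.dir_sphere_mem (f := fun D => D.rho) hA.rho hdρ (hR.lam hK a.succ)
      fun q => (hK q).isSphere_lam _
  have hgenρ := h.dir_gen_mem (f := fun D => D.rho) hA.rho hdρ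
  refine hT.sub (hT.add (hT.sub (hT.sub (hT.sub (hT.add (hT.sub (hT.add (hT.sub (hT.add
    (hT.sub (hT.add ?_ ?_) ?_) ?_) ?_) ?_) ?_) ?_) ?_) ?_) ?_) ?_) ?_
  · have hHH : ∀ q : Points e K, etabar e q.1.D q.1.x ^ 2 =
        ip e q.1.D q.1.x (Hbar e q.1.D q.1.x) (Hbar e q.1.D q.1.x) := fun q => by
      refine Real.sq_sqrt ?_
      rw [(hK q).ip_Hbar_Hbar]
      exact mul_nonneg (hK q).ip_Hbar_Hbar_coef_pos.le (neg_nonneg.2 (hcausal q))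
    have hη : FunctionOf 1 arg fun q : Points e K => etabar e q.1.D q.1.x ^ 2 :=
      (hR.psi.ip hR.Hbar hR.Hbar).congr hHH
    have hden : ∀ q : Points e K,
        0 < hbar e q.1.D q.1.x ^ 2 + etabar e q.1.D q.1.x ^ 2 * nu e q.1.D q.1.x ^ 2 := fun q =>
      add_pos_of_pos_of_nonneg (pow_pos (hK q).h_pos 2) (by positivity)
    have hratio : FunctionOf 1 arg fun q : Points e K =>
        (hbar e q.1.D q.1.x + etabar e q.1.D q.1.x ^ 2) /
          Real.sqrt (hbar e q.1.D q.1.x ^ 2 + etabar e q.1.D q.1.x ^ 2 * nu e q.1.D q.1.x ^ 2) :=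
      (hR.hbar.add hη).div (((hR.hbar.pow 2).add (hη.mul ((hR.nu hK).pow 2))).sqrt
        fun q => (hden q).ne') fun q => (Real.sqrt_pos.2 (hden q)).ne'
    refine IsCoefModule.congr (hT.mul (hσ.mul (hc ((hbase 1).mul hratio)))
      (h.brace_mem hA hST)) fun q => ?_
    simp only [pow_one]
    ring
  · exact hT.mul (hc (hz4.mul (hR.psi.ip hOV hE)))
      (h.dir_sphere_mem (f := fun D y => Real.log (snd e D y)) hA.log_snd hdc hW hWS)
  · exact hT.mul (hc (hz4.mul (hR.sIp hK hW hW)))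
      (h.dir_Ebar_mem (f := fun D y => Real.log (snd e D y)) hA.log_snd hdc)
  · exact hT.mul (hc (hz4.mul (hE 0))) (hT.sum _ fun a => hT.mul (hc (hR.psi.low hOV a.succ))
      (h.dir_sphere_mem (f := fun D => D.v a) (hA.v a) (hdv a) hW hWS))
  · exact hT.mul (hc (hz4.mul (hW 0))) (hT.sum _ fun a => hT.mul (hc (hR.psi.low hOV a.succ))
      (h.dir_Ebar_mem (f := fun D => D.v a) (hA.v a) (hdv a)))
  · exact hT.mul (hc ((hbase 4).mul (.eps hE hW hP hSV))) hgenρ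
  · exact hT.mul (hc (((hbase 4).mul hSN).mul (.eps hE hW hR.psi.B hP))) hgenρ
  · exact hT.mul (hc (hbase 2)) (hT.eps_third_mem hE hW (hT.spatial_mem hlamρ) hSV)
  · exact hT.mul (hc ((hbase 2).mul hSN))
      (hT.eps_fourth_mem hE hW hR.psi.B (hT.spatial_mem hlamρ))
  · exact hT.mul (hc ((hbase 4).mul (.sum _ fun a => (hS a).mul (hR.psi.low hP a.succ))))
      (hT.eps_fourth_mem hE hW hR.psi.B (hT.spatial_mem fun i =>
        h.dir_gen_mem (f := fun D => D.v i) (hA.v i) (hdv i)))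
  · exact hT.mul (hc (hbase 4)) (hT.eps_fourth_mem hE hW hR.psi.B (hT.spatial_mem fun i =>
      hT.sum _ fun a => hT.mul (hc (hS a)) (h.dir_sphere_mem (f := fun D => D.v i) (hA.v i) (hdv i)
        (hR.lam hK a.succ) fun q => (hK q).isSphere_lam _)))
  · exact hT.mul (hc ((hz2.mul (hR.psi.snd_inv_pow 2)).mul hR.psi.rho.exp))
      (hT.eps_fourth_mem hE hW hR.psi.B (hT.spatial_mem hCT))
  · exact hT.mul (hc ((((hz2.mul (hR.psi.snd_inv_pow 4)).mul (he (-3))).mul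
      (hR.psi.pSbar.pow 2)).mul hSN)) (hT.eps_fourth_mem hE hW hR.psi.B (hT.spatial_mem hST))

end IsDerivModule

end Integrands

/-! ### Causal character of the normal -/

section Causal

variable {e : EquationOfState} {D : Config} {x : Vec}

theorem IsFrame.isNormal_Nbar (h : IsFrame e D x) : IsNormal e D x (Nbar e D x) :=
  fun X hX => (h.mem_TH X).1 hX

theorem IsFrame.Nbar_ne_zero (h : IsFrame e D x) : Nbar e D x ≠ 0 := fun hN =>
  zero_ne_one (by rw [← h.Nbar_zero, hN]; rfl)

theorem IsFrame.ip_Nbar_Nbar_neg (h : IsFrame e D x) (hs : IsSpacelike e D) (hx : x ∈ D.H) :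
    ip e D x (Nbar e D x) (Nbar e D x) < 0 := hs x hx _ h.Nbar_ne_zero h.isNormal_Nbar

theorem IsFrame.ip_Nbar_Nbar_eq_zero (h : IsFrame e D x) (hn : IsNull e D) (hx : x ∈ D.H) :
    ip e D x (Nbar e D x) (Nbar e D x) = 0 := hn x hx _ h.Nbar_ne_zero h.isNormal_Nbar

theorem IsFrame.ip_Nbar_Nbar (h : IsFrame e D x) : ip e D x (Nbar e D x) (Nbar e D x) =
    zbar e D x ^ 2 - (tilt e D x * nu e D x) ^ 2 := by
  rw [mul_pow, h.nu_sq]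
  conv_lhs => rw [h.Nbar_decomp]
  simp only [ip_sub_left, ip_sub_right, ip_smul_left, ip_smul_right, h.ip_NZ, h.ip_ZZ,
    ip_comm (Z e D x) (N e D x)]
  ring

/-- `N` and a null `N̲` are both future-directed, since `N t = N̲ t = 1`, so their product is
negative. -/
theorem IsFrame.tilt_pos (h : IsFrame e D x) (h0 : ip e D x (Nbar e D x) (Nbar e D x) = 0) :
    0 < tilt e D x := by
  have h1 : (N e D x - Nbar e D x) 0 = 0 := by
    rw [Pi.sub_apply, h.N_zero, h.Nbar_zero, sub_self]
  have h2 : 0 ≤ ip e D x (N e D x - Nbar e D x) (N e D x - Nbar e D x) := by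
    rw [ip_self_of_zero h1]
    exact mul_nonneg (inv_nonneg.2 (sq_nonneg _)) (Finset.sum_nonneg fun a _ => sq_nonneg _)
  simp only [ip_sub_left, ip_sub_right, h0, ip_comm (N e D x) (Nbar e D x)] at h2
  exact div_pos_of_neg_of_neg (by linarith [h.ip_NN]) h.ip_NN

/-- If `p` is the coefficient `tilt`, then `g(N̲, N̲) = z̲ ^ 2 - (p ν) ^ 2`, where `z̲` and `p ν` are
positive. -/
theorem IsFrame.zbar_eq_of_null (h : IsFrame e D x)
    (h0 : ip e D x (Nbar e D x) (Nbar e D x) = 0) : zbar e D x = tilt e D x * nu e D x := by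
  rw [h.ip_Nbar_Nbar] at h0
  exact (pow_left_inj₀ h.z_pos.le (mul_pos (h.tilt_pos (by rw [h.ip_Nbar_Nbar, h0])) h.nu_pos).le
    two_ne_zero).1 (by linarith)

/-- A null normal is tangent to `H` and orthogonal to the sphere, so it is proportional to `H̲`; the time
components of both are one. -/
theorem IsFrame.Nbar_eq_Hbar (h : IsFrame e D x)
    (h0 : ip e D x (Nbar e D x) (Nbar e D x) = 0) : Nbar e D x = Hbar e D x := by
  have h1 := h.zbar_eq_of_null h0
  have h2 := (h.tilt_pos h0).ne'
  have h3 := h.nu_pos.ne'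
  set r := hbar e D x / (tilt e D x * nu e D x ^ 2) with hr
  have h4 : Hbar e D x = r • Nbar e D x := by
    rw [h.Hbar_decomp, h.Nbar_decomp, ← h.nu_sq, h1, smul_sub, smul_smul, smul_smul, hr]
    congr 2
    · field_simp
    · field_simp
  have h5 : r = 1 := by
    have := congrFun h4 0
    rw [h.Hbar_zero, Pi.smul_apply, h.Nbar_zero, smul_eq_mul, mul_one] at this
    exact this.symm
  rw [h4, h5, one_smul]

end Causal

/-! ### The time function -/

section ArrayN

variable {e : EquationOfState} {K : Config → Prop} {E : Type} [NormedAddCommGroup E]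
  [NormedSpace ℝ E] {A : Points e K → E}

theorem FluidArray.tauRate (hA : FluidArray A)
    (hτ : ∀ α, FunctionOf 1 A fun q => pd α q.1.D.tau q.1.x) :
    FunctionOf 1 A fun q => EulerBoundary.tauRate q.1.D q.1.x :=
  (FunctionOf.sum Finset.univ fun α => (hA.B α).mul (hτ α)).congr fun _ => dir_eq_sum _ _ _

theorem FluidArray.N_of_tau (hA : FluidArray A) (hK : ∀ q : Points e K, IsFrame e q.1.D q.1.x)
    (hτ : ∀ α, FunctionOf 1 A fun q => pd α q.1.D.tau q.1.x) :
    VecFunctionOf A fun q => EulerBoundary.N e q.1.D q.1.x :=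
  (VecFunctionOf.smul ((hA.tauRate hτ).inv fun q => (hK q).tau_pos.ne').neg (hA.raise hτ)).congr
    fun _ => N_eq

end ArrayN

/-! ### Differentiability of the frame along the boundary -/

section FrameDifferentiability

variable {e : EquationOfState} {D : Config} {x : Vec}

/-- `Z` and `H̲` are smooth functions of `Ψ`, `∂τ` and `N̲`, which are differentiable along `H`. -/
theorem Admissible.differentiableWithinAt_frame (h : Admissible e D)
    (hc : IsSpacelike e D ∨ IsNull e D) (hx : x ∈ D.H) (α : Fin 4) :
    DifferentiableWithinAt ℝ (fun y => Z e D y α) D.H x ∧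
      DifferentiableWithinAt ℝ (fun y => Hbar e D y α) D.H x := by
  set K : Config → Prop := fun D => IsSpacelike e D ∨ IsNull e D
  set A : Config → Vec → Fin 5 ⊕ Fin 4 ⊕ Fin 4 → ℝ := fun D x =>
    Sum.elim (fun J => Psi D J x) (Sum.elim (fun α => pd α D.tau x) (Nbar e D x))
  have hK : ∀ q : Points e K, IsFrame e q.1.D q.1.x := fun q => q.1.admissible.isFrame q.2 q.1.mem
  have hΨ : FluidArray fun q : Points e K => A q.1.D q.1.x := fun J => .coord (Sum.inl J)
  have hA : FrameArray fun q : Points e K => A q.1.D q.1.x :=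
    .of_N_Nbar hK hΨ (hΨ.N_of_tau hK fun α => .coord (Sum.inr (Sum.inl α)))
      fun α => .coord (Sum.inr (Sum.inr α))
  have hd : ∀ (q : Points e K) j,
      DifferentiableWithinAt ℝ (fun y => A q.1.D y j) q.1.D.H q.1.x := by
    rintro q (J | β | β)
    · exact (q.1.admissible.differentiableAt_Psi
        (q.1.admissible.mem_O q.1.mem) J).differentiableWithinAt
    · exact (q.1.admissible.differentiableAt_pd_tau
        (q.1.admissible.mem_O q.1.mem) β).differentiableWithinAt
    · exact q.1.admissible.differentiableWithinAt_Nbar q.2 q.1.mem β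
  exact ⟨(FunctionOf.exists_along_eq (f := fun D y => Z e D y α) (hA.Z α) hd).1
      ⟨⟨D, h, x, hx⟩, hc⟩,
    (FunctionOf.exists_along_eq (f := fun D y => Hbar e D y α) (hA.Hbar α) hd).1
      ⟨⟨D, h, x, hx⟩, hc⟩⟩

end FrameDifferentiability

/-! ### Spacelike boundaries -/

section Spacelike

variable {e : EquationOfState}

theorem isFrame_of_spacelike (q : Points e (IsSpacelike e)) : IsFrame e q.1.D q.1.x :=
  q.1.admissible.isFrame (Or.inl q.2) q.1.mem

theorem functionOf_argSpacelike {F : (Fin 5 → ℝ) × (Fin 3 → ℝ) × (Fin 3 → ℝ) × Vec × Vec ×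
    (Fin 4 → ℝ) → ℝ} (hF : ContDiff ℝ 1 F) :
    FunctionOf 1 (fun q : Points e (IsSpacelike e) => argSpacelike q.1)
      fun q => F (argSpacelike q.1) := .of_contDiff hF

theorem fluidArray_argSpacelike :
    FluidArray fun q : Points e (IsSpacelike e) => argSpacelike q.1 := fun J =>
  functionOf_argSpacelike (F := fun a => a.1 J) (by fun_prop)

theorem dtau_argSpacelike (α : Fin 4) :
    FunctionOf 1 (fun q : Points e (IsSpacelike e) => argSpacelike q.1)
      fun q => pd α q.1.D.tau q.1.x :=
  functionOf_argSpacelike (F := fun a => a.2.2.2.2.2 α) (by fun_prop)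

theorem frameArray_argSpacelike :
    FrameArray fun q : Points e (IsSpacelike e) => argSpacelike q.1 :=
  .of_N_Z_Hbar isFrame_of_spacelike fluidArray_argSpacelike
    (fluidArray_argSpacelike.N_of_tau isFrame_of_spacelike dtau_argSpacelike)
    (fun α => functionOf_argSpacelike (F := fun a => a.2.2.2.2.1 α) (by fun_prop))
    (fun α => functionOf_argSpacelike (F := fun a => a.2.2.2.1 α) (by fun_prop))

/-- The array `(Ψ, H̲, Z, ∂τ)`, of which all the geometric quantities along a spacelike boundary are
functions. -/
def spacelikeArray (e : EquationOfState) (D : Config) (x : Vec) :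
    Fin 5 ⊕ Fin 4 ⊕ Fin 4 ⊕ Fin 4 → ℝ :=
  Sum.elim (fun J => Psi D J x) (Sum.elim (Hbar e D x) (Sum.elim (Z e D x) fun α => pd α D.tau x))

theorem frameArray_spacelikeArray :
    FrameArray fun q : Points e (IsSpacelike e) => spacelikeArray e q.1.D q.1.x := by
  have hΨ : FluidArray fun q : Points e (IsSpacelike e) => spacelikeArray e q.1.D q.1.x :=
    fun J => .coord (Sum.inl J)
  exact .of_N_Z_Hbar isFrame_of_spacelike hΨ
    (hΨ.N_of_tau isFrame_of_spacelike fun α => .coord (Sum.inr (Sum.inr (Sum.inr α))))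
    (fun α => .coord (Sum.inr (Sum.inr (Sum.inl α)))) (fun α => .coord (Sum.inr (Sum.inl α)))

theorem nubar_sq {D : Config} {x : Vec} (h : ip e D x (Nbar e D x) (Nbar e D x) < 0) :
    nubar e D x ^ 2 = -ip e D x (Nbar e D x) (Nbar e D x) := Real.sq_sqrt (neg_pos.2 h).le

theorem hProj_apply {D : Config} {x : Vec} (α β : Fin 4) : hProj e D x α β =
    (if α = β then 1 else 0) + (nubar e D x ^ 2)⁻¹ * Nbar e D x α * low e D x (Nbar e D x) β := by
  have h1 : low e D x (Nbarhat e D x) β = (nubar e D x)⁻¹ * low e D x (Nbar e D x) β := by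
    simp only [low, Nbarhat, Finset.mul_sum]
    exact Finset.sum_congr rfl fun γ _ => by ring
  rw [hProj, h1, Nbarhat]
  ring

theorem sum_smul_sideVec {D : Config} {x : Vec} {X : Vec} (hX : ip e D x (Nbar e D x) X = 0) :
    ∑ α, X α • sideVec e D α x = X := by
  ext β
  simp only [Finset.sum_apply, Pi.smul_apply, smul_eq_mul, sideVec, hProj_apply, mul_add,
    Finset.sum_add_distrib]
  have h1 : ∑ α, X α * ((nubar e D x ^ 2)⁻¹ * Nbar e D x β * low e D x (Nbar e D x) α) =
      (nubar e D x ^ 2)⁻¹ * Nbar e D x β * ip e D x (Nbar e D x) X := by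
    rw [ip_eq_sum_low, Finset.mul_sum]
    exact Finset.sum_congr rfl fun α _ => by ring
  rw [h1, hX]
  simp

theorem sideVec_mem_TH {D : Config} {x : Vec} (h : IsFrame e D x)
    (hneg : ip e D x (Nbar e D x) (Nbar e D x) < 0) (α : Fin 4) : sideVec e D α x ∈ TH D x := by
  have h1 : sideVec e D α x = coordVec α +
      ((nubar e D x ^ 2)⁻¹ * low e D x (Nbar e D x) α) • Nbar e D x := by
    ext β
    simp only [sideVec, hProj_apply, Pi.add_apply, Pi.smul_apply, smul_eq_mul, coordVec,
      Pi.single_apply]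
    ring
  rw [h.mem_TH, h1, ip_add_right, ip_smul_right, nubar_sq hneg, ← low_eq_ip]
  have := hneg.ne
  field_simp
  ring

theorem differentiableWithinAt_spacelikeArray (q : Points e (IsSpacelike e))
    (j : Fin 5 ⊕ Fin 4 ⊕ Fin 4 ⊕ Fin 4) :
    DifferentiableWithinAt ℝ (fun y => spacelikeArray e q.1.D y j) q.1.D.H q.1.x := by
  have h := q.1.admissible
  have hO := h.mem_O q.1.mem
  rcases j with J | α | α | α
  · exact (h.differentiableAt_Psi hO J).differentiableWithinAt
  · exact (h.differentiableWithinAt_frame (Or.inl q.2) q.1.mem α).2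
  · exact (h.differentiableWithinAt_frame (Or.inl q.2) q.1.mem α).1
  · exact (h.differentiableAt_pd_tau hO α).differentiableWithinAt

open scoped Pointwise in
theorem isCoefModule_spacelike {ι : Type} [Fintype ι] (b : Points e (IsSpacelike e) → ι → ℝ) :
    IsCoefModule (fun q : Points e (IsSpacelike e) => argSpacelike q.1)
      (Schematic (fun q : Points e (IsSpacelike e) => argSpacelike q.1) b
        + Schematic (fun q : Points e (IsSpacelike e) => argSpacelike q.1) fun q => arrLow q.1) :=
  (isCoefModule_schematic id).set_add (isCoefModule_schematic id)

/-- Derivatives in `H`-tangent directions are combinations of the projected Cartesian derivatives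
`∂̲_α`. -/
theorem along_mem_of_sideVec {T : Set (Points e (IsSpacelike e) → ℝ)}
    (hT : IsCoefModule (fun q : Points e (IsSpacelike e) => argSpacelike q.1) T)
    {f : Config → Vec → ℝ} (hf : ∀ α, (fun q : Points e (IsSpacelike e) =>
      along q.1.D (sideVec e q.1.D α q.1.x) (f q.1.D) q.1.x) ∈ T)
    {X : Points e (IsSpacelike e) → Vec}
    (hX : VecFunctionOf (fun q : Points e (IsSpacelike e) => argSpacelike q.1) X)
    (hXT : ∀ q, X q ∈ TH q.1.D q.1.x) :
    (fun q : Points e (IsSpacelike e) => along q.1.D (X q) (f q.1.D) q.1.x) ∈ T := by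
  refine IsCoefModule.congr (hT.sum Finset.univ fun α =>
    hT.mul ((hX α).of_le zero_le_one) (hf α)) fun q => ?_
  conv_lhs => rw [← sum_smul_sideVec (((isFrame_of_spacelike q).mem_TH _).1 (hXT q))]
  rw [along_sum_smul]

theorem isDerivModule_of_sideVec {κ : Type} [Fintype κ] {A : Config → Vec → κ → ℝ}
    {T : Set (Points e (IsSpacelike e) → ℝ)}
    (hT : IsCoefModule (fun q : Points e (IsSpacelike e) => argSpacelike q.1) T)
    (hA : ∀ j, FunctionOf 0 (fun q : Points e (IsSpacelike e) => argSpacelike q.1)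
      fun q => A q.1.D q.1.x j)
    (hd : ∀ (q : Points e (IsSpacelike e)) j,
      DifferentiableWithinAt ℝ (fun y => A q.1.D y j) q.1.D.H q.1.x)
    (hf : ∀ α j, (fun q : Points e (IsSpacelike e) =>
      along q.1.D (sideVec e q.1.D α q.1.x) (fun y => A q.1.D y j) q.1.x) ∈ T) :
    IsDerivModule (fun q : Points e (IsSpacelike e) => argSpacelike q.1) A T where
  frame := isFrame_of_spacelike
  isCoefModule := hT
  frameArray := frameArray_argSpacelike
  coef := hA
  diff := hd
  ang δ j := along_mem_of_sideVec hT (f := fun D y => A D y j) (fun α => hf α j)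
    (fun α => frameArray_argSpacelike.sProj isFrame_of_spacelike α δ)
    fun q => (isFrame_of_spacelike q).mem_TH_of_isSphere ((isFrame_of_spacelike q).isSphere_angVec δ)
  gen j := along_mem_of_sideVec hT (f := fun D y => A D y j) (fun α => hf α j)
    frameArray_argSpacelike.Hbar fun q => (isFrame_of_spacelike q).Hbar_mem

theorem along_sideVec_Psi (q : Points e (IsSpacelike e)) (α : Fin 4) (J : Fin 5) :
    along q.1.D (sideVec e q.1.D α q.1.x) (Psi q.1.D J) q.1.x = sidePsi q.1 (α, J) :=
  along_eq_dir (q.1.admissible.differentiableAt_Psi (q.1.admissible.mem_O q.1.mem) J)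
    (sideVec_mem_TH (isFrame_of_spacelike q)
      ((isFrame_of_spacelike q).ip_Nbar_Nbar_neg q.2 q.1.mem) α)

open scoped Pointwise in
theorem isDerivModule_arrSide :
    IsDerivModule (fun q : Points e (IsSpacelike e) => argSpacelike q.1) (spacelikeArray e)
      (Schematic (fun q : Points e (IsSpacelike e) => argSpacelike q.1) (fun q => arrSide q.1)
        + Schematic (fun q : Points e (IsSpacelike e) => argSpacelike q.1) fun q => arrLow q.1) := by
  refine isDerivModule_of_sideVec (isCoefModule_spacelike _) ?_
    differentiableWithinAt_spacelikeArray fun α j => ?_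
  · rintro (J | α | α | α)
    · exact (fluidArray_argSpacelike J).of_le zero_le_one
    · exact (frameArray_argSpacelike.Hbar α).of_le zero_le_one
    · exact (frameArray_argSpacelike.Z α).of_le zero_le_one
    · exact (dtau_argSpacelike α).of_le zero_le_one
  · refine IsCoefModule.mem_add_left
      (isCoefModule_schematic (A' := fun q : Points e (IsSpacelike e) => argSpacelike q.1) id) ?_
    rcases j with J | β | β | β
    · exact schematic_coord (Sum.inl (α, J)) fun q => along_sideVec_Psi q α J
    · exact schematic_coord (Sum.inr (Sum.inl (α, β))) fun q => rfl
    · exact schematic_coord (Sum.inr (Sum.inr (Sum.inl (α, β)))) fun q => rfl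
    · exact schematic_coord (Sum.inr (Sum.inr (Sum.inr (α, β)))) fun q => along_eq_dir
        (q.1.admissible.differentiableAt_pd_tau (q.1.admissible.mem_O q.1.mem) β)
        (sideVec_mem_TH (isFrame_of_spacelike q)
          ((isFrame_of_spacelike q).ip_Nbar_Nbar_neg q.2 q.1.mem) α)

open scoped Pointwise in
/-- For integrands in which only the fluid variables are differentiated, no derivatives of `H̲` are
needed. -/
theorem isDerivModule_arrSideAng :
    IsDerivModule (fun q : Points e (IsSpacelike e) => argSpacelike q.1) (fun D x J => Psi D J x)
      (Schematic (fun q : Points e (IsSpacelike e) => argSpacelike q.1) (fun q => arrSideAng q.1)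
        + Schematic (fun q : Points e (IsSpacelike e) => argSpacelike q.1) fun q => arrLow q.1) :=
  isDerivModule_of_sideVec (isCoefModule_spacelike _)
    (fun J => (fluidArray_argSpacelike J).of_le zero_le_one)
    (fun q J => differentiableWithinAt_spacelikeArray q (Sum.inl J)) fun α J =>
      IsCoefModule.mem_add_left
        (isCoefModule_schematic (A' := fun q : Points e (IsSpacelike e) => argSpacelike q.1) id)
        (schematic_coord (Sum.inl (α, J)) fun q => along_sideVec_Psi q α J)

theorem om_argSpacelike (a : Fin 3) :
    FunctionOf 1 (fun q : Points e (IsSpacelike e) => argSpacelike q.1)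
      fun q => Om q.1.D a q.1.x := functionOf_argSpacelike (F := fun u => u.2.1 a) (by fun_prop)

theorem s_argSpacelike (a : Fin 3) :
    FunctionOf 1 (fun q : Points e (IsSpacelike e) => argSpacelike q.1)
      fun q => S q.1.D a q.1.x := functionOf_argSpacelike (F := fun u => u.2.2.1 a) (by fun_prop)

open scoped Pointwise in
theorem errV_mem_spacelike {V : Points e (IsSpacelike e) → Vec}
    (hV : VecFunctionOf (fun q : Points e (IsSpacelike e) => argSpacelike q.1) V) :
    (fun q : Points e (IsSpacelike e) => errV e q.1.D q.1.x (V q)) ∈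
      Schematic (fun q : Points e (IsSpacelike e) => argSpacelike q.1) (fun q => arrSide q.1)
        + Schematic (fun q : Points e (IsSpacelike e) => argSpacelike q.1) fun q => arrLow q.1 := by
  have h := isDerivModule_arrSide (e := e)
  refine h.errV_mem frameArray_spacelikeArray ?_ hV
  have h1 := h.along_gen_mem (f := tauRate) (frameArray_spacelikeArray.psi.tauRate
    fun α => .coord (Sum.inr (Sum.inr (Sum.inr α))))
  exact IsCoefModule.congr (h.isCoefModule.mul_right h1 (((fluidArray_argSpacelike.tauRate
    dtau_argSpacelike).inv fun q => (isFrame_of_spacelike q).tau_pos.ne').of_le zero_le_one))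
    fun q => div_eq_mul_inv _ _

theorem sigma_mul_sqrt_gram_argSpacelike :
    FunctionOf 0 (fun q : Points e (IsSpacelike e) => argSpacelike q.1)
      fun q => sigma e q.1.D q.1.x * Real.sqrt (gram e q.1.D q.1.x) := by
  have hK := isFrame_of_spacelike (e := e)
  have hR := frameArray_argSpacelike (e := e)
  have hneg := fun q : Points e (IsSpacelike e) => (hK q).ip_Nbar_Nbar_neg q.2 q.1.mem
  have hpos : ∀ q : Points e (IsSpacelike e), 0 <
      -ip e q.1.D q.1.x (Nbar e q.1.D q.1.x) (Nbar e q.1.D q.1.x) *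
        ip e q.1.D q.1.x (Hbar e q.1.D q.1.x) (Hbar e q.1.D q.1.x) := fun q => by
    rw [(hK q).ip_Hbar_Hbar]
    exact mul_pos (neg_pos.2 (hneg q)) (mul_pos (hK q).ip_Hbar_Hbar_coef_pos (neg_pos.2 (hneg q)))
  have hSN : FunctionOf 1 (fun q : Points e (IsSpacelike e) => argSpacelike q.1)
      fun q => SNbar e q.1.D q.1.x :=
    .sum _ fun a => (s_argSpacelike a).mul (hR.psi.low hR.Nbar a.succ)
  have h1 := (FunctionOf.eps (hR.Ebar hK) (hR.slash hK (.spatial om_argSpacelike)) hR.Nbar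
    ((VecFunctionOf.spatial s_argSpacelike).add (.smul hSN hR.psi.B))).mul
    ((((hR.psi.snd_inv_pow 2).pow 3).mul (((hR.psi.ip hR.Nbar hR.Nbar).neg.mul
      (hR.psi.ip hR.Hbar hR.Hbar)).inv fun q => (hpos q).ne')).sqrt fun q =>
        (mul_pos (pow_pos (inv_pos.2 (pow_pos (snd_pos e q.1.D q.1.x) 2)) 3)
          (inv_pos.2 (hpos q))).ne')
  exact (h1.of_le zero_le_one).congr fun q => (hK q).sigma_mul_sqrt_gram (hneg q)

end Spacelike

/-! ### Null boundaries -/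

section Null

variable {e : EquationOfState}

theorem isFrame_of_null (q : Points e (IsNull e)) : IsFrame e q.1.D q.1.x :=
  q.1.admissible.isFrame (Or.inr q.2) q.1.mem

theorem ip_Nbar_Nbar_of_null (q : Points e (IsNull e)) :
    ip e q.1.D q.1.x (Nbar e q.1.D q.1.x) (Nbar e q.1.D q.1.x) = 0 :=
  (isFrame_of_null q).ip_Nbar_Nbar_eq_zero q.2 q.1.mem

theorem Nbar_eq_Hbar_of_null (q : Points e (IsNull e)) :
    Nbar e q.1.D q.1.x = Hbar e q.1.D q.1.x :=
  (isFrame_of_null q).Nbar_eq_Hbar (ip_Nbar_Nbar_of_null q)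

theorem functionOf_argNull {F : (Fin 5 → ℝ) × (Fin 3 → ℝ) × (Fin 3 → ℝ) × Vec × Vec → ℝ}
    (hF : ContDiff ℝ 1 F) : FunctionOf 1 (fun q : Points e (IsNull e) => argNull q.1)
      fun q => F (argNull q.1) := .of_contDiff hF

theorem frameArray_argNull : FrameArray fun q : Points e (IsNull e) => argNull q.1 :=
  .of_N_Nbar isFrame_of_null (fun J => functionOf_argNull (F := fun a => a.1 J) (by fun_prop))
    (fun α => functionOf_argNull (F := fun a => a.2.2.2.2 α) (by fun_prop))
    fun α => functionOf_argNull (F := fun a => a.2.2.2.1 α) (by fun_prop)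

theorem om_argNull (a : Fin 3) : FunctionOf 1 (fun q : Points e (IsNull e) => argNull q.1)
    fun q => Om q.1.D a q.1.x := functionOf_argNull (F := fun u => u.2.1 a) (by fun_prop)

theorem s_argNull (a : Fin 3) : FunctionOf 1 (fun q : Points e (IsNull e) => argNull q.1)
    fun q => S q.1.D a q.1.x := functionOf_argNull (F := fun u => u.2.2.1 a) (by fun_prop)

/-- The array `(Ψ, H̲, Z)`, of which the geometric quantities along a null boundary are functions:
`N` is recovered from `H̲ = N̲ = p N - z̲ Z` with `p = 1 + z̲ Z⁰`. -/
def nullArray (e : EquationOfState) (D : Config) (x : Vec) : Fin 5 ⊕ Fin 4 ⊕ Fin 4 → ℝ :=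
  Sum.elim (fun J => Psi D J x) (Sum.elim (Hbar e D x) (Z e D x))

theorem frameArray_nullArray :
    FrameArray fun q : Points e (IsNull e) => nullArray e q.1.D q.1.x := by
  have hΨ : FluidArray fun q : Points e (IsNull e) => nullArray e q.1.D q.1.x :=
    fun J => .coord (Sum.inl J)
  have hH : VecFunctionOf (fun q : Points e (IsNull e) => nullArray e q.1.D q.1.x)
      fun q => Hbar e q.1.D q.1.x := fun α => .coord (Sum.inr (Sum.inl α))
  have hZ : VecFunctionOf (fun q : Points e (IsNull e) => nullArray e q.1.D q.1.x)
      fun q => Z e q.1.D q.1.x := fun α => .coord (Sum.inr (Sum.inr α))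
  have hz : FunctionOf 1 (fun q : Points e (IsNull e) => nullArray e q.1.D q.1.x)
      fun q => zbar e q.1.D q.1.x :=
    (hΨ.ip hZ hH).neg.congr fun q => by rw [zbar, Nbar_eq_Hbar_of_null]
  have hp : FunctionOf 1 (fun q : Points e (IsNull e) => nullArray e q.1.D q.1.x)
      fun q => tilt e q.1.D q.1.x :=
    ((FunctionOf.const 1).add (hz.mul (hZ 0))).congr fun q => (isFrame_of_null q).tilt_eq
  have hp0 := fun q : Points e (IsNull e) =>
    ((isFrame_of_null q).tilt_pos (ip_Nbar_Nbar_of_null q)).ne'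
  refine .of_N_Z_Hbar isFrame_of_null hΨ ?_ hZ hH
  refine (VecFunctionOf.smul (hp.inv hp0) (hH.add (.smul hz hZ))).congr fun q => ?_
  have h1 := (isFrame_of_null q).Nbar_decomp
  rw [Nbar_eq_Hbar_of_null] at h1
  rw [h1, sub_add_cancel, smul_smul, inv_mul_cancel₀ (hp0 q), one_smul]

theorem differentiableWithinAt_nullArray (q : Points e (IsNull e)) (j : Fin 5 ⊕ Fin 4 ⊕ Fin 4) :
    DifferentiableWithinAt ℝ (fun y => nullArray e q.1.D y j) q.1.D.H q.1.x := by
  have h := q.1.admissible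
  rcases j with J | α | α
  · exact (h.differentiableAt_Psi (h.mem_O q.1.mem) J).differentiableWithinAt
  · exact (h.differentiableWithinAt_frame (Or.inr q.2) q.1.mem α).2
  · exact (h.differentiableWithinAt_frame (Or.inr q.2) q.1.mem α).1

theorem coef_nullArray (j : Fin 5 ⊕ Fin 4 ⊕ Fin 4) :
    FunctionOf 0 (fun q : Points e (IsNull e) => argNull q.1)
      fun q => nullArray e q.1.D q.1.x j := by
  rcases j with J | α | α
  · exact (frameArray_argNull.psi J).of_le zero_le_one
  · exact (frameArray_argNull.Hbar α).of_le zero_le_one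
  · exact (frameArray_argNull.Z α).of_le zero_le_one

theorem along_Hbar_Psi (q : Points e (IsNull e)) (J : Fin 5) :
    along q.1.D (Hbar e q.1.D q.1.x) (Psi q.1.D J) q.1.x = nullPsi q.1 J := by
  rw [nullPsi, Nbar_eq_Hbar_of_null]
  exact along_eq_dir (q.1.admissible.differentiableAt_Psi (q.1.admissible.mem_O q.1.mem) J)
    (isFrame_of_null q).Hbar_mem

theorem along_angVec_Psi (q : Points e (IsNull e)) (δ : Fin 4) (J : Fin 5) :
    along q.1.D (angVec e q.1.D δ q.1.x) (Psi q.1.D J) q.1.x = angPsi q.1 (δ, J) :=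
  along_eq_dir (q.1.admissible.differentiableAt_Psi (q.1.admissible.mem_O q.1.mem) J)
    ((isFrame_of_null q).mem_TH_of_isSphere ((isFrame_of_null q).isSphere_angVec δ))

open scoped Pointwise in
/-- For integrands in which only the fluid variables are differentiated, no derivatives of `∂τ` are
needed. -/
theorem isDerivModule_arrNull_Psi :
    IsDerivModule (fun q : Points e (IsNull e) => argNull q.1) (fun D x J => Psi D J x)
      (Schematic (fun q : Points e (IsNull e) => argNull q.1) (fun q => arrNull q.1)
        + Schematic (fun q : Points e (IsNull e) => argNull q.1) fun q => arrLow q.1) where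
  frame := isFrame_of_null
  isCoefModule := (isCoefModule_schematic id).set_add (isCoefModule_schematic id)
  frameArray := frameArray_argNull
  coef J := coef_nullArray (Sum.inl J)
  diff q J := differentiableWithinAt_nullArray q (Sum.inl J)
  ang δ J := IsCoefModule.mem_add_left
    (isCoefModule_schematic (A' := fun q : Points e (IsNull e) => argNull q.1) id)
    (schematic_coord (Sum.inr (Sum.inl (δ, J))) fun q => along_angVec_Psi q δ J)
  gen J := IsCoefModule.mem_add_left
    (isCoefModule_schematic (A' := fun q : Points e (IsNull e) => argNull q.1) id)
    (schematic_coord (Sum.inl J) fun q => along_Hbar_Psi q J)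

/-- The components of `dτ / Bτ`. They agree up to sign with those of `N` with lowered index, so that a
function of them is a function of `Ψ` and `N`. -/
def normTau (D : Config) (α : Fin 4) (x : Vec) : ℝ := pd α D.tau x / tauRate D x

theorem low_N {D : Config} {x : Vec} (α : Fin 4) : low e D x (N e D x) α = -normTau D α x := by
  rw [low_eq_ip, ip_N_left]
  change -(tauRate D x)⁻¹ * pd α D.tau x = _
  rw [normTau]
  ring

/-- The array `(Ψ, dτ / Bτ, Z)`. It determines `N`, hence also `L̲`, along a null boundary: the null
vector `L̲` is the multiple of `N / ν - Z` with time component one. So the derivative `L̲L̲` can be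
expressed through `L̲Ψ`, `L̲Z` and `L̲∂τ`. -/
def nullTauArray (e : EquationOfState) (D : Config) (x : Vec) : Fin 5 ⊕ Fin 4 ⊕ Fin 4 → ℝ :=
  Sum.elim (fun J => Psi D J x) (Sum.elim (fun α => normTau D α x) (Z e D x))

theorem Hbar_nullTauArray :
    VecFunctionOf (fun q : Points e (IsNull e) => nullTauArray e q.1.D q.1.x)
      fun q => Hbar e q.1.D q.1.x := by
  have hK := isFrame_of_null (e := e)
  have hΨ : FluidArray fun q : Points e (IsNull e) => nullTauArray e q.1.D q.1.x :=
    fun J => .coord (Sum.inl J)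
  have hZ : VecFunctionOf (fun q : Points e (IsNull e) => nullTauArray e q.1.D q.1.x)
      fun q => Z e q.1.D q.1.x := fun α => .coord (Sum.inr (Sum.inr α))
  have hN : VecFunctionOf (fun q : Points e (IsNull e) => nullTauArray e q.1.D q.1.x)
      fun q => N e q.1.D q.1.x :=
    (hΨ.raise (w := fun q α => -normTau q.1.D α q.1.x)
      fun α => (FunctionOf.coord (Sum.inr (Sum.inl α))).neg).congr fun q => by
        rw [← raise_low (e := e) (D := q.1.D) (x := q.1.x) (N e q.1.D q.1.x)]
        congr 1
        exact funext fun α => low_N α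
  have hν : FunctionOf 1 (fun q : Points e (IsNull e) => nullTauArray e q.1.D q.1.x)
      fun q => nu e q.1.D q.1.x :=
    (hΨ.ip hN hN).neg.sqrt fun q => (neg_pos.2 (hK q).ip_NN).ne'
  have hzq : ∀ q : Points e (IsNull e), zbar e q.1.D q.1.x *
      ((nu e q.1.D q.1.x)⁻¹ - Z e q.1.D q.1.x 0) = 1 := fun q => by
    have h1 := (hK q).zbar_eq_of_null (ip_Nbar_Nbar_of_null q)
    have h2 := (hK q).tilt_eq
    have h3 := (hK q).nu_pos.ne'
    have h4 : zbar e q.1.D q.1.x * (nu e q.1.D q.1.x)⁻¹ = tilt e q.1.D q.1.x := by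
      rw [h1]; field_simp
    rw [mul_sub, h4, h2]
    ring
  have hz : FunctionOf 1 (fun q : Points e (IsNull e) => nullTauArray e q.1.D q.1.x)
      fun q => zbar e q.1.D q.1.x :=
    (((hν.inv fun q => (hK q).nu_pos.ne').sub (hZ 0)).inv
      fun q => right_ne_zero_of_mul_eq_one (hzq q)).congr fun q => eq_inv_of_mul_eq_one_left (hzq q)
  have hp : FunctionOf 1 (fun q : Points e (IsNull e) => nullTauArray e q.1.D q.1.x)
      fun q => tilt e q.1.D q.1.x :=
    ((FunctionOf.const 1).add (hz.mul (hZ 0))).congr fun q => (hK q).tilt_eq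
  exact ((VecFunctionOf.smul hp hN).sub (.smul hz hZ)).congr fun q => by
    rw [← Nbar_eq_Hbar_of_null, ← (hK q).Nbar_decomp]

theorem normTau_argNull (α : Fin 4) : FunctionOf 1 (fun q : Points e (IsNull e) => argNull q.1)
    fun q => normTau q.1.D α q.1.x :=
  (frameArray_argNull.psi.low frameArray_argNull.N α).neg.congr fun q => by rw [low_N, neg_neg]

theorem coef_nullTauArray (j : Fin 5 ⊕ Fin 4 ⊕ Fin 4) :
    FunctionOf 0 (fun q : Points e (IsNull e) => argNull q.1)
      fun q => nullTauArray e q.1.D q.1.x j := by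
  rcases j with J | α | α
  · exact (frameArray_argNull.psi J).of_le zero_le_one
  · exact (normTau_argNull α).of_le zero_le_one
  · exact (frameArray_argNull.Z α).of_le zero_le_one

theorem differentiableAt_normTau (q : Points e (IsNull e)) (α : Fin 4) :
    DifferentiableAt ℝ (normTau q.1.D α) q.1.x := by
  have h := q.1.admissible
  have hO := h.mem_O q.1.mem
  have h1 : DifferentiableAt ℝ (fun y => (tauRate q.1.D y)⁻¹) q.1.x :=
    (h.differentiableAt_tauRate hO).inv (isFrame_of_null q).tau_pos.ne'
  have h2 : normTau q.1.D α = fun y => pd α q.1.D.tau y * (tauRate q.1.D y)⁻¹ :=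
    funext fun y => div_eq_mul_inv _ _
  rw [h2]
  exact (h.differentiableAt_pd_tau hO α).mul h1

theorem differentiableWithinAt_nullTauArray (q : Points e (IsNull e))
    (j : Fin 5 ⊕ Fin 4 ⊕ Fin 4) :
    DifferentiableWithinAt ℝ (fun y => nullTauArray e q.1.D y j) q.1.D.H q.1.x := by
  rcases j with J | α | α
  · exact differentiableWithinAt_nullArray q (Sum.inl J)
  · exact (differentiableAt_normTau q α).differentiableWithinAt
  · exact differentiableWithinAt_nullArray q (Sum.inr (Sum.inr α))

theorem functionOf_argNullTau_of_argNull {n : WithTop ℕ∞} {f : Points e (IsNull e) → ℝ}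
    (hf : FunctionOf n (fun q : Points e (IsNull e) => argNull q.1) f) :
    FunctionOf n (fun q : Points e (IsNull e) => argNullTau q.1) f :=
  FunctionOf.comp_contDiff (Φ := fun a : (Fin 5 → ℝ) × (Fin 3 → ℝ) × (Fin 3 → ℝ) × Vec × Vec ×
    (Fin 4 → ℝ) => (a.1, a.2.1, a.2.2.1, a.2.2.2.1, a.2.2.2.2.1)) hf (by fun_prop)

end Null

/-! ### Second derivatives of the time function along a null boundary -/

section NullTau

variable {e : EquationOfState}

/-- Along a null boundary `L̲(Bτ) / Bτ` is controlled by `L̲Ψ` and `L̲∂τ / Bτ`. -/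
theorem along_tauRate_mem {T : Set (Points e (IsNull e) → ℝ)}
    (hT : IsCoefModule (fun q : Points e (IsNull e) => argNull q.1) T)
    (hΨ : ∀ J, (fun q : Points e (IsNull e) =>
      along q.1.D (Hbar e q.1.D q.1.x) (Psi q.1.D J) q.1.x) ∈ T)
    (hτ : ∀ α, (fun q : Points e (IsNull e) =>
      along q.1.D (Hbar e q.1.D q.1.x) (pd α q.1.D.tau) q.1.x / tauRate q.1.D q.1.x) ∈ T) :
    (fun q : Points e (IsNull e) =>
      along q.1.D (Hbar e q.1.D q.1.x) (tauRate q.1.D) q.1.x / tauRate q.1.D q.1.x) ∈ T := by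
  have hB : ∀ α, (fun q : Points e (IsNull e) =>
      along q.1.D (Hbar e q.1.D q.1.x) (fun y => B q.1.D y α) q.1.x) ∈ T := fun α => by
    refine Fin.cases ?_ (fun i => ?_) α
    · refine IsCoefModule.congr hT.zero fun q => ?_
      exact along_eq (f := fun _ => 1) (f' := 0) (hasFDerivWithinAt_const 1 _ _)
        (isFrame_of_null q).Hbar_mem
    · fin_cases i
      exacts [hΨ 1, hΨ 2, hΨ 3]
  refine IsCoefModule.congr (hT.sum Finset.univ fun α => hT.add
    (hT.mul ((frameArray_argNull.psi.B α).of_le zero_le_one) (hτ α))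
    (hT.mul ((normTau_argNull α).of_le zero_le_one) (hB α))) fun q => ?_
  have h := q.1.admissible
  have hO := h.mem_O q.1.mem
  have h1 : HasFDerivWithinAt (tauRate q.1.D) (∑ α, (B q.1.D q.1.x α •
      fderivWithin ℝ (pd α q.1.D.tau) q.1.D.H q.1.x +
        pd α q.1.D.tau q.1.x • fderivWithin ℝ (fun y => B q.1.D y α) q.1.D.H q.1.x))
      q.1.D.H q.1.x := by
    have h2 : tauRate q.1.D = fun y => ∑ α, B q.1.D y α * pd α q.1.D.tau y :=
      funext fun y => dir_eq_sum _ _ _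
    rw [h2]
    exact HasFDerivWithinAt.fun_sum fun α _ =>
      (h.differentiableAt_B hO α).differentiableWithinAt.hasFDerivWithinAt.mul
        (h.differentiableAt_pd_tau hO α).differentiableWithinAt.hasFDerivWithinAt
  rw [along_eq h1 (isFrame_of_null q).Hbar_mem]
  simp only [sum_apply, add_apply,
    smul_apply, smul_eq_mul, Finset.sum_div, normTau, along]
  exact Finset.sum_congr rfl fun α _ => by ring

/-- The quotient rule for `dτ / Bτ`. -/
theorem along_normTau_mem {T : Set (Points e (IsNull e) → ℝ)}
    (hT : IsCoefModule (fun q : Points e (IsNull e) => argNull q.1) T)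
    (hΨ : ∀ J, (fun q : Points e (IsNull e) =>
      along q.1.D (Hbar e q.1.D q.1.x) (Psi q.1.D J) q.1.x) ∈ T)
    (hτ : ∀ α, (fun q : Points e (IsNull e) =>
      along q.1.D (Hbar e q.1.D q.1.x) (pd α q.1.D.tau) q.1.x / tauRate q.1.D q.1.x) ∈ T)
    (α : Fin 4) : (fun q : Points e (IsNull e) =>
      along q.1.D (Hbar e q.1.D q.1.x) (normTau q.1.D α) q.1.x) ∈ T := by
  refine IsCoefModule.congr (hT.sub (hτ α) (hT.mul ((normTau_argNull α).of_le zero_le_one)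
    (along_tauRate_mem hT hΨ hτ))) fun q => ?_
  have h := q.1.admissible
  have hK := isFrame_of_null q
  have h1 : along q.1.D (Hbar e q.1.D q.1.x) (pd α q.1.D.tau) q.1.x =
      normTau q.1.D α q.1.x * along q.1.D (Hbar e q.1.D q.1.x) (tauRate q.1.D) q.1.x +
        tauRate q.1.D q.1.x * along q.1.D (Hbar e q.1.D q.1.x) (normTau q.1.D α) q.1.x := by
    rw [← along_mul (differentiableAt_normTau q α).differentiableWithinAt
      (h.differentiableAt_tauRate (h.mem_O q.1.mem)).differentiableWithinAt hK.Hbar_mem]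
    refine along_congr q.1.mem fun y hy => ?_
    have h2 : tauRate q.1.D y ≠ 0 :=
      (isFrame_of_null ⟨⟨q.1.D, q.1.admissible, y, hy⟩, q.2⟩).tau_pos.ne'
    rw [normTau, div_mul_cancel₀ _ h2]
  have h3 : tauRate q.1.D q.1.x ≠ 0 := hK.tau_pos.ne'
  rw [h1]
  field_simp
  ring

/-- Since `L̲` is a function of `Ψ`, `dτ / Bτ` and `Z`, its derivative along itself is controlled by
`L̲Ψ`, `L̲Z` and `L̲∂τ / Bτ`. -/
theorem along_Hbar_Hbar_mem {T : Set (Points e (IsNull e) → ℝ)}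
    (hT : IsCoefModule (fun q : Points e (IsNull e) => argNull q.1) T)
    (hΨ : ∀ J, (fun q : Points e (IsNull e) =>
      along q.1.D (Hbar e q.1.D q.1.x) (Psi q.1.D J) q.1.x) ∈ T)
    (hZ : ∀ α, (fun q : Points e (IsNull e) =>
      along q.1.D (Hbar e q.1.D q.1.x) (fun y => Z e q.1.D y α) q.1.x) ∈ T)
    (hτ : ∀ α, (fun q : Points e (IsNull e) =>
      along q.1.D (Hbar e q.1.D q.1.x) (pd α q.1.D.tau) q.1.x / tauRate q.1.D q.1.x) ∈ T)
    (α : Fin 4) : (fun q : Points e (IsNull e) =>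
      along q.1.D (Hbar e q.1.D q.1.x) (fun y => Hbar e q.1.D y α) q.1.x) ∈ T := by
  obtain ⟨-, c, hc, hq⟩ := FunctionOf.exists_along_eq (f := fun D y => Hbar e D y α)
    (Hbar_nullTauArray α) differentiableWithinAt_nullTauArray
  refine IsCoefModule.congr (hT.sum Finset.univ fun j =>
    hT.mul ((hc j).comp coef_nullTauArray) (?_ : (fun q : Points e (IsNull e) =>
      along q.1.D (Hbar e q.1.D q.1.x) (fun y => nullTauArray e q.1.D y j) q.1.x) ∈ T))
    fun q => hq q _ (isFrame_of_null q).Hbar_mem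
  rcases j with J | β | β
  · exact hΨ J
  · exact along_normTau_mem hT hΨ hτ β
  · exact hZ β

theorem tauRate_inv_argNullTau : FunctionOf 0 (fun q : Points e (IsNull e) => argNullTau q.1)
    fun q => (tauRate q.1.D q.1.x)⁻¹ := by
  have hΨ : FluidArray fun q : Points e (IsNull e) => argNullTau q.1 := fun J =>
    functionOf_argNullTau_of_argNull (frameArray_argNull.psi J)
  have hτ : ∀ α, FunctionOf 1 (fun q : Points e (IsNull e) => argNullTau q.1)
      fun q => pd α q.1.D.tau q.1.x := fun α =>
    FunctionOf.of_contDiff (A := fun q : Points e (IsNull e) => argNullTau q.1)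
      (F := fun a : (Fin 5 → ℝ) × (Fin 3 → ℝ) × (Fin 3 → ℝ) × Vec × Vec × (Fin 4 → ℝ) =>
        a.2.2.2.2.2 α) (by fun_prop)
  exact ((hΨ.tauRate hτ).inv fun q => (isFrame_of_null q).tau_pos.ne').of_le zero_le_one

theorem along_pd_tau_div_tauRate_mem (α : Fin 4) : (fun q : Points e (IsNull e) =>
    along q.1.D (Hbar e q.1.D q.1.x) (pd α q.1.D.tau) q.1.x / tauRate q.1.D q.1.x) ∈
      Schematic (fun q : Points e (IsNull e) => argNullTau q.1) fun q => nullDtau q.1 := by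
  refine IsCoefModule.congr ((isCoefModule_schematic
    (A' := fun q : Points e (IsNull e) => argNullTau q.1) id).mul tauRate_inv_argNullTau
      (schematic_coord α fun q => rfl)) fun q => ?_
  rw [nullDtau, Nbar_eq_Hbar_of_null, along_eq_dir (q.1.admissible.differentiableAt_pd_tau
    (q.1.admissible.mem_O q.1.mem) α) (isFrame_of_null q).Hbar_mem, div_eq_mul_inv, mul_comm]

open scoped Pointwise in
/-- The class of functions in which the integrands `𝔥[V]` are found along a null boundary. -/
def nullClass (e : EquationOfState) : Set (Points e (IsNull e) → ℝ) :=
  Schematic (fun q : Points e (IsNull e) => argNull q.1) (fun q => arrNull q.1)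
    + Schematic (fun q : Points e (IsNull e) => argNullTau q.1) (fun q => nullDtau q.1)
    + Schematic (fun q : Points e (IsNull e) => argNull q.1) (fun q => arrLow q.1)

theorem isCoefModule_schematic_argNull {ι : Type} [Fintype ι]
    (b : Points e (IsNull e) → ι → ℝ) :
    IsCoefModule (fun q : Points e (IsNull e) => argNull q.1)
      (Schematic (fun q : Points e (IsNull e) => argNull q.1) b) := isCoefModule_schematic id

theorem isCoefModule_nullDtau :
    IsCoefModule (fun q : Points e (IsNull e) => argNull q.1)
      (Schematic (fun q : Points e (IsNull e) => argNullTau q.1) fun q => nullDtau q.1) :=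
  isCoefModule_schematic functionOf_argNullTau_of_argNull

theorem isCoefModule_nullClass :
    IsCoefModule (fun q : Points e (IsNull e) => argNull q.1) (nullClass e) :=
  ((isCoefModule_schematic_argNull _).set_add isCoefModule_nullDtau).set_add
    (isCoefModule_schematic_argNull _)

theorem mem_nullClass_of_arrNull {f : Points e (IsNull e) → ℝ}
    (i : Fin 5 ⊕ (Fin 4 × Fin 5) ⊕ (Fin 4 × Fin 4) ⊕ Fin 4 ⊕ (Fin 4 × Fin 4))
    (h : ∀ q, f q = arrNull q.1 i) : f ∈ nullClass e :=
  IsCoefModule.mem_add_left (isCoefModule_schematic_argNull _)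
    (IsCoefModule.mem_add_left isCoefModule_nullDtau (schematic_coord i h))

theorem mem_nullClass_of_nullDtau {f : Points e (IsNull e) → ℝ}
    (h : f ∈ Schematic (fun q : Points e (IsNull e) => argNullTau q.1) fun q => nullDtau q.1) :
    f ∈ nullClass e :=
  IsCoefModule.mem_add_left (isCoefModule_schematic_argNull _)
    (IsCoefModule.mem_add_right (isCoefModule_schematic_argNull _) h)

theorem along_Hbar_Z_mem_nullClass (α : Fin 4) : (fun q : Points e (IsNull e) =>
    along q.1.D (Hbar e q.1.D q.1.x) (fun y => Z e q.1.D y α) q.1.x) ∈ nullClass e :=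
  mem_nullClass_of_arrNull (Sum.inr (Sum.inr (Sum.inr (Sum.inl α)))) fun q => by
    rw [← Nbar_eq_Hbar_of_null]; rfl

theorem along_Hbar_Psi_mem_nullClass (J : Fin 5) : (fun q : Points e (IsNull e) =>
    along q.1.D (Hbar e q.1.D q.1.x) (Psi q.1.D J) q.1.x) ∈ nullClass e :=
  mem_nullClass_of_arrNull (Sum.inl J) fun q => along_Hbar_Psi q J

theorem isDerivModule_nullClass :
    IsDerivModule (fun q : Points e (IsNull e) => argNull q.1) (nullArray e) (nullClass e) where
  frame := isFrame_of_null
  isCoefModule := isCoefModule_nullClass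
  frameArray := frameArray_argNull
  coef := coef_nullArray
  diff := differentiableWithinAt_nullArray
  ang δ j := by
    rcases j with J | α | α
    · exact mem_nullClass_of_arrNull (Sum.inr (Sum.inl (δ, J))) fun q => along_angVec_Psi q δ J
    · exact mem_nullClass_of_arrNull (Sum.inr (Sum.inr (Sum.inl (δ, α)))) fun q =>
        along_congr q.1.mem fun y hy => congrFun
          (Nbar_eq_Hbar_of_null ⟨⟨q.1.D, q.1.admissible, y, hy⟩, q.2⟩).symm α
    · exact mem_nullClass_of_arrNull (Sum.inr (Sum.inr (Sum.inr (Sum.inr (δ, α))))) fun q => rfl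
  gen j := by
    rcases j with J | α | α
    · exact along_Hbar_Psi_mem_nullClass J
    · exact along_Hbar_Hbar_mem isCoefModule_nullClass along_Hbar_Psi_mem_nullClass
        along_Hbar_Z_mem_nullClass
        (fun β => mem_nullClass_of_nullDtau (along_pd_tau_div_tauRate_mem β)) α
    · exact along_Hbar_Z_mem_nullClass α

/-- The second derivatives of `τ` enter through the lapse and through the derivative of `L̲` along
itself. -/
theorem errV_mem_nullClass {V : Points e (IsNull e) → Vec}
    (hV : VecFunctionOf (fun q : Points e (IsNull e) => argNull q.1) V) :
    (fun q : Points e (IsNull e) => errV e q.1.D q.1.x (V q)) ∈ nullClass e :=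
  isDerivModule_nullClass.errV_mem frameArray_nullArray
    (along_tauRate_mem isCoefModule_nullClass along_Hbar_Psi_mem_nullClass
      fun α => mem_nullClass_of_nullDtau (along_pd_tau_div_tauRate_mem α)) hV

end NullTau

/-! ### The integrands `𝔥_(1)[Ω]` and `𝔥_(2)[S]` on both kinds of boundary -/

section Integrands

variable {e : EquationOfState}

open scoped Pointwise in
theorem errOne_mem_spacelike : (fun q : Points e (IsSpacelike e) => errOne e q.1.D q.1.x) ∈
    Schematic (fun q : Points e (IsSpacelike e) => argSpacelike q.1) (fun q => arrSideAng q.1)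
      + Schematic (fun q : Points e (IsSpacelike e) => argSpacelike q.1) fun q => arrLow q.1 := by
  have hT : IsCoefModule (fun q : Points e (IsSpacelike e) => argSpacelike q.1)
      (Schematic (fun q : Points e (IsSpacelike e) => argSpacelike q.1)
        fun q => arrSideAng q.1) := isCoefModule_schematic id
  exact isDerivModule_arrSideAng.errOne_mem (fun J => .coord J)
    (fun q => ((isFrame_of_spacelike q).ip_Nbar_Nbar_neg q.2 q.1.mem).le)
    om_argSpacelike s_argSpacelike sigma_mul_sqrt_gram_argSpacelike
    (fun a => IsCoefModule.mem_add_right hT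
      (schematic_coord (Sum.inr (Sum.inl a)) fun q => rfl))
    (fun a => IsCoefModule.mem_add_right hT
      (schematic_coord (Sum.inr (Sum.inr a)) fun q => rfl))

open scoped Pointwise in
theorem errTwo_mem_spacelike : (fun q : Points e (IsSpacelike e) => errTwo e q.1.D q.1.x) ∈
    Schematic (fun q : Points e (IsSpacelike e) => argSpacelike q.1) (fun q => arrSideAng q.1)
      + Schematic (fun q : Points e (IsSpacelike e) => argSpacelike q.1) fun q => arrLow q.1 :=
  isDerivModule_arrSideAng.errTwo_mem (fun J => .coord J) (.spatial s_argSpacelike)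

open scoped Pointwise in
theorem errOne_mem_null : (fun q : Points e (IsNull e) => errOne e q.1.D q.1.x) ∈
    Schematic (fun q : Points e (IsNull e) => argNull q.1) (fun q => arrNull q.1)
      + Schematic (fun q : Points e (IsNull e) => argNull q.1) fun q => arrLow q.1 := by
  have hσ : FunctionOf 0 (fun q : Points e (IsNull e) => argNull q.1)
      fun q => sigma e q.1.D q.1.x * Real.sqrt (gram e q.1.D q.1.x) :=
    (FunctionOf.const 0).congr fun q => by
      rw [(isFrame_of_null q).sigma_eq_zero (ip_Nbar_Nbar_of_null q), zero_mul]
  exact isDerivModule_arrNull_Psi.errOne_mem (fun J => .coord J)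
    (fun q => (ip_Nbar_Nbar_of_null q).le) om_argNull s_argNull hσ
    (fun a => IsCoefModule.mem_add_right (isCoefModule_schematic_argNull _)
      (schematic_coord (Sum.inr (Sum.inl a)) fun q => rfl))
    (fun a => IsCoefModule.mem_add_right (isCoefModule_schematic_argNull _)
      (schematic_coord (Sum.inr (Sum.inr a)) fun q => rfl))

open scoped Pointwise in
theorem errTwo_mem_null : (fun q : Points e (IsNull e) => errTwo e q.1.D q.1.x) ∈
    Schematic (fun q : Points e (IsNull e) => argNull q.1) (fun q => arrNull q.1)
      + Schematic (fun q : Points e (IsNull e) => argNull q.1) fun q => arrLow q.1 :=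
  isDerivModule_arrNull_Psi.errTwo_mem (fun J => .coord J) (.spatial s_argNull)

end Integrands

end EulerBoundary

end

open scoped Pointwise in
open EulerBoundary in
theorem theorem6p3 (e : EquationOfState) :
    (∀ h ∈ ({errOm, errS} : Set (BoundaryPoint e → ℝ)),
      (fun q : SpacelikePoint e => h q.1) ∈
        Schematic (fun q : SpacelikePoint e => argSpacelike q.1) (fun q => arrSide q.1)
          + Schematic (fun q : SpacelikePoint e => argSpacelike q.1) (fun q => arrLow q.1)) ∧
    (∀ h ∈ ({errOneOm, errTwoS} : Set (BoundaryPoint e → ℝ)),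
      (fun q : SpacelikePoint e => h q.1) ∈
        Schematic (fun q : SpacelikePoint e => argSpacelike q.1) (fun q => arrSideAng q.1)
          + Schematic (fun q : SpacelikePoint e => argSpacelike q.1) (fun q => arrLow q.1)) ∧
    (∀ q : NullPoint e, Nbar e q.1.D q.1.x = Hbar e q.1.D q.1.x) ∧
    (∀ h ∈ ({errOm, errS} : Set (BoundaryPoint e → ℝ)),
      (fun q : NullPoint e => h q.1) ∈
        Schematic (fun q : NullPoint e => argNull q.1) (fun q => arrNull q.1)
          + Schematic (fun q : NullPoint e => argNullTau q.1) (fun q => nullDtau q.1)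
          + Schematic (fun q : NullPoint e => argNull q.1) (fun q => arrLow q.1)) ∧
    (∀ h ∈ ({errOneOm, errTwoS} : Set (BoundaryPoint e → ℝ)),
      (fun q : NullPoint e => h q.1) ∈
        Schematic (fun q : NullPoint e => argNull q.1) (fun q => arrNull q.1)
          + Schematic (fun q : NullPoint e => argNull q.1) (fun q => arrLow q.1)) := by
  refine ⟨?_, ?_, Nbar_eq_Hbar_of_null, ?_, ?_⟩
  · rintro h (rfl | rfl)
    · exact errV_mem_spacelike (.spatial om_argSpacelike)
    · exact errV_mem_spacelike (.spatial s_argSpacelike)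
  · rintro h (rfl | rfl)
    · exact errOne_mem_spacelike
    · exact errTwo_mem_spacelike
  · rintro h (rfl | rfl)
    · exact errV_mem_nullClass (.spatial om_argNull)
    · exact errV_mem_nullClass (.spatial s_argNull)
  · rintro h (rfl | rfl)
    · exact errOne_mem_null
    · exact errTwo_mem_null
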